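/- Let $w_0\in\mathbb R^d$, $\sigma_0\ge 0$, and let $\mathcal D_n=\{(x_i,y_i)\}_{i\le n}$ be i.i.d. copies of $(x,y)$ with $y=x^\top w_0+z$, where $x\sim N(0,I_d)$ and $z\sim N(0,\sigma_0^2)$ are independent. For $w\in\mathbb R^d$ and $r\ge 0$ let $$E(w,r)=\mathbb E\sup_{\|\delta\|_2\le r}\big((x+\delta)^\top w-y\big)^2,\qquad \Delta(w)=\frac{E(w,0)-\sigma_0^2}{\|w_0\|_2^2},\qquad E_{opt}(r,\epsilon)=\inf\{E(w,r): \Delta(w)=\epsilon^2\}.$$ For $s\ge 0$ let $$\widehat E(w,s)=\frac1n\sum_{i=1}^n\sup_{\|\delta\|_2\le s}\big((x_i+\delta)^\top w-y_i\big)^2,\qquad F(w,s)=\frac1n\sum_{i=1}^n(x_i^\top w-y_i)^2+s^2\|w\|_2^2 .$$ (1) (Reduction.) For every dataset with $n\ge 1$ and all $s\ge 0$, $F(w,s)\le\widehat E(w,s)\le 2F(w,s)$ for every $w\in\mathbb R^d$, and $F(\cdot,s)$ has a minimizer over $\mathbb R^d$; if $s>0$, the minimizer is unique and is the ridge estimator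 $(X^\top X/n+tI_d)^{-1}X^\top Y/n$ with $t=s^2$, where $X\in\mathbb R^{n\times d}$ has rows $x_i^\top$ and $Y=(y_1,\dots,y_n)$. Let $\widehat w_n(s)$ denote any minimizer of $F(\cdot,s)$. (2) There are absolute constants $c,C>0$ such that the following holds for all $R,\sigma\in(0,\infty)$, $r\ge0$, $\epsilon\in[0,1)$. Let the training strength $s\ge 0$ be given by $s^2=\epsilon/(1-\epsilon)$. Assume $\|w_0\|_2^2/d\to R^2$ and $\sigma_0^2/d\to\sigma^2$ as $n,d\to\infty$ with $d/n\to\gamma$. Then for all sufficiently small $\gamma>0$ the inner limits below exist in probability (they are deterministic and depend only on $\gamma,R,\sigma,r,\epsilon$, not on the sequences), the limits as $\gamma\to0^+$ exist, and $$\lim_{\gamma\to0^+}\lim_{\substack{n,d\to\infty\\ d/n\to\gamma}}\Delta(\widehat w_n(s))=\epsilon^2,\qquad L:=\lim_{\gamma\to0^+}\lim_{\substack{n,d\to\infty\\ d/n\to\gamma}}\frac{E(\widehat w_n(s),r)}{d}\ \text{ satisfies }\ cM\le L\le CM,$$ where $M=\lim E_{opt}(r,\epsilon)/d$, a limit which exists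 and depends only on $R,\sigma,r,\epsilon$. Moreover, let $E_{opt}^{\le}(r,\epsilon)=\inf\{E(w,r):\Delta(w)\le\epsilon^2\}$. The limit $M'=\lim E^{\le}_{opt}(r,\epsilon)/d$ exists and depends only on $R,\sigma,r,\epsilon$, and $cM'\le L\le C(1+R^2/\sigma^2)M'$; if $\epsilon\le r^2/(1+r^2)$, then also $L\le CM'$. -/

import Mathlib

open MeasureTheory ProbabilityTheory Filter Topology
open scoped NNReal ENNReal

noncomputable section

namespace AdvReg

/-- Euclidean space `ℝ^d`. -/
abbrev E (d : ℕ) : Type := EuclideanSpace ℝ (Fin d)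

/-- A dataset of `n` feature-label pairs. -/
abbrev Data (n d : ℕ) : Type := Fin n → E d × ℝ

/-- The data distribution: the law of `(x, y)` with `y = ⟪x, w₀⟫ + z`, where `x ∼ N(0, I_d)` and
`z ∼ N(0, σ₀²)` are independent. -/
def sampleLaw {d : ℕ} (w₀ : E d) (σ₀ : ℝ≥0) : Measure (E d × ℝ) :=
  ((stdGaussian (E d)).prod (gaussianReal 0 (σ₀ ^ 2))).map
    (fun p => (p.1, inner ℝ p.1 w₀ + p.2))

/-- The law of a dataset of `n` i.i.d. draws from the data distribution. -/
def dataLaw (n : ℕ) {d : ℕ} (w₀ : E d) (σ₀ : ℝ≥0) : Measure (Data n d) :=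
  Measure.pi (fun _ => sampleLaw w₀ σ₀)

/-- The worst squared loss of the linear model `w` at `p = (x, y)` over all Euclidean
perturbations `δ` of the feature vector `x` with `‖δ‖ ≤ r`. -/
def advLoss {d : ℕ} (r : ℝ) (w : E d) (p : E d × ℝ) : ℝ :=
  ⨆ δ : Metric.closedBall (0 : E d) r, (inner ℝ (p.1 + (δ : E d)) w - p.2) ^ 2

/-- The (population) adversarial risk `E(w, r)`. -/
def advRisk {d : ℕ} (w₀ : E d) (σ₀ : ℝ≥0) (w : E d) (r : ℝ) : ℝ :=
  ∫ p, advLoss r w p ∂(sampleLaw w₀ σ₀)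

/-- The normalized excess standard risk `Δ(w) = (E(w, 0) - σ₀²) / ‖w₀‖²`. -/
def excessRisk {d : ℕ} (w₀ : E d) (σ₀ : ℝ≥0) (w : E d) : ℝ :=
  (advRisk w₀ σ₀ w 0 - (σ₀ : ℝ) ^ 2) / ‖w₀‖ ^ 2

/-- `E_opt(r, ε)`: the least adversarial risk of a linear model whose excess standard
risk equals `ε²`. -/
def optRisk {d : ℕ} (w₀ : E d) (σ₀ : ℝ≥0) (r ε : ℝ) : ℝ :=
  sInf ((fun w => advRisk w₀ σ₀ w r) '' {w : E d | excessRisk w₀ σ₀ w = ε ^ 2})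

/-- The variant of `E_opt(r, ε)` over the linear models whose excess standard risk
is at most `ε²`. -/
def optRiskLe {d : ℕ} (w₀ : E d) (σ₀ : ℝ≥0) (r ε : ℝ) : ℝ :=
  sInf ((fun w => advRisk w₀ σ₀ w r) '' {w : E d | excessRisk w₀ σ₀ w ≤ ε ^ 2})

/-- The empirical adversarial risk at training attack strength `s`. -/
def empAdvRisk {n d : ℕ} (D : Data n d) (s : ℝ) (w : E d) : ℝ :=
  (1 / (n : ℝ)) * ∑ i, advLoss s w (D i)

/-- The ridge objective with regularization parameter `s²`. -/
def ridgeObj {n d : ℕ} (D : Data n d) (s : ℝ) (w : E d) : ℝ :=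
  (1 / (n : ℝ)) * ∑ i, (inner ℝ (D i).1 w - (D i).2) ^ 2 + s ^ 2 * ‖w‖ ^ 2

/-- The adversarially trained model: `w` minimizes the ridge objective with parameter `s²`. -/
def IsTrained {n d : ℕ} (D : Data n d) (s : ℝ) (w : E d) : Prop :=
  ∀ w' : E d, ridgeObj D s w ≤ ridgeObj D s w'

/-- The design matrix, with rows `x_1, …, x_n`. -/
def design {n d : ℕ} (D : Data n d) : Matrix (Fin n) (Fin d) ℝ :=
  Matrix.of fun i j => (D i).1 j

/-- The response vector `(y_1, …, y_n)`. -/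
def responses {n d : ℕ} (D : Data n d) : Fin n → ℝ := fun i => (D i).2

/-- The ridge formula `(XᵀX/n + t I)⁻¹ Xᵀ y / n`. -/
def ridge {n d : ℕ} (D : Data n d) (t : ℝ) : E d :=
  WithLp.toLp 2
    (((1 / (n : ℝ)) • ((design D).transpose * design D) + t • (1 : Matrix (Fin d) (Fin d) ℝ))⁻¹.mulVec
      ((1 / (n : ℝ)) • (design D).transpose.mulVec (responses D)))

/-- Convergence in probability to a constant of random variables on varying spaces. -/
def TendstoInProb {Ω : ℕ → Type} [∀ k, MeasurableSpace (Ω k)] (P : ∀ k, Measure (Ω k))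
    (f : ∀ k, Ω k → ℝ) (l : ℝ) : Prop :=
  ∀ η : ℝ, 0 < η → Tendsto (fun k => P k {ω | η ≤ |f k ω - l|}) atTop (𝓝 0)

/-- The limit `n, d → ∞`, `d / n → γ`, along which `‖w₀‖² / d → R²` and `σ₀² / d → σ²`. -/
structure Regime (R σ γ : ℝ) (n d : ℕ → ℕ) (w₀ : ∀ k, E (d k)) (σ₀ : ℕ → ℝ≥0) : Prop where
  n_top : Tendsto n atTop atTop
  d_top : Tendsto d atTop atTop
  ratio : Tendsto (fun k => (d k : ℝ) / (n k : ℝ)) atTop (𝓝 γ)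
  signal : Tendsto (fun k => ‖w₀ k‖ ^ 2 / (d k : ℝ)) atTop (𝓝 (R ^ 2))
  noise : Tendsto (fun k => (σ₀ k : ℝ) ^ 2 / (d k : ℝ)) atTop (𝓝 (σ ^ 2))

end AdvReg

end

/-!
The reduction to ridge regression is deterministic. The inner supremum is
`(|⟪x, w⟫ - y| + s ‖w‖)²` (`advLoss_eq`), which lies between the sum of the two squares and twice
that sum, and the minimizers of the ridge objective are the solutions of the normal equation
`S w + s² w = (1/n) ∑ yᵢ xᵢ`, with `S` the sample covariance operator (`isTrained_iff`).

The residual of a fixed model `w` is a centred Gaussian variable of variance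
`τ² = ‖w - w₀‖² + σ₀²`, so the population risk is `τ² + 2 κ r ‖w‖ τ + r² ‖w‖²` with `κ = 𝔼|g|`
(`advRisk_eq`), and `Δ(w) = ‖w - w₀‖² / ‖w₀‖²`. Among the models with `Δ(w) = ε²` the norm, hence
the risk, is least at `(1 - ε) w₀` (`segRisk_le_advRisk`); this computes `optRisk` and `optRiskLe`
through one real function, `segRisk`.

The risk of the trained model only involves the norms of `ŵ - w₀` and `ŵ`. For `t = s² > 0` and
`G = (S + t)⁻¹`, the error is `ŵ - w₀ = σ₀ G T z - t G w₀`, where `T z = (1/n) ∑ zᵢ xᵢ`. Leaving one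
sample out, with the Sherman–Morrison formula, gives an approximate self-consistent equation for the
normalized trace of `G` (`abs_selfConsistent_le`); it is stable, so the trace converges to its root
`m` (`lintegral_tr_resolvent_sub_mpRoot_le`). A difference quotient in `t` gives the trace of `G²`.
By rotation invariance the forms `⟪w₀, G w₀⟫` and `‖G w₀‖²` behave as if `w₀` were a Gaussian vector,
that is, as normalized traces (`lintegral_quadForm_sq_le`). The noise, given the features, enters
through a quadratic form that concentrates around a trace and through linear forms that are
negligible.

For `t = 0` the matrix `S` has to be invertible. A net argument with exponential tail bounds shows
that `S` is bounded below by an absolute constant with high probability when `d / n` is small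
(`exists_tendsto_smallest_eigenvalue`). The ridgeless solution is then close to ridge solutions
with small parameter (`tendstoInProb_norm_sub_of_ridge`), and the limits are continuous in `t`.

As `γ → 0` the limits of `‖ŵ - w₀‖² / d` and `‖ŵ‖² / d` tend to those of the model `(1 - ε) w₀`
with `ε = t / (1 + t)`. Hence the limiting risk `L` is equal to `M`, and the comparison of `M` with
`M'` is an elementary property of `segRisk`.
-/

namespace AdvReg

/-! ### Worst-case loss and population risk -/

lemma advLoss_eq {d : ℕ} {r : ℝ} (hr : 0 ≤ r) (w : E d) (p : E d × ℝ) :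
    advLoss r w p = (|inner ℝ p.1 w - p.2| + r * ‖w‖) ^ 2 := by
  have hub : ∀ δ : Metric.closedBall (0 : E d) r,
      (inner ℝ (p.1 + (δ : E d)) w - p.2) ^ 2 ≤ (|inner ℝ p.1 w - p.2| + r * ‖w‖) ^ 2 := by
    intro δ
    have h1 : |inner ℝ (δ : E d) w| ≤ r * ‖w‖ :=
      (abs_real_inner_le_norm _ _).trans
        (mul_le_mul_of_nonneg_right (mem_closedBall_zero_iff.1 δ.2) (norm_nonneg _))
    rw [← sq_abs]
    refine pow_le_pow_left₀ (abs_nonneg _) ?_ 2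
    rw [inner_add_left]
    calc |inner ℝ p.1 w + inner ℝ (δ : E d) w - p.2|
        = |(inner ℝ p.1 w - p.2) + inner ℝ (δ : E d) w| := by ring_nf
      _ ≤ _ := (abs_add_le _ _).trans (by gcongr)
  have : Nonempty (Metric.closedBall (0 : E d) r) := ⟨⟨0, by simpa using hr⟩⟩
  refine le_antisymm (ciSup_le hub) ?_
  -- the extremal perturbation points along `± w`; for `w = 0` the formula below gives `0`
  set a : ℝ := inner ℝ p.1 w - p.2 with ha
  obtain ⟨s, hs1, hs2⟩ : ∃ s : ℝ, |s| = 1 ∧ s * |a| = a := by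
    rcases le_total 0 a with h | h
    · exact ⟨1, by simp, by rw [abs_of_nonneg h]; ring⟩
    · exact ⟨-1, by simp, by rw [abs_of_nonpos h]; ring⟩
  have hmem : (s * r / ‖w‖) • w ∈ Metric.closedBall (0 : E d) r := by
    rw [mem_closedBall_zero_iff, norm_smul, Real.norm_eq_abs, abs_div, abs_mul, hs1, abs_norm,
      abs_of_nonneg hr, one_mul]
    rcases eq_or_ne ‖w‖ 0 with h | h
    · simpa [h] using hr
    · rw [div_mul_cancel₀ _ h]
  refine le_ciSup_of_le ⟨_, by rintro _ ⟨δ, rfl⟩; exact hub δ⟩ ⟨_, hmem⟩ (le_of_eq ?_)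
  have h2 : inner ℝ ((s * r / ‖w‖) • w) w = s * (r * ‖w‖) := by
    rw [real_inner_smul_left, real_inner_self_eq_norm_sq]
    rcases eq_or_ne ‖w‖ 0 with h | h
    · simp [h]
    · field_simp
  have hs3 : s ^ 2 = 1 := by rw [← sq_abs, hs1]; norm_num
  change _ = (inner ℝ (p.1 + (s * r / ‖w‖) • w) w - p.2) ^ 2
  rw [inner_add_left, h2]
  calc (|a| + r * ‖w‖) ^ 2 = s ^ 2 * (|a| + r * ‖w‖) ^ 2 := by rw [hs3, one_mul]
    _ = (s * |a| + s * (r * ‖w‖)) ^ 2 := by ring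
    _ = _ := by rw [hs2, ha]; ring

/-- The mean absolute value of a standard Gaussian variable. -/
noncomputable def gaussAbs : ℝ := ∫ g, |g| ∂(gaussianReal 0 1)

lemma integrable_abs_gaussianReal : Integrable (fun g : ℝ => |g|) (gaussianReal 0 1) :=
  ((memLp_id_gaussianReal 1).integrable (by norm_num)).abs

lemma integrable_sq_gaussianReal : Integrable (fun g : ℝ => g ^ 2) (gaussianReal 0 1) :=
  (memLp_id_gaussianReal 2).integrable_sq

lemma integral_sq_gaussianReal : ∫ g, g ^ 2 ∂(gaussianReal 0 1) = 1 := by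
  have h := variance_fun_id_gaussianReal (μ := 0) (v := 1)
  rw [variance_eq_integral aemeasurable_id'] at h
  simpa [integral_id_gaussianReal] using h

lemma gaussAbs_nonneg : 0 ≤ gaussAbs := integral_nonneg fun _ => abs_nonneg _

lemma gaussAbs_le_one : gaussAbs ≤ 1 := by
  have h : gaussAbs ≤ ∫ g, (1 / 2 + g ^ 2 / 2) ∂(gaussianReal 0 1) := by
    refine integral_mono integrable_abs_gaussianReal
      ((integrable_const _).add (integrable_sq_gaussianReal.div_const 2)) fun g => ?_
    have := sq_nonneg (|g| - 1)
    simp only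
    nlinarith [sq_abs g]
  rw [integral_add (integrable_const _) (integrable_sq_gaussianReal.div_const 2),
    integral_div (μ := gaussianReal 0 1) 2 fun g : ℝ => g ^ 2, integral_sq_gaussianReal] at h
  refine h.trans (le_of_eq ?_)
  simp
  norm_num

/-- The expected value of `(|g| + r b)²` for `g ∼ N(0, τ²)` with `τ ≥ 0`. -/
noncomputable def riskOf (r τ b : ℝ) : ℝ := τ ^ 2 + 2 * gaussAbs * r * b * τ + r ^ 2 * b ^ 2

lemma integral_sq_abs_add (c : ℝ) (v : ℝ≥0) :
    ∫ g, (|g| + c) ^ 2 ∂(gaussianReal 0 (v ^ 2)) = v ^ 2 + 2 * gaussAbs * c * v + c ^ 2 := by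
  have hmap : gaussianReal 0 (v ^ 2) = (gaussianReal 0 1).map ((v : ℝ) * ·) := by
    rw [gaussianReal_map_const_mul]
    congr 1
    · simp
    · ext; simp
  rw [hmap, integral_map (by fun_prop) (by fun_prop)]
  have : ∀ g : ℝ, (|(v : ℝ) * g| + c) ^ 2 = (v : ℝ) ^ 2 * g ^ 2 + (2 * c * v) * |g| + c ^ 2 := by
    intro g
    rw [abs_mul, abs_of_nonneg v.coe_nonneg, ← sq_abs g]
    ring
  simp_rw [this]
  have hi : Integrable (fun g : ℝ => (v : ℝ) ^ 2 * g ^ 2 + 2 * c * v * |g|) (gaussianReal 0 1) :=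
    (integrable_sq_gaussianReal.const_mul _).add (integrable_abs_gaussianReal.const_mul _)
  rw [integral_add hi (integrable_const _),
    integral_add (integrable_sq_gaussianReal.const_mul _) (integrable_abs_gaussianReal.const_mul _),
    integral_const_mul, integral_const_mul, integral_sq_gaussianReal]
  simp only [integral_const, probReal_univ, smul_eq_mul, one_mul, gaussAbs]
  ring

lemma map_inner_stdGaussian {V : Type*} [NormedAddCommGroup V] [InnerProductSpace ℝ V]
    [FiniteDimensional ℝ V] [MeasurableSpace V] [BorelSpace V] (u : V) :
    (stdGaussian V).map (fun x => inner ℝ x u) = gaussianReal 0 (‖u‖₊ ^ 2) := by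
  have h : (fun x => inner ℝ x u) = (innerSL ℝ u : V → ℝ) := by
    ext x; simp [real_inner_comm]
  rw [h, IsGaussian.map_eq_gaussianReal, integral_strongDual_stdGaussian,
    variance_dual_stdGaussian, innerSL_apply_norm]
  congr 1
  ext; simp

/-- The residual `⟪x, w⟫ - y` of a fixed linear model is Gaussian. -/
lemma map_residual_sampleLaw {d : ℕ} (w₀ : E d) (σ₀ : ℝ≥0) (w : E d) :
    (sampleLaw w₀ σ₀).map (fun p => inner ℝ p.1 w - p.2)
      = gaussianReal 0 (‖w - w₀‖₊ ^ 2 + σ₀ ^ 2) := by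
  rw [sampleLaw, Measure.map_map (by fun_prop) (by fun_prop)]
  have h1 : IndepFun (fun p : E d × ℝ => inner ℝ p.1 (w - w₀)) (fun p => -p.2)
      ((stdGaussian (E d)).prod (gaussianReal 0 (σ₀ ^ 2))) :=
    indepFun_prod (X := fun x : E d => inner ℝ x (w - w₀)) (Y := fun z : ℝ => -z)
      (by fun_prop) (by fun_prop)
  have hX : ((stdGaussian (E d)).prod (gaussianReal 0 (σ₀ ^ 2))).map
      (fun p : E d × ℝ => inner ℝ p.1 (w - w₀)) = gaussianReal 0 (‖w - w₀‖₊ ^ 2) := by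
    have h := Measure.map_map (μ := (stdGaussian (E d)).prod (gaussianReal 0 (σ₀ ^ 2)))
      (g := fun x : E d => inner ℝ x (w - w₀)) (f := Prod.fst) (by fun_prop) measurable_fst
    rw [Measure.map_fst_prod, measure_univ, one_smul, map_inner_stdGaussian] at h
    exact h.symm
  have hY : ((stdGaussian (E d)).prod (gaussianReal 0 (σ₀ ^ 2))).map
      (fun p : E d × ℝ => -p.2) = gaussianReal 0 (σ₀ ^ 2) := by
    have h := Measure.map_map (μ := (stdGaussian (E d)).prod (gaussianReal 0 (σ₀ ^ 2)))
      (g := fun x : ℝ => -x) (f := Prod.snd) (by fun_prop) measurable_snd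
    rw [Measure.map_snd_prod, measure_univ, one_smul, gaussianReal_map_neg, neg_zero] at h
    exact h.symm
  have h2 := gaussianReal_add_gaussianReal_of_indepFun h1 hX hY
  rw [add_zero] at h2
  rw [← h2]
  congr 1
  ext p
  simp [inner_sub_right]
  ring

lemma advRisk_eq {d : ℕ} (w₀ : E d) (σ₀ : ℝ≥0) (w : E d) {r : ℝ} (hr : 0 ≤ r) :
    advRisk w₀ σ₀ w r = riskOf r (√(‖w - w₀‖ ^ 2 + (σ₀ : ℝ) ^ 2)) ‖w‖ := by
  set v : ℝ≥0 := NNReal.sqrt (‖w - w₀‖₊ ^ 2 + σ₀ ^ 2) with hv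
  have hv1 : v ^ 2 = ‖w - w₀‖₊ ^ 2 + σ₀ ^ 2 := NNReal.sq_sqrt _
  have hv2 : (v : ℝ) = √(‖w - w₀‖ ^ 2 + (σ₀ : ℝ) ^ 2) := by simp [hv]
  simp only [advRisk, advLoss_eq hr]
  have h := integral_map (μ := sampleLaw w₀ σ₀) (φ := fun p => inner ℝ p.1 w - p.2)
    (f := fun g : ℝ => (|g| + r * ‖w‖) ^ 2) (by fun_prop) (by fun_prop)
  rw [← h, map_residual_sampleLaw, ← hv1, integral_sq_abs_add, hv2, riskOf]
  ring

lemma riskOf_sqrt (r : ℝ) {x : ℝ} (hx : 0 ≤ x) (b : ℝ) :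
    riskOf r (√x) b = x + 2 * gaussAbs * r * b * √x + r ^ 2 * b ^ 2 := by
  rw [riskOf, Real.sq_sqrt hx]

lemma excessRisk_eq {d : ℕ} (w₀ : E d) (σ₀ : ℝ≥0) (w : E d) :
    excessRisk w₀ σ₀ w = ‖w - w₀‖ ^ 2 / ‖w₀‖ ^ 2 := by
  rw [excessRisk, advRisk_eq _ _ _ le_rfl, riskOf_sqrt _ (by positivity)]
  congr 1
  ring

lemma riskOf_mono {r τ τ' b b' : ℝ} (hr : 0 ≤ r) (hτ : 0 ≤ τ) (hb : 0 ≤ b) (h1 : τ ≤ τ')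
    (h2 : b ≤ b') : riskOf r τ b ≤ riskOf r τ' b' := by
  have := gaussAbs_nonneg
  have hb' := hb.trans h2
  unfold riskOf
  gcongr

lemma riskOf_smul (r c τ b : ℝ) : riskOf r (c * τ) (c * b) = c ^ 2 * riskOf r τ b := by
  unfold riskOf; ring

lemma continuous_riskOf (r : ℝ) : Continuous fun p : ℝ × ℝ => riskOf r p.1 p.2 := by
  unfold riskOf; fun_prop

/-- The adversarial risk of the model `(1 - e) w₀`, for signal strength `a = ‖w₀‖²` and noise level
`b = σ₀²`. It is homogeneous in `(a, b)`, so that the same function, at the normalized strengths,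
gives the risk per dimension. -/
noncomputable def segRisk (r a b e : ℝ) : ℝ := riskOf r (√(e ^ 2 * a + b)) ((1 - e) * √a)

lemma segRisk_nonneg {r a b e : ℝ} (hr : 0 ≤ r) (he : e ≤ 1) : 0 ≤ segRisk r a b e := by
  have := gaussAbs_nonneg
  have : 0 ≤ 1 - e := by linarith
  unfold segRisk riskOf
  positivity

lemma continuous_segRisk (r : ℝ) :
    Continuous fun p : (ℝ × ℝ) × ℝ => segRisk r p.1.1 p.1.2 p.2 := by
  unfold segRisk riskOf; fun_prop

lemma segRisk_smul (r : ℝ) {c a b : ℝ} (e : ℝ) (hc : 0 ≤ c) :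
    segRisk r (c * a) (c * b) e = c * segRisk r a b e := by
  have h1 : √(e ^ 2 * (c * a) + c * b) = √c * √(e ^ 2 * a + b) := by
    rw [← Real.sqrt_mul hc]; ring_nf
  have h2 : (1 - e) * √(c * a) = √c * ((1 - e) * √a) := by
    rw [Real.sqrt_mul hc]; ring
  rw [segRisk, segRisk, h1, h2, riskOf_smul, Real.sq_sqrt hc]

/-- A model at relative distance `e` from `w₀` has norm at least `(1 - e) ‖w₀‖`, so its risk is at
least that of the model on the segment from `0` to `w₀`. -/
lemma segRisk_le_advRisk {d : ℕ} {w₀ : E d} (σ₀ : ℝ≥0) {w : E d} {r e : ℝ} (hr : 0 ≤ r)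
    (he : e ≤ 1) (hw : ‖w - w₀‖ = e * ‖w₀‖) :
    segRisk r (‖w₀‖ ^ 2) ((σ₀ : ℝ) ^ 2) e ≤ advRisk w₀ σ₀ w r := by
  have h1 : (1 - e) * ‖w₀‖ ≤ ‖w‖ := by
    have := norm_sub_norm_le w₀ w
    rw [norm_sub_rev, hw] at this
    linarith
  rw [segRisk, advRisk_eq _ _ _ hr, hw, Real.sqrt_sq (norm_nonneg _), mul_pow]
  exact riskOf_mono hr (Real.sqrt_nonneg _)
    (mul_nonneg (by linarith) (norm_nonneg _)) le_rfl h1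

lemma advRisk_smul {d : ℕ} (w₀ : E d) (σ₀ : ℝ≥0) {r e : ℝ} (hr : 0 ≤ r) (he : e ≤ 1) :
    advRisk w₀ σ₀ ((1 - e) • w₀) r = segRisk r (‖w₀‖ ^ 2) ((σ₀ : ℝ) ^ 2) e := by
  have h1 : (1 - e) • w₀ - w₀ = (-e) • w₀ := by module
  have h2 : (0 : ℝ) ≤ 1 - e := by linarith
  rw [segRisk, advRisk_eq _ _ _ hr, h1, norm_smul, norm_smul, Real.sqrt_sq (norm_nonneg _),
    Real.norm_of_nonneg h2]
  simp [mul_pow]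

lemma excessRisk_smul {d : ℕ} {w₀ : E d} (hw₀ : w₀ ≠ 0) (σ₀ : ℝ≥0) (e : ℝ) :
    excessRisk w₀ σ₀ ((1 - e) • w₀) = e ^ 2 := by
  have h1 : (1 - e) • w₀ - w₀ = (-e) • w₀ := by module
  have : ‖w₀‖ ≠ 0 := norm_ne_zero_iff.2 hw₀
  rw [excessRisk_eq, h1, norm_smul, mul_pow]
  field_simp
  simp

lemma norm_sub_eq_of_excessRisk {d : ℕ} {w₀ : E d} (hw₀ : w₀ ≠ 0) (σ₀ : ℝ≥0) (w : E d) :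
    ‖w - w₀‖ = √(excessRisk w₀ σ₀ w) * ‖w₀‖ := by
  have h : ‖w₀‖ ≠ 0 := norm_ne_zero_iff.2 hw₀
  rw [excessRisk_eq, ← div_pow, Real.sqrt_sq (by positivity), div_mul_cancel₀ _ h]

lemma optRisk_eq {d : ℕ} {w₀ : E d} (hw₀ : w₀ ≠ 0) (σ₀ : ℝ≥0) {r ε : ℝ} (hr : 0 ≤ r)
    (hε0 : 0 ≤ ε) (hε1 : ε ≤ 1) :
    optRisk w₀ σ₀ r ε = segRisk r (‖w₀‖ ^ 2) ((σ₀ : ℝ) ^ 2) ε := by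
  refine IsLeast.csInf_eq ⟨⟨(1 - ε) • w₀, excessRisk_smul hw₀ _ _, advRisk_smul _ _ hr hε1⟩, ?_⟩
  rintro _ ⟨w, hw, rfl⟩
  refine segRisk_le_advRisk σ₀ hr hε1 ?_
  rw [norm_sub_eq_of_excessRisk hw₀ σ₀, hw, Real.sqrt_sq hε0]

lemma exists_isLeast_segRisk (r a b : ℝ) {ε : ℝ} (hε0 : 0 ≤ ε) :
    ∃ e ∈ Set.Icc 0 ε, IsLeast (segRisk r a b '' Set.Icc 0 ε) (segRisk r a b e) := by
  have hc : Continuous (segRisk r a b) :=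
    (continuous_segRisk r).comp (f := fun e : ℝ => ((a, b), e)) (by fun_prop)
  obtain ⟨e, he, hmin⟩ := isCompact_Icc.exists_isMinOn (Set.nonempty_Icc.2 hε0) hc.continuousOn
  exact ⟨e, he, ⟨e, he, rfl⟩, by rintro _ ⟨e', he', rfl⟩; exact hmin he'⟩

lemma optRiskLe_eq {d : ℕ} {w₀ : E d} (hw₀ : w₀ ≠ 0) (σ₀ : ℝ≥0) {r ε : ℝ} (hr : 0 ≤ r)
    (hε0 : 0 ≤ ε) (hε1 : ε ≤ 1) :
    optRiskLe w₀ σ₀ r ε = sInf (segRisk r (‖w₀‖ ^ 2) ((σ₀ : ℝ) ^ 2) '' Set.Icc 0 ε) := by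
  obtain ⟨e, he, hmin⟩ := exists_isLeast_segRisk r (‖w₀‖ ^ 2) ((σ₀ : ℝ) ^ 2) hε0
  rw [hmin.csInf_eq]
  refine IsLeast.csInf_eq ⟨⟨(1 - e) • w₀, ?_, advRisk_smul _ _ hr (he.2.trans hε1)⟩, ?_⟩
  · change excessRisk _ _ _ ≤ _
    rw [excessRisk_smul hw₀]
    exact pow_le_pow_left₀ he.1 he.2 2
  rintro _ ⟨w, hw, rfl⟩
  have h1 : √(excessRisk w₀ σ₀ w) ≤ ε := Real.sqrt_le_iff.2 ⟨hε0, hw⟩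
  exact (hmin.2 ⟨_, ⟨Real.sqrt_nonneg _, h1⟩, rfl⟩).trans
    (segRisk_le_advRisk σ₀ hr (h1.trans hε1) (norm_sub_eq_of_excessRisk hw₀ σ₀ w))

lemma continuous_sInf_segRisk (r ε : ℝ) :
    Continuous fun p : ℝ × ℝ => sInf (segRisk r p.1 p.2 '' Set.Icc 0 ε) :=
  IsCompact.continuous_sInf (f := fun (p : ℝ × ℝ) e => segRisk r p.1 p.2 e) isCompact_Icc
    (continuous_segRisk r)

lemma sInf_segRisk_smul (r ε : ℝ) {c a b : ℝ} (hc : 0 ≤ c) :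
    sInf (segRisk r (c * a) (c * b) '' Set.Icc 0 ε) = c * sInf (segRisk r a b '' Set.Icc 0 ε) := by
  rw [← smul_eq_mul (b := sInf _), ← Real.sInf_smul_of_nonneg hc, ← Set.image_smul,
    Set.image_image]
  simp only [segRisk_smul _ _ hc, smul_eq_mul]

/-- Dropping the cross term of the risk costs at most a factor of two. -/
lemma segRisk_le_two_mul {r a b e : ℝ} (hr : 0 ≤ r) (ha : 0 ≤ a) (hb : 0 ≤ b) (he : e ≤ 1) :
    segRisk r a b e ≤ 2 * (e ^ 2 * a + b + r ^ 2 * ((1 - e) ^ 2 * a)) := by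
  have h1 : 0 ≤ 1 - e := by linarith
  have h2 : 0 ≤ e ^ 2 * a + b := by positivity
  rw [segRisk, riskOf, Real.sq_sqrt h2, mul_pow, Real.sq_sqrt ha]
  have h3 := Real.sq_sqrt h2
  have h4 := Real.sq_sqrt ha
  set x := √(e ^ 2 * a + b)
  set y := r * ((1 - e) * √a)
  have hx : 0 ≤ x := Real.sqrt_nonneg _
  have hy : 0 ≤ y := by positivity
  have h5 : 2 * gaussAbs * r * ((1 - e) * √a) * x ≤ 2 * (x * y) := by
    have := mul_le_mul_of_nonneg_right gaussAbs_le_one (mul_nonneg hx hy)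
    simp only [y] at this ⊢
    nlinarith
  have h6 : y ^ 2 = r ^ 2 * ((1 - e) ^ 2 * a) := by simp only [y, mul_pow, h4]
  nlinarith [sq_nonneg (x - y)]

lemma le_segRisk {r a b e : ℝ} (hr : 0 ≤ r) (ha : 0 ≤ a) (hb : 0 ≤ b) (he : e ≤ 1) :
    e ^ 2 * a + b + r ^ 2 * ((1 - e) ^ 2 * a) ≤ segRisk r a b e := by
  have h1 : 0 ≤ 1 - e := by linarith
  have h2 : 0 ≤ e ^ 2 * a + b := by positivity
  have := gaussAbs_nonneg
  rw [segRisk, riskOf, Real.sq_sqrt h2, mul_pow, Real.sq_sqrt ha]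
  have : 0 ≤ 2 * gaussAbs * r * ((1 - e) * √a) * √(e ^ 2 * a + b) := by positivity
  linarith

/-- The first two terms are compared through `ε² a + b ≤ (1 + a / b) b`, and `r² (1 - e)²` is
antitone in `e`. -/
lemma segRisk_le_ratio_mul {r a b e ε : ℝ} (hr : 0 ≤ r) (ha : 0 ≤ a) (hb : 0 < b)
    (he0 : 0 ≤ e) (he : e ≤ ε) (hε : ε ≤ 1) :
    segRisk r a b ε ≤ 2 * (1 + a / b) * segRisk r a b e := by
  have h1 := segRisk_le_two_mul hr ha hb.le hε
  have h2 := le_segRisk hr ha hb.le (he.trans hε)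
  have h3 : b + a = (1 + a / b) * b := by field_simp
  have h4 : 0 ≤ a / b := by positivity
  have h5 : (1 - ε) ^ 2 ≤ (1 - e) ^ 2 := pow_le_pow_left₀ (by linarith) (by linarith) 2
  have h6 : ε ^ 2 * a ≤ a := mul_le_of_le_one_left ha (by nlinarith)
  have h7 : r ^ 2 * ((1 - ε) ^ 2 * a) ≤ r ^ 2 * ((1 - e) ^ 2 * a) := by gcongr
  have h8 : 0 ≤ r ^ 2 * ((1 - e) ^ 2 * a) := by positivity
  have h9 : 0 ≤ e ^ 2 * a := by positivity
  calc segRisk r a b ε ≤ 2 * ((b + a) + r ^ 2 * ((1 - e) ^ 2 * a)) := by linarith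
    _ ≤ 2 * (1 + a / b) * (e ^ 2 * a + b + r ^ 2 * ((1 - e) ^ 2 * a)) := by
        rw [h3]; nlinarith [mul_nonneg h4 h8, mul_nonneg h4 h9]
    _ ≤ _ := by gcongr

/-- On `[0, r² / (1 + r²)]` the function `e² + r² (1 - e)²` is antitone. -/
lemma segRisk_le_of_le_ratio {r a b e ε : ℝ} (hr : 0 ≤ r) (ha : 0 ≤ a) (hb : 0 ≤ b)
    (he : e ≤ ε) (hε : ε ≤ 1) (hεr : ε ≤ r ^ 2 / (1 + r ^ 2)) :
    segRisk r a b ε ≤ 2 * segRisk r a b e := by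
  have h1 := segRisk_le_two_mul hr ha hb hε
  have h2 := le_segRisk hr ha hb (he.trans hε)
  rw [le_div_iff₀ (by positivity)] at hεr
  have h3 : ε ^ 2 + r ^ 2 * (1 - ε) ^ 2 ≤ e ^ 2 + r ^ 2 * (1 - e) ^ 2 := by
    nlinarith [mul_nonneg (sub_nonneg.2 he) (sub_nonneg.2 hεr), mul_nonneg (sub_nonneg.2 he)
      (mul_nonneg (sub_nonneg.2 he) (by positivity : 0 ≤ 1 + r ^ 2))]
  nlinarith [mul_le_mul_of_nonneg_right h3 ha]

/-! ### Gaussian linear and quadratic forms -/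

section Gaussian

variable {V : Type*} [NormedAddCommGroup V] [InnerProductSpace ℝ V] [FiniteDimensional ℝ V]
  [MeasurableSpace V] [BorelSpace V]

/-- The variance of the square of a standard Gaussian variable. -/
noncomputable def gaussKurt : ℝ := Var[fun g => g ^ 2; gaussianReal 0 1]

lemma gaussKurt_nonneg : 0 ≤ gaussKurt := variance_nonneg _ _

lemma memLp_sq_gaussianReal : MemLp (fun g : ℝ => g ^ 2) 2 (gaussianReal 0 1) := by
  have h := (memLp_id_gaussianReal (μ := 0) (v := 1) 4).norm_rpow_div (2 : ℝ≥0∞)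
  have h4 : ((4 : ℝ≥0) : ℝ≥0∞) / 2 = 2 := by
    refine ((ENNReal.eq_div_iff (by norm_num) (by norm_num)).2 ?_).symm
    norm_num
  rw [h4] at h
  refine h.congr_norm (by fun_prop) (ae_of_all _ fun g => ?_)
  simp

/-- A Gaussian quadratic form concentrates around the trace of its operator. The bound comes from
diagonalizing: the form is then a weighted sum of independent squares. -/
lemma lintegral_quadForm_sub_trace_sq_le (B : V →L[ℝ] V) (hB : (B : V →ₗ[ℝ] V).IsSymmetric) :
    ∫⁻ x, ENNReal.ofReal ((inner ℝ x (B x) - LinearMap.trace ℝ V B) ^ 2) ∂(stdGaussian V)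
      ≤ ENNReal.ofReal (gaussKurt * Module.finrank ℝ V * ‖B‖ ^ 2) := by
  set b := hB.eigenvectorBasis rfl with hb
  set l := hB.eigenvalues rfl with hl
  have hBb : ∀ i, B (b i) = l i • b i := fun i => by
    exact hB.apply_eigenvectorBasis rfl i
  have htr : LinearMap.trace ℝ V B = ∑ i, l i := by
    rw [LinearMap.trace_eq_sum_inner _ b]
    refine Finset.sum_congr rfl fun i _ => ?_
    rw [ContinuousLinearMap.coe_coe, hBb, real_inner_smul_right, real_inner_self_eq_norm_sq]
    simp
  have hl_le : ∀ i, l i ^ 2 ≤ ‖B‖ ^ 2 := fun i => by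
    have h := B.le_opNorm (b i)
    rw [hBb, norm_smul, b.norm_eq_one, mul_one, mul_one, Real.norm_eq_abs] at h
    rw [← sq_abs]
    exact pow_le_pow_left₀ (abs_nonneg _) h 2
  have hform : ∀ x : Fin (Module.finrank ℝ V) → ℝ,
      inner ℝ (∑ i, x i • b i) (B (∑ i, x i • b i)) = ∑ i, l i * x i ^ 2 := fun x => by
    simp only [map_sum, map_smul, hBb, smul_smul]
    rw [b.orthonormal.inner_sum]
    refine Finset.sum_congr rfl fun i _ => ?_
    simp
    ring
  set μ := Measure.pi fun _ : Fin (Module.finrank ℝ V) => gaussianReal 0 1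
  set F : (Fin (Module.finrank ℝ V) → ℝ) → ℝ := ∑ i, fun x => l i * x i ^ 2 with hF
  have hF_apply : ∀ x, F x = ∑ i, l i * x i ^ 2 := fun x => by simp [hF]
  have hLp : ∀ i, MemLp (fun g : ℝ => l i * g ^ 2) 2 (gaussianReal 0 1) :=
    fun i => memLp_sq_gaussianReal.const_mul (l i)
  have hLpc : ∀ i, MemLp (fun x : Fin (Module.finrank ℝ V) → ℝ => l i * x i ^ 2) 2 μ :=
    fun i => (hLp i).comp_measurePreserving (measurePreserving_eval _ i)
  have hmean : ∫ x, F x ∂μ = ∑ i, l i := by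
    simp only [hF_apply]
    rw [integral_finsetSum _ fun i _ => (hLpc i).integrable (by norm_num)]
    refine Finset.sum_congr rfl fun i _ => ?_
    have h := integral_map (μ := μ) (φ := fun x => x i) (f := fun g : ℝ => l i * g ^ 2)
      (measurable_pi_apply i).aemeasurable (by fun_prop)
    rw [(measurePreserving_eval _ i).map_eq, integral_const_mul, integral_sq_gaussianReal,
      mul_one] at h
    exact h.symm
  have hvar : Var[F; μ] = ∑ i, l i ^ 2 * gaussKurt := by
    rw [hF, variance_sum_pi hLp]
    exact Finset.sum_congr rfl fun i _ => variance_const_mul _ _ _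
  have hFL : MemLp F 2 μ := memLp_finsetSum' _ fun i _ => hLpc i
  calc ∫⁻ x, ENNReal.ofReal ((inner ℝ x (B x) - LinearMap.trace ℝ V B) ^ 2) ∂(stdGaussian V)
      = ∫⁻ x, ENNReal.ofReal ((F x - ∫ x, F x ∂μ) ^ 2) ∂μ := by
        rw [stdGaussian_eq_map_pi_orthonormalBasis b, lintegral_map (by fun_prop) (by fun_prop)]
        simp only [hform, hmean]
        simp only [hF_apply, htr]
        rfl
    _ = evariance F μ := by
        refine lintegral_congr fun x => ?_
        rw [← sq_abs, ENNReal.ofReal_pow (abs_nonneg _), ← Real.norm_eq_abs, ofReal_norm]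
    _ = ENNReal.ofReal (∑ i, l i ^ 2 * gaussKurt) := by rw [← hFL.ofReal_variance_eq, hvar]
    _ ≤ _ := by
        refine ENNReal.ofReal_le_ofReal ?_
        rw [← Finset.sum_mul, mul_assoc, mul_comm]
        refine mul_le_mul_of_nonneg_left ?_ gaussKurt_nonneg
        calc ∑ i, l i ^ 2 ≤ ∑ _i : Fin (Module.finrank ℝ V), ‖B‖ ^ 2 :=
              Finset.sum_le_sum fun i _ => hl_le i
          _ = _ := by simp

lemma lintegral_sq_gaussianReal (v : ℝ≥0) :
    ∫⁻ g, ENNReal.ofReal (g ^ 2) ∂(gaussianReal 0 v) = v := by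
  have h := variance_fun_id_gaussianReal (μ := 0) (v := v)
  rw [variance_eq_integral aemeasurable_id'] at h
  have hi : Integrable (fun g : ℝ => g ^ 2) (gaussianReal 0 v) :=
    (memLp_id_gaussianReal 2).integrable_sq
  rw [← ofReal_integral_eq_lintegral_ofReal hi (ae_of_all _ fun g => sq_nonneg g)]
  rw [integral_id_gaussianReal] at h
  simp only [sub_zero] at h
  rw [h, ENNReal.ofReal_coe_nnreal]

lemma lintegral_inner_sq (v : V) :
    ∫⁻ x, ENNReal.ofReal ((inner ℝ x v) ^ 2) ∂(stdGaussian V) = ENNReal.ofReal (‖v‖ ^ 2) := by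
  have h := lintegral_map (μ := stdGaussian V) (f := fun g : ℝ => ENNReal.ofReal (g ^ 2))
    (g := fun x => inner ℝ x v) (by fun_prop) (by fun_prop)
  rw [← h, map_inner_stdGaussian, lintegral_sq_gaussianReal, ← ENNReal.ofReal_coe_nnreal]
  simp

lemma lintegral_norm_sq_stdGaussian :
    ∫⁻ x, ENNReal.ofReal (‖x‖ ^ 2) ∂(stdGaussian V) = (Module.finrank ℝ V : ℕ) := by
  set b := stdOrthonormalBasis ℝ V
  have h : ∀ x : V, ENNReal.ofReal (‖x‖ ^ 2) = ∑ i, ENNReal.ofReal ((inner ℝ x (b i)) ^ 2) := by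
    intro x
    rw [← ENNReal.ofReal_sum_of_nonneg fun i _ => sq_nonneg _, b.sum_sq_inner_left]
  simp_rw [h]
  rw [lintegral_finsetSum _ fun i _ => by fun_prop]
  simp [lintegral_inner_sq]

lemma sq_finrank_le_lintegral_norm_pow_four :
    ((Module.finrank ℝ V : ℕ) : ℝ≥0∞) ^ 2 ≤ ∫⁻ x, ENNReal.ofReal (‖x‖ ^ 4) ∂(stdGaussian V) := by
  set D : ℝ≥0∞ := ((Module.finrank ℝ V : ℕ) : ℝ≥0∞) with hD
  have hDr : D = ENNReal.ofReal (Module.finrank ℝ V : ℝ) := by simp [hD]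
  have hDtop : D ≠ ⊤ := by simp [hD]
  have key : 2 * D * D ≤ ∫⁻ x, ENNReal.ofReal (‖x‖ ^ 4) ∂(stdGaussian V) + D ^ 2 := by
    calc 2 * D * D = ∫⁻ x, 2 * D * ENNReal.ofReal (‖x‖ ^ 2) ∂(stdGaussian V) := by
          rw [lintegral_const_mul _ (by fun_prop), lintegral_norm_sq_stdGaussian]
      _ ≤ ∫⁻ x, (ENNReal.ofReal (‖x‖ ^ 4) + D ^ 2) ∂(stdGaussian V) := by
          refine lintegral_mono fun x => ?_
          rw [hDr, show (2 : ℝ≥0∞) = ENNReal.ofReal 2 by simp, ← ENNReal.ofReal_mul (by norm_num),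
            ← ENNReal.ofReal_mul (by positivity), ← ENNReal.ofReal_pow (by positivity),
            ← ENNReal.ofReal_add (by positivity) (by positivity)]
          refine ENNReal.ofReal_le_ofReal ?_
          nlinarith [sq_nonneg (‖x‖ ^ 2 - Module.finrank ℝ V)]
      _ = _ := by rw [lintegral_add_right _ measurable_const]; simp
  have h2 : 2 * D * D = D ^ 2 + D ^ 2 := by ring
  rw [h2] at key
  exact (ENNReal.add_le_add_iff_right (ENNReal.pow_ne_top hDtop)).1 key

end Gaussian

/-- On a probability space, an `L²` bound gives an `L¹` bound. -/
lemma lintegral_abs_le_of_sq {Ω : Type*} [MeasurableSpace Ω] {μ : Measure Ω}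
    [IsProbabilityMeasure μ] {f : Ω → ℝ} (hf : Measurable f) {B : ℝ} (hB : 0 < B)
    (h : ∫⁻ ω, ENNReal.ofReal (f ω ^ 2) ∂μ ≤ ENNReal.ofReal (B ^ 2)) :
    ∫⁻ ω, ENNReal.ofReal |f ω| ∂μ ≤ ENNReal.ofReal B := by
  have hpt : ∀ ω, ENNReal.ofReal |f ω|
      ≤ ENNReal.ofReal (1 / (2 * B)) * ENNReal.ofReal (f ω ^ 2) + ENNReal.ofReal (B / 2) := by
    intro ω
    rw [← ENNReal.ofReal_mul (by positivity), ← ENNReal.ofReal_add (by positivity) (by positivity)]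
    refine ENNReal.ofReal_le_ofReal ?_
    have h1 : 1 / (2 * B) * f ω ^ 2 + B / 2 - |f ω| = (|f ω| - B) ^ 2 / (2 * B) := by
      rw [← sq_abs (f ω)]; field_simp; ring
    have h2 : 0 ≤ (|f ω| - B) ^ 2 / (2 * B) := by positivity
    linarith
  calc ∫⁻ ω, ENNReal.ofReal |f ω| ∂μ
      ≤ ∫⁻ ω, (ENNReal.ofReal (1 / (2 * B)) * ENNReal.ofReal (f ω ^ 2)
          + ENNReal.ofReal (B / 2)) ∂μ := lintegral_mono hpt
    _ = ENNReal.ofReal (1 / (2 * B)) * ∫⁻ ω, ENNReal.ofReal (f ω ^ 2) ∂μ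
          + ENNReal.ofReal (B / 2) := by
        rw [lintegral_add_right _ measurable_const, lintegral_const_mul _ (by fun_prop)]
        simp
    _ ≤ ENNReal.ofReal (1 / (2 * B)) * ENNReal.ofReal (B ^ 2) + ENNReal.ofReal (B / 2) := by
        gcongr
    _ = ENNReal.ofReal B := by
        rw [← ENNReal.ofReal_mul (by positivity),
          ← ENNReal.ofReal_add (by positivity) (by positivity)]
        congr 1
        field_simp
        ring

/-! ### The sample covariance operator and its resolvent -/

section Resolvent

open InnerProductSpace

variable {n d : ℕ}

/-- The sample second-moment operator `(1/n) ∑ xᵢ xᵢᵀ`. -/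
noncomputable def sampleCov (X : Fin n → E d) : E d →L[ℝ] E d :=
  (1 / (n : ℝ)) • ∑ i, rankOne ℝ (X i) (X i)

/-- The resolvent `(S + t)⁻¹` of the sample second-moment operator `S`. -/
noncomputable def resolvent (t : ℝ) (X : Fin n → E d) : E d →L[ℝ] E d :=
  Ring.inverse (sampleCov X + t • 1)

lemma sampleCov_apply (X : Fin n → E d) (u : E d) :
    sampleCov X u = (1 / (n : ℝ)) • ∑ i, (inner ℝ (X i) u : ℝ) • X i := by
  simp [sampleCov]

lemma inner_sampleCov (X : Fin n → E d) (u v : E d) :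
    inner ℝ u (sampleCov X v) = (1 / (n : ℝ)) * ∑ i, inner ℝ (X i) u * inner ℝ (X i) v := by
  rw [sampleCov_apply, real_inner_smul_right, inner_sum]
  congr 1
  refine Finset.sum_congr rfl fun i _ => ?_
  rw [real_inner_smul_right, real_inner_comm u (X i), mul_comm]

lemma inner_sampleCov_comm (X : Fin n → E d) (u v : E d) :
    inner ℝ u (sampleCov X v) = inner ℝ (sampleCov X u) v := by
  rw [real_inner_comm _ (sampleCov X u), inner_sampleCov, inner_sampleCov]
  simp_rw [mul_comm]

lemma inner_sampleCov_self_nonneg (X : Fin n → E d) (u : E d) :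
    0 ≤ inner ℝ u (sampleCov X u) := by
  rw [inner_sampleCov]
  exact mul_nonneg (by positivity) (Finset.sum_nonneg fun i _ => mul_self_nonneg _)

lemma shift_apply (t : ℝ) (X : Fin n → E d) (u : E d) :
    (sampleCov X + t • (1 : E d →L[ℝ] E d)) u = sampleCov X u + t • u := by
  simp

lemma mul_norm_sq_le_inner_shift (t : ℝ) (X : Fin n → E d) (u : E d) :
    t * ‖u‖ ^ 2 ≤ inner ℝ u (sampleCov X u + t • u) := by
  rw [inner_add_right, real_inner_smul_right, real_inner_self_eq_norm_sq]
  linarith [inner_sampleCov_self_nonneg X u]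

lemma isUnit_shift {t : ℝ} (ht : 0 < t) (X : Fin n → E d) :
    IsUnit (sampleCov X + t • (1 : E d →L[ℝ] E d)) := by
  rw [ContinuousLinearMap.isUnit_iff_bijective]
  have hinj : Function.Injective (sampleCov X + t • (1 : E d →L[ℝ] E d)) := by
    rw [injective_iff_map_eq_zero]
    intro u hu
    rw [shift_apply] at hu
    have h := mul_norm_sq_le_inner_shift t X u
    rw [hu, inner_zero_right] at h
    have h2 : ‖u‖ ^ 2 ≤ 0 := by nlinarith [sq_nonneg ‖u‖]
    simpa using h2
  exact ⟨hinj, (LinearMap.injective_iff_surjective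
    (f := ((sampleCov X + t • (1 : E d →L[ℝ] E d) : E d →L[ℝ] E d) : E d →ₗ[ℝ] E d))).1 hinj⟩

lemma shift_resolvent_apply {t : ℝ} (ht : 0 < t) (X : Fin n → E d) (u : E d) :
    sampleCov X (resolvent t X u) + t • resolvent t X u = u := by
  have h := Ring.mul_inverse_cancel _ (isUnit_shift ht X)
  have h2 := congrArg (fun A : E d →L[ℝ] E d => A u) h
  simpa [resolvent] using h2

lemma resolvent_shift_apply {t : ℝ} (ht : 0 < t) (X : Fin n → E d) (u : E d) :
    resolvent t X (sampleCov X u + t • u) = u := by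
  have h := Ring.inverse_mul_cancel _ (isUnit_shift ht X)
  have h2 := congrArg (fun A : E d →L[ℝ] E d => A u) h
  simpa [resolvent] using h2

lemma sampleCov_resolvent_apply {t : ℝ} (ht : 0 < t) (X : Fin n → E d) (u : E d) :
    sampleCov X (resolvent t X u) = u - t • resolvent t X u :=
  eq_sub_of_add_eq (shift_resolvent_apply ht X u)

lemma resolvent_sampleCov_apply {t : ℝ} (ht : 0 < t) (X : Fin n → E d) (u : E d) :
    resolvent t X (sampleCov X u) = u - t • resolvent t X u := by
  have h := resolvent_shift_apply ht X u
  rw [map_add, map_smul] at h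
  exact eq_sub_of_add_eq h

lemma inner_resolvent_comm {t : ℝ} (ht : 0 < t) (X : Fin n → E d) (u v : E d) :
    inner ℝ u (resolvent t X v) = inner ℝ (resolvent t X u) v := by
  conv_lhs => rw [← shift_resolvent_apply ht X u]
  conv_rhs => rw [← shift_resolvent_apply ht X v]
  rw [inner_add_left, inner_add_right, real_inner_smul_left, real_inner_smul_right,
    inner_sampleCov_comm]

lemma isSymmetric_resolvent {t : ℝ} (ht : 0 < t) (X : Fin n → E d) :
    (resolvent t X : E d →ₗ[ℝ] E d).IsSymmetric :=
  fun u v => (inner_resolvent_comm ht X u v).symm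

lemma mul_norm_resolvent_sq_le {t : ℝ} (ht : 0 < t) (X : Fin n → E d) (u : E d) :
    t * ‖resolvent t X u‖ ^ 2 ≤ inner ℝ u (resolvent t X u) := by
  have h := mul_norm_sq_le_inner_shift t X (resolvent t X u)
  rwa [shift_resolvent_apply ht, real_inner_comm] at h

lemma inner_resolvent_self_nonneg {t : ℝ} (ht : 0 < t) (X : Fin n → E d) (u : E d) :
    0 ≤ inner ℝ u (resolvent t X u) :=
  (by positivity : 0 ≤ t * ‖resolvent t X u‖ ^ 2).trans (mul_norm_resolvent_sq_le ht X u)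

lemma norm_resolvent_apply_le {t : ℝ} (ht : 0 < t) (X : Fin n → E d) (u : E d) :
    ‖resolvent t X u‖ ≤ 1 / t * ‖u‖ := by
  have h := (mul_norm_resolvent_sq_le ht X u).trans (real_inner_le_norm _ _)
  have h2 : t * ‖resolvent t X u‖ ≤ ‖u‖ := by
    rcases (norm_nonneg (resolvent t X u)).eq_or_lt with h0 | h0
    · rw [← h0]; simp
    · exact le_of_mul_le_mul_right (by nlinarith) h0
  rw [one_div, inv_mul_eq_div, le_div_iff₀ ht]
  linarith

lemma norm_resolvent_le {t : ℝ} (ht : 0 < t) (X : Fin n → E d) : ‖resolvent t X‖ ≤ 1 / t :=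
  ContinuousLinearMap.opNorm_le_bound _ (by positivity) (norm_resolvent_apply_le ht X)

lemma inner_resolvent_self_le {t : ℝ} (ht : 0 < t) (X : Fin n → E d) (u : E d) :
    inner ℝ u (resolvent t X u) ≤ ‖u‖ ^ 2 / t := by
  calc inner ℝ u (resolvent t X u) ≤ ‖u‖ * ‖resolvent t X u‖ := real_inner_le_norm _ _
    _ ≤ ‖u‖ * (1 / t * ‖u‖) := by gcongr; exact norm_resolvent_apply_le ht X u
    _ = _ := by ring

lemma inner_resolvent_sampleCov_le {t : ℝ} (ht : 0 < t) (X : Fin n → E d) (u : E d) :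
    inner ℝ (resolvent t X u) (sampleCov X (resolvent t X u)) ≤ ‖u‖ ^ 2 / t := by
  refine le_trans ?_ (inner_resolvent_self_le ht X u)
  rw [sampleCov_resolvent_apply ht, inner_sub_right, real_inner_smul_right,
    real_inner_self_eq_norm_sq, real_inner_comm]
  have : 0 ≤ t * ‖resolvent t X u‖ ^ 2 := by positivity
  linarith

lemma resolvent_sub_resolvent {t h : ℝ} (ht : 0 < t) (hh : 0 < h) (X : Fin n → E d) :
    resolvent t X - resolvent (t + h) X = h • (resolvent t X * resolvent (t + h) X) := by
  ext1 u
  have h1 := sampleCov_resolvent_apply (add_pos ht hh) X u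
  have h2 := resolvent_shift_apply ht X (resolvent (t + h) X u)
  rw [h1] at h2
  have h3 : u - (t + h) • resolvent (t + h) X u + t • resolvent (t + h) X u
      = u - h • resolvent (t + h) X u := by module
  rw [h3, map_sub, map_smul] at h2
  simp only [sub_apply, smul_apply,
    mul_apply_eq_comp]
  rw [sub_eq_iff_eq_add, add_comm]
  exact sub_eq_iff_eq_add.1 h2

/-- The trace of a continuous operator on Euclidean space. -/
noncomputable def tr (A : E d →L[ℝ] E d) : ℝ := LinearMap.trace ℝ (E d) A

lemma tr_eq_sum (A : E d →L[ℝ] E d) :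
    tr A = ∑ j, inner ℝ (EuclideanSpace.basisFun (Fin d) ℝ j)
      (A (EuclideanSpace.basisFun (Fin d) ℝ j)) :=
  LinearMap.trace_eq_sum_inner _ _

lemma tr_sub (A B : E d →L[ℝ] E d) : tr (A - B) = tr A - tr B := by simp [tr]

lemma tr_smul (c : ℝ) (A : E d →L[ℝ] E d) : tr (c • A) = c * tr A := by simp [tr]

lemma tr_one : tr (1 : E d →L[ℝ] E d) = d := by simp [tr_eq_sum]

lemma tr_rankOne (x y : E d) : tr (rankOne ℝ x y) = inner ℝ y x := trace_rankOne x y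

lemma abs_tr_le (A : E d →L[ℝ] E d) : |tr A| ≤ d * ‖A‖ := by
  rw [tr_eq_sum]
  calc _ ≤ ∑ j : Fin d, |(inner ℝ (EuclideanSpace.basisFun (Fin d) ℝ j)
        (A (EuclideanSpace.basisFun (Fin d) ℝ j)) : ℝ)| := Finset.abs_sum_le_sum_abs _ _
    _ ≤ ∑ _j : Fin d, ‖A‖ := by
        refine Finset.sum_le_sum fun j _ => (abs_real_inner_le_norm _ _).trans ?_
        have h := A.le_opNorm (EuclideanSpace.basisFun (Fin d) ℝ j)
        simpa using h
    _ = _ := by simp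

lemma continuous_tr : Continuous (tr : (E d →L[ℝ] E d) → ℝ) := by
  have : (tr : (E d →L[ℝ] E d) → ℝ) = fun A => ∑ j, inner ℝ (EuclideanSpace.basisFun (Fin d) ℝ j)
      (A (EuclideanSpace.basisFun (Fin d) ℝ j)) := funext tr_eq_sum
  rw [this]
  fun_prop

lemma tr_resolvent_nonneg {t : ℝ} (ht : 0 < t) (X : Fin n → E d) : 0 ≤ tr (resolvent t X) := by
  rw [tr_eq_sum]
  exact Finset.sum_nonneg fun j _ => inner_resolvent_self_nonneg ht X _

lemma continuous_sampleCov : Continuous (sampleCov : (Fin n → E d) → (E d →L[ℝ] E d)) := by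
  have h : ∀ i, Continuous fun X : Fin n → E d => (rankOne ℝ (X i) (X i) : E d →L[ℝ] E d) :=
    fun i => ((rankOne ℝ).continuous.comp (continuous_apply i)).clm_apply (continuous_apply i)
  exact (continuous_finsetSum Finset.univ fun i _ => h i).const_smul (1 / (n : ℝ))

lemma continuous_resolvent {t : ℝ} (ht : 0 < t) :
    Continuous (resolvent t : (Fin n → E d) → (E d →L[ℝ] E d)) := by
  rw [continuous_iff_continuousAt]
  intro X
  obtain ⟨u, hu⟩ := isUnit_shift ht X
  have h := NormedRing.inverse_continuousAt u
  rw [hu] at h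
  have h2 : Continuous fun X : Fin n → E d => sampleCov X + t • (1 : E d →L[ℝ] E d) :=
    continuous_sampleCov.add continuous_const
  exact ContinuousAt.comp (f := fun X : Fin n → E d => sampleCov X + t • (1 : E d →L[ℝ] E d))
    h h2.continuousAt

/-! ### Leaving one sample out -/

lemma sampleCov_update (X : Fin n → E d) (i : Fin n) (u : E d) :
    sampleCov X u = sampleCov (Function.update X i 0) u
      + ((1 / (n : ℝ)) * inner ℝ (X i) u) • X i := by
  rw [sampleCov_apply, sampleCov_apply, ← Finset.add_sum_erase _ _ (Finset.mem_univ i),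
    ← Finset.add_sum_erase _ _ (Finset.mem_univ i)]
  have h : ∀ j ∈ Finset.univ.erase i, (inner ℝ (Function.update X i 0 j) u : ℝ) •
      Function.update X i 0 j = (inner ℝ (X j) u : ℝ) • X j := by
    intro j hj
    rw [Function.update_of_ne (Finset.ne_of_mem_erase hj)]
  rw [Finset.sum_congr rfl h]
  simp only [Function.update_self, inner_zero_left, zero_smul]
  module

/-- The leave-one-out quadratic form `xᵢᵀ G₍ᵢ₎ xᵢ / n`, where `G₍ᵢ₎` is the resolvent of the data
in which `xᵢ` is replaced by zero. -/
noncomputable def looQuad (t : ℝ) (X : Fin n → E d) (i : Fin n) : ℝ :=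
  (1 / (n : ℝ)) * inner ℝ (X i) (resolvent t (Function.update X i 0) (X i))

lemma looQuad_nonneg {t : ℝ} (ht : 0 < t) (X : Fin n → E d) (i : Fin n) : 0 ≤ looQuad t X i :=
  mul_nonneg (by positivity) (inner_resolvent_self_nonneg ht _ _)

/-- The Sherman–Morrison formula for the image of the removed sample. -/
lemma resolvent_apply_sample {t : ℝ} (ht : 0 < t) (X : Fin n → E d) (i : Fin n) :
    resolvent t X (X i)
      = (1 + looQuad t X i)⁻¹ • resolvent t (Function.update X i 0) (X i) := by
  have hq : 1 + looQuad t X i ≠ 0 := by have := looQuad_nonneg ht X i; positivity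
  set u := resolvent t (Function.update X i 0) (X i) with hu
  have h1 : sampleCov X u + t • u = (1 + looQuad t X i) • X i := by
    rw [sampleCov_update X i u, hu, sampleCov_resolvent_apply ht, looQuad]
    module
  have h2 := resolvent_shift_apply ht X u
  rw [h1, map_smul] at h2
  rw [← h2, smul_smul, inv_mul_cancel₀ hq, one_smul]

lemma inner_resolvent_sample {t : ℝ} (ht : 0 < t) (X : Fin n → E d) (i : Fin n) :
    (1 / (n : ℝ)) * inner ℝ (X i) (resolvent t X (X i))
      = looQuad t X i / (1 + looQuad t X i) := by
  rw [resolvent_apply_sample ht, real_inner_smul_right]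
  rw [div_eq_inv_mul _ (1 + looQuad t X i)]
  nth_rewrite 3 [looQuad]
  ring

/-- Rank-one perturbation of the resolvent. -/
lemma resolvent_update_sub {t : ℝ} (ht : 0 < t) (X : Fin n → E d) (i : Fin n) :
    resolvent t (Function.update X i 0) - resolvent t X
      = ((1 / (n : ℝ)) * (1 + looQuad t X i)⁻¹) •
        rankOne ℝ (resolvent t (Function.update X i 0) (X i))
          (resolvent t (Function.update X i 0) (X i)) := by
  ext1 v
  set G' := resolvent t (Function.update X i 0)
  have h1 : sampleCov X (G' v) + t • G' v
      = v + ((1 / (n : ℝ)) * inner ℝ (X i) (G' v)) • X i := by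
    rw [sampleCov_update X i, sampleCov_resolvent_apply ht]
    module
  have h2 := resolvent_shift_apply ht X (G' v)
  rw [h1, map_add, map_smul, resolvent_apply_sample ht] at h2
  simp only [sub_apply, smul_apply, rankOne_apply]
  rw [← inner_resolvent_comm ht]
  nth_rewrite 1 [← h2]
  module

lemma tr_resolvent_update_sub {t : ℝ} (ht : 0 < t) (X : Fin n → E d) (i : Fin n) :
    |tr (resolvent t (Function.update X i 0)) - tr (resolvent t X)| ≤ 1 / t := by
  have hq := looQuad_nonneg ht X i
  rw [← tr_sub, resolvent_update_sub ht, tr_smul, tr_rankOne, real_inner_self_eq_norm_sq,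
    abs_of_nonneg (by positivity)]
  have h1 := mul_norm_resolvent_sq_le ht (Function.update X i 0) (X i)
  have h2 : (1 / (n : ℝ)) * (t * ‖resolvent t (Function.update X i 0) (X i)‖ ^ 2)
      ≤ looQuad t X i := by
    rw [looQuad]; gcongr
  have h3 : (1 / (n : ℝ)) * (1 + looQuad t X i)⁻¹ *
      ‖resolvent t (Function.update X i 0) (X i)‖ ^ 2
      = (1 / (n : ℝ)) * (t * ‖resolvent t (Function.update X i 0) (X i)‖ ^ 2)
        / (t * (1 + looQuad t X i)) := by
    field_simp
  rw [h3, div_le_div_iff₀ (by positivity) ht]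
  nlinarith

lemma tr_resolvent_identity {t : ℝ} (ht : 0 < t) (X : Fin n → E d) :
    d - t * tr (resolvent t X) = ∑ i, looQuad t X i / (1 + looQuad t X i) := by
  have h1 : resolvent t X * sampleCov X = 1 - t • resolvent t X := by
    ext1 u
    simpa using resolvent_sampleCov_apply ht X u
  have h2 : resolvent t X * sampleCov X
      = (1 / (n : ℝ)) • ∑ i, rankOne ℝ (resolvent t X (X i)) (X i) := by
    ext1 u
    simp [sampleCov_apply]
  have h3 := congrArg tr h1
  rw [tr_sub, tr_one, tr_smul] at h3
  rw [← h3, h2, tr_smul]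
  have h4 : tr (∑ i, rankOne ℝ (resolvent t X (X i)) (X i))
      = ∑ i, inner ℝ (X i) (resolvent t X (X i)) := by
    simp only [tr]
    rw [ContinuousLinearMap.toLinearMap_sum, map_sum]
    exact Finset.sum_congr rfl fun i _ => tr_rankOne _ _
  rw [h4, Finset.mul_sum]
  exact Finset.sum_congr rfl fun i _ => inner_resolvent_sample ht X i

lemma abs_div_one_add_sub_le {x y : ℝ} (hx : 0 ≤ x) (hy : 0 ≤ y) :
    |x / (1 + x) - y / (1 + y)| ≤ |x - y| := by
  have h : x / (1 + x) - y / (1 + y) = (x - y) / ((1 + x) * (1 + y)) := by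
    field_simp; ring
  rw [h, abs_div, abs_of_pos (by positivity : 0 < (1 + x) * (1 + y))]
  exact div_le_self (abs_nonneg _) (by nlinarith [mul_nonneg hx hy])

/-- The approximate self-consistent equation for the trace of the resolvent. -/
lemma abs_selfConsistent_le {t : ℝ} (ht : 0 < t) (hd : 0 < d) (hn : 0 < n) (X : Fin n → E d) :
    |1 - t * (tr (resolvent t X) / d)
        - (tr (resolvent t X) / d) / (1 + (d / n : ℝ) * (tr (resolvent t X) / d))|
      ≤ (1 / (d : ℝ)) * ∑ i, (|looQuad t X i
          - (1 / (n : ℝ)) * tr (resolvent t (Function.update X i 0))| + 1 / (t * n)) := by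
  have hd' : (0 : ℝ) < d := by exact_mod_cast hd
  have hn' : (0 : ℝ) < n := by exact_mod_cast hn
  set T := tr (resolvent t X) with hT
  have hT0 : 0 ≤ T := tr_resolvent_nonneg ht X
  have hy : 0 ≤ (1 / (n : ℝ)) * T := by positivity
  have h1 : 1 - t * (T / d) - (T / d) / (1 + (d / n : ℝ) * (T / d))
      = (1 / (d : ℝ)) * ∑ i, (looQuad t X i / (1 + looQuad t X i)
        - ((1 / (n : ℝ)) * T) / (1 + (1 / (n : ℝ)) * T)) := by
    rw [Finset.sum_sub_distrib, ← tr_resolvent_identity ht, ← hT]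
    simp only [Finset.sum_const, Finset.card_univ, Fintype.card_fin, nsmul_eq_mul]
    field_simp
  rw [h1, abs_mul, abs_of_pos (by positivity : 0 < 1 / (d : ℝ))]
  refine mul_le_mul_of_nonneg_left ?_ (by positivity)
  refine (Finset.abs_sum_le_sum_abs _ _).trans (Finset.sum_le_sum fun i _ => ?_)
  refine (abs_div_one_add_sub_le (looQuad_nonneg ht X i) hy).trans ?_
  have h2 := tr_resolvent_update_sub ht X i
  set T' := tr (resolvent t (Function.update X i 0))
  have h3 : looQuad t X i - (1 / (n : ℝ)) * T
      = (looQuad t X i - (1 / (n : ℝ)) * T') + (1 / (n : ℝ)) * (T' - T) := by ring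
  rw [h3]
  refine (abs_add_le _ _).trans (add_le_add le_rfl ?_)
  rw [abs_mul, abs_of_pos (by positivity : 0 < 1 / (n : ℝ))]
  calc 1 / (n : ℝ) * |T' - T| ≤ 1 / (n : ℝ) * (1 / t) := by gcongr
    _ = _ := by field_simp

end Resolvent

/-! ### The limiting equation -/

/-- The positive root of `1 - t m = m / (1 + g m)`, the Stieltjes transform at `-t` of the
Marchenko–Pastur law of ratio `g`. This form of the root makes sense also at `t = 0` and `g = 0`. -/
noncomputable def mpRoot (t g : ℝ) : ℝ := 2 / ((t + 1 - g) + √((t + 1 - g) ^ 2 + 4 * g * t))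

lemma mpRoot_denom_pos {t g : ℝ} (ht : 0 < t) (hg : 0 < g) :
    0 < (t + 1 - g) + √((t + 1 - g) ^ 2 + 4 * g * t) := by
  have h : |t + 1 - g| < √((t + 1 - g) ^ 2 + 4 * g * t) := by
    rw [← Real.sqrt_sq_eq_abs]
    exact Real.sqrt_lt_sqrt (sq_nonneg _) (by nlinarith [mul_pos hg ht])
  linarith [neg_abs_le (t + 1 - g)]

lemma mpRoot_pos {t g : ℝ} (ht : 0 < t) (hg : 0 < g) : 0 < mpRoot t g :=
  div_pos two_pos (mpRoot_denom_pos ht hg)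

lemma mpRoot_eq {t g : ℝ} (ht : 0 < t) (hg : 0 < g) :
    1 - t * mpRoot t g = mpRoot t g / (1 + g * mpRoot t g) := by
  have hD := mpRoot_denom_pos ht hg
  have hm := mpRoot_pos ht hg
  have hs := Real.sq_sqrt (by nlinarith [mul_pos hg ht, sq_nonneg (t + 1 - g)] :
    0 ≤ (t + 1 - g) ^ 2 + 4 * g * t)
  have hmD : mpRoot t g * ((t + 1 - g) + √((t + 1 - g) ^ 2 + 4 * g * t)) = 2 :=
    div_mul_cancel₀ _ hD.ne'
  set s := √((t + 1 - g) ^ 2 + 4 * g * t)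
  set m := mpRoot t g
  rw [eq_div_iff (by positivity)]
  have h1 : m * s = 2 - m * (t + 1 - g) := by linarith
  have h2 : (m * s) ^ 2 = m ^ 2 * ((t + 1 - g) ^ 2 + 4 * g * t) := by rw [mul_pow, hs]
  rw [h1] at h2
  nlinarith

lemma mpRoot_le {t g : ℝ} (ht : 0 < t) (hg : 0 < g) : mpRoot t g ≤ 1 / t := by
  have hm := mpRoot_pos ht hg
  have h := mpRoot_eq ht hg
  have h2 : 0 ≤ mpRoot t g / (1 + g * mpRoot t g) := by positivity
  rw [le_div_iff₀ ht]
  linarith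

lemma div_one_add_mul_sub {g x y : ℝ} (hg : 0 ≤ g) (hx : 0 ≤ x) (hy : 0 ≤ y) :
    x / (1 + g * x) - y / (1 + g * y) = (x - y) / ((1 + g * x) * (1 + g * y)) := by
  have h1 : 1 + g * x ≠ 0 := by positivity
  have h2 : 1 + g * y ≠ 0 := by positivity
  field_simp
  ring

/-- Stability of the self-consistent equation. -/
lemma abs_sub_mpRoot_le {t g x : ℝ} (ht : 0 < t) (hg : 0 < g) (hx : 0 ≤ x) :
    |x - mpRoot t g| ≤ 1 / t * |1 - t * x - x / (1 + g * x)| := by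
  have hm := mpRoot_pos ht hg
  have h := mpRoot_eq ht hg
  set m := mpRoot t g
  have h1 : 1 - t * x - x / (1 + g * x) = -((x - m) * (t + 1 / ((1 + g * x) * (1 + g * m)))) := by
    have := div_one_add_mul_sub hg.le hx hm.le
    have h3 : (x - m) * (t + 1 / ((1 + g * x) * (1 + g * m)))
      = t * (x - m) + (x - m) / ((1 + g * x) * (1 + g * m)) := by ring
    rw [h3, ← this, ← h]
    ring
  have h2 : t ≤ t + 1 / ((1 + g * x) * (1 + g * m)) := by
    have : 0 < 1 / ((1 + g * x) * (1 + g * m)) := by positivity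
    linarith
  rw [h1, abs_neg, abs_mul, abs_of_pos (ht.trans_le h2), one_div, inv_mul_eq_div,
    le_div_iff₀ ht]
  gcongr

/-- Minus the derivative of `mpRoot` in its first variable: the limit of the normalized trace of
the squared resolvent. -/
noncomputable def mpRoot₂ (t g : ℝ) : ℝ := mpRoot t g / (t + 1 / (1 + g * mpRoot t g) ^ 2)

/-- `mpRoot₂` is minus the derivative of `mpRoot` in `t`, with an explicit error. -/
lemma abs_slope_sub_mpRoot₂_le {t g h : ℝ} (ht : 0 < t) (hg : 0 < g) (hh : 0 < h) :
    |(mpRoot t g - mpRoot (t + h) g) / h - mpRoot₂ t g| ≤ h / t ^ 3 + g * h / t ^ 5 := by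
  have hth : 0 < t + h := by positivity
  have hm := mpRoot_pos ht hg
  have hm' := mpRoot_pos hth hg
  have e := mpRoot_eq ht hg
  have e' := mpRoot_eq hth hg
  have hle := mpRoot_le ht hg
  have hle' : mpRoot (t + h) g ≤ 1 / t :=
    (mpRoot_le hth hg).trans (one_div_le_one_div_of_le ht (by linarith))
  rw [mpRoot₂]
  set m := mpRoot t g
  set m' := mpRoot (t + h) g
  set D := t + 1 / ((1 + g * m) * (1 + g * m')) with hD
  set D₀ := t + 1 / (1 + g * m) ^ 2 with hD₀
  have hDt : t ≤ D := by
    have : 0 < 1 / ((1 + g * m) * (1 + g * m')) := by positivity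
    linarith
  have hD₀t : t ≤ D₀ := by
    have : 0 < 1 / (1 + g * m) ^ 2 := by positivity
    linarith
  have hDp : 0 < D := ht.trans_le hDt
  have hD₀p : 0 < D₀ := ht.trans_le hD₀t
  have h1 : (m - m') * D = h * m' := by
    have := div_one_add_mul_sub hg.le hm.le hm'.le
    have h3 : (m - m') * D = t * (m - m') + (m - m') / ((1 + g * m) * (1 + g * m')) := by
      rw [hD]; ring
    rw [h3, ← this, ← e, ← e']
    ring
  have h2 : (m - m') / h = m' / D := by
    rw [div_eq_div_iff hh.ne' hDp.ne', h1, mul_comm]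
  have hmm0 : 0 ≤ m - m' := by
    by_contra hcon
    have : (m - m') * D < 0 := mul_neg_of_neg_of_pos (not_le.1 hcon) hDp
    have : 0 < h * m' := by positivity
    linarith
  have hmm : m - m' ≤ h / t ^ 2 := by
    have h4 : (m - m') * t ≤ h * (1 / t) :=
      calc (m - m') * t ≤ (m - m') * D := by gcongr
        _ = h * m' := h1
        _ ≤ _ := by gcongr
    rw [le_div_iff₀ (by positivity)]
    calc (m - m') * t ^ 2 = (m - m') * t * t := by ring
      _ ≤ h * (1 / t) * t := by gcongr
      _ = h := by field_simp
  have hDD : |D₀ - D| ≤ g * h / t ^ 2 := by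
    have h5 : D₀ - D = -(g * (m - m')) / ((1 + g * m) ^ 2 * (1 + g * m')) := by
      rw [hD, hD₀]; field_simp; ring
    rw [h5, abs_div, abs_neg, abs_of_nonneg (by positivity : 0 ≤ g * (m - m')),
      abs_of_pos (by positivity : 0 < (1 + g * m) ^ 2 * (1 + g * m'))]
    have h6 : 1 ≤ (1 + g * m) ^ 2 * (1 + g * m') := by
      have a1 : 1 ≤ 1 + g * m := by linarith [mul_pos hg hm]
      have a2 : 1 ≤ 1 + g * m' := by linarith [mul_pos hg hm']
      exact one_le_mul_of_one_le_of_one_le (one_le_pow₀ a1) a2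
    refine (div_le_self (by positivity) h6).trans ?_
    rw [mul_div_assoc]
    gcongr
  have h7 : m' / D - m / D₀ = -((m - m') / D) + m * (D₀ - D) / (D * D₀) := by
    field_simp; ring
  rw [h2, h7]
  refine (abs_add_le _ _).trans (add_le_add ?_ ?_)
  · rw [abs_neg, abs_div, abs_of_nonneg hmm0, abs_of_pos hDp]
    calc (m - m') / D ≤ (h / t ^ 2) / t := by gcongr
      _ = _ := by field_simp
  · rw [abs_div, abs_mul, abs_of_pos hm, abs_of_pos (mul_pos hDp hD₀p)]
    calc m * |D₀ - D| / (D * D₀) ≤ (1 / t) * (g * h / t ^ 2) / (t * t) := by gcongr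
      _ = _ := by field_simp

/-! ### Convergence of resolvent traces -/

/-- The law of the feature vectors. -/
noncomputable abbrev featLaw (n d : ℕ) : Measure (Fin n → E d) :=
  Measure.pi fun _ => stdGaussian (E d)

lemma map_update_pi {ι α : Type*} [Fintype ι] [DecidableEq ι] [MeasurableSpace α] (μ : Measure α)
    [IsProbabilityMeasure μ] (i : ι) :
    ((Measure.pi fun _ : ι => μ).prod μ).map (fun p => Function.update p.1 i p.2)
      = Measure.pi fun _ => μ := by
  have hm : Measurable fun p : (ι → α) × α => Function.update p.1 i p.2 :=
    measurable_update'
  refine (Measure.pi_eq fun s hs => ?_).symm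
  rw [Measure.map_apply hm (MeasurableSet.univ_pi hs)]
  have h : (fun p : (ι → α) × α => Function.update p.1 i p.2) ⁻¹' (Set.univ.pi s)
      = (Set.univ.pi (Function.update s i Set.univ)) ×ˢ (s i) := by
    ext p
    simp only [Set.mem_preimage, Set.mem_univ_pi, Set.mem_prod]
    constructor
    · intro hp
      refine ⟨fun j => ?_, by simpa using hp i⟩
      rcases eq_or_ne j i with rfl | hj
      · simp
      · simpa [hj] using hp j
    · rintro ⟨h1, h2⟩ j
      rcases eq_or_ne j i with rfl | hj
      · simpa using h2
      · simpa [hj] using h1 j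
  rw [h, Measure.prod_prod, Measure.pi_pi, ← Finset.prod_erase_mul _ _ (Finset.mem_univ i),
    ← Finset.prod_erase_mul Finset.univ (fun j => μ (s j)) (Finset.mem_univ i)]
  simp only [Function.update_self, measure_univ, mul_one]
  congr 1
  refine Finset.prod_congr rfl fun j hj => ?_
  rw [Function.update_of_ne (Finset.ne_of_mem_erase hj)]

/-- Integrating out one coordinate that is independent of the others. -/
lemma lintegral_pi_update {ι α : Type*} [Fintype ι] [DecidableEq ι] [MeasurableSpace α]
    (μ : Measure α) [IsProbabilityMeasure μ] (i : ι) (a : α) {F : (ι → α) → α → ℝ≥0∞}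
    (hF : Measurable (Function.uncurry F)) :
    ∫⁻ X, F (Function.update X i a) (X i) ∂(Measure.pi fun _ => μ)
      = ∫⁻ X, ∫⁻ y, F (Function.update X i a) y ∂μ ∂(Measure.pi fun _ => μ) := by
  have hm : Measurable fun p : (ι → α) × α => Function.update p.1 i p.2 :=
    measurable_update'
  have hm2 : Measurable fun X : ι → α => Function.update X i a := measurable_update_left
  rw [← map_update_pi μ i, lintegral_map, map_update_pi μ i, lintegral_prod]
  · simp
  · simp only [Function.update_idem, Function.update_self]
    exact (hF.comp ((hm2.comp measurable_fst).prodMk measurable_snd)).aemeasurable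
  · exact hF.comp (hm2.prodMk (measurable_pi_apply i))
  · exact hm

lemma continuous_inner_resolvent {n d : ℕ} {t : ℝ} (ht : 0 < t) :
    Continuous fun p : (Fin n → E d) × E d => (inner ℝ p.2 (resolvent t p.1 p.2) : ℝ) :=
  continuous_snd.inner
    (((continuous_resolvent ht).comp continuous_fst).clm_apply continuous_snd)

lemma measurable_tr_resolvent {n d : ℕ} {t : ℝ} (ht : 0 < t) :
    Measurable fun X : Fin n → E d => tr (resolvent t X) :=
  (continuous_tr.comp (continuous_resolvent ht)).measurable

lemma lintegral_looQuad_sub_le {n d : ℕ} {t : ℝ} (ht : 0 < t) (hd : 0 < d) (hn : 0 < n)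
    (i : Fin n) :
    ∫⁻ X, ENNReal.ofReal |looQuad t X i
        - (1 / (n : ℝ)) * tr (resolvent t (Function.update X i 0))| ∂(featLaw n d)
      ≤ ENNReal.ofReal (√((gaussKurt + 1) * d) / (t * n)) := by
  have hd' : (0 : ℝ) < d := by exact_mod_cast hd
  have hn' : (0 : ℝ) < n := by exact_mod_cast hn
  have hK := gaussKurt_nonneg
  set F : (Fin n → E d) → E d → ℝ := fun X y =>
    (1 / (n : ℝ)) * inner ℝ y (resolvent t X y) - (1 / (n : ℝ)) * tr (resolvent t X) with hF
  have hFm : Measurable (Function.uncurry F) :=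
    ((continuous_inner_resolvent ht).measurable.const_mul _).sub
      (((measurable_tr_resolvent ht).comp measurable_fst).const_mul _)
  have hFX : ∀ X, Measurable (F X) := fun X => hFm.of_uncurry_left
  have h := lintegral_pi_update (stdGaussian (E d)) i 0
    (F := fun X y => ENNReal.ofReal |F X y|) hFm.abs.ennreal_ofReal
  refine (le_of_eq h).trans ?_
  have hb : ∀ X : Fin n → E d, ∫⁻ y, ENNReal.ofReal |F X y| ∂(stdGaussian (E d))
      ≤ ENNReal.ofReal (√((gaussKurt + 1) * d) / (t * n)) := by
    intro X
    refine lintegral_abs_le_of_sq (f := F X) (hFX X) (by positivity) ?_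
    have h1 : ∀ y, ENNReal.ofReal (F X y ^ 2) = ENNReal.ofReal (1 / (n : ℝ) ^ 2) *
        ENNReal.ofReal ((inner ℝ y (resolvent t X y) - tr (resolvent t X)) ^ 2) := by
      intro y
      rw [← ENNReal.ofReal_mul (by positivity)]
      congr 1
      simp only [hF]
      ring
    simp_rw [h1]
    have hm1 : Measurable fun y : E d =>
        ENNReal.ofReal ((inner ℝ y (resolvent t X y) - tr (resolvent t X)) ^ 2) := by fun_prop
    rw [lintegral_const_mul _ hm1]
    refine (mul_le_mul_right (lintegral_quadForm_sub_trace_sq_le (resolvent t X)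
      (isSymmetric_resolvent ht X)) _).trans ?_
    rw [← ENNReal.ofReal_mul (by positivity)]
    refine ENNReal.ofReal_le_ofReal ?_
    rw [div_pow, Real.sq_sqrt (by positivity), finrank_euclideanSpace_fin, mul_pow]
    have h2 : ‖resolvent t X‖ ^ 2 ≤ (1 / t) ^ 2 :=
      pow_le_pow_left₀ (norm_nonneg _) (norm_resolvent_le ht X) 2
    calc 1 / (n : ℝ) ^ 2 * (gaussKurt * d * ‖resolvent t X‖ ^ 2)
        ≤ 1 / (n : ℝ) ^ 2 * ((gaussKurt + 1) * d * (1 / t) ^ 2) := by gcongr; linarith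
      _ = _ := by field_simp
  calc _ ≤ ∫⁻ _X, ENNReal.ofReal (√((gaussKurt + 1) * d) / (t * n)) ∂(featLaw n d) :=
        lintegral_mono fun X => hb _
    _ = _ := by simp

/-- The rate of convergence of the normalized resolvent trace. -/
noncomputable def mpErr (t : ℝ) (d : ℕ) : ℝ := (√((gaussKurt + 1) * d) + 1) / (t ^ 2 * d)

lemma mpErr_nonneg (t : ℝ) (d : ℕ) : 0 ≤ mpErr t d := by unfold mpErr; positivity

/-- The normalized resolvent trace converges in `L¹`: the self-consistent equation holds up to the
fluctuations of the leave-one-out quadratic forms, and it is stable. -/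
theorem lintegral_tr_resolvent_sub_mpRoot_le {n d : ℕ} {t : ℝ} (ht : 0 < t) (hd : 0 < d)
    (hn : 0 < n) :
    ∫⁻ X, ENNReal.ofReal |tr (resolvent t X) / d - mpRoot t (d / n)| ∂(featLaw n d)
      ≤ ENNReal.ofReal (mpErr t d) := by
  have hd' : (0 : ℝ) < d := by exact_mod_cast hd
  have hn' : (0 : ℝ) < n := by exact_mod_cast hn
  set A : Fin n → (Fin n → E d) → ℝ := fun i X => |looQuad t X i
    - (1 / (n : ℝ)) * tr (resolvent t (Function.update X i 0))| with hA
  have hupd : ∀ i : Fin n, Continuous fun X : Fin n → E d => Function.update X i (0 : E d) :=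
    fun i => continuous_id.update i continuous_const
  have hAm : ∀ i, Measurable (A i) := by
    intro i
    refine (Measurable.sub ?_ ?_).abs
    · exact (((continuous_inner_resolvent ht).comp
        ((hupd i).prodMk (continuous_apply i))).const_mul _).measurable
    · exact ((measurable_tr_resolvent ht).comp (hupd i).measurable).const_mul _
  have hpt : ∀ X : Fin n → E d, ENNReal.ofReal |tr (resolvent t X) / d - mpRoot t (d / n)|
      ≤ ENNReal.ofReal (1 / (t * d)) *
        ∑ i, (ENNReal.ofReal (A i X) + ENNReal.ofReal (1 / (t * n))) := by
    intro X
    have hsum : ∀ i, ENNReal.ofReal (A i X) + ENNReal.ofReal (1 / (t * n))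
        = ENNReal.ofReal (A i X + 1 / (t * n)) :=
      fun i => (ENNReal.ofReal_add (abs_nonneg _) (by positivity)).symm
    simp_rw [hsum]
    rw [← ENNReal.ofReal_sum_of_nonneg (fun i _ => by positivity),
      ← ENNReal.ofReal_mul (by positivity)]
    refine ENNReal.ofReal_le_ofReal ?_
    refine (abs_sub_mpRoot_le ht (by positivity)
      (div_nonneg (tr_resolvent_nonneg ht X) hd'.le)).trans ?_
    calc _ ≤ 1 / t * _ := mul_le_mul_of_nonneg_left (abs_selfConsistent_le ht hd hn X)
          (by positivity)
      _ = _ := by rw [← mul_assoc]; congr 1; field_simp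
  calc _ ≤ ∫⁻ X, ENNReal.ofReal (1 / (t * d)) *
        ∑ i, (ENNReal.ofReal (A i X) + ENNReal.ofReal (1 / (t * n))) ∂(featLaw n d) :=
        lintegral_mono hpt
    _ = ENNReal.ofReal (1 / (t * d)) *
        ∑ i, (∫⁻ X, ENNReal.ofReal (A i X) ∂(featLaw n d) + ENNReal.ofReal (1 / (t * n))) := by
        have hm : ∀ i, Measurable fun X => ENNReal.ofReal (A i X) + ENNReal.ofReal (1 / (t * n)) :=
          fun i => (hAm i).ennreal_ofReal.add_const _
        rw [lintegral_const_mul _ (Finset.measurable_fun_sum _ fun i _ => hm i),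
          lintegral_finsetSum _ fun i _ => hm i]
        congr 1
        refine Finset.sum_congr rfl fun i _ => ?_
        rw [lintegral_add_right _ measurable_const]
        simp
    _ ≤ ENNReal.ofReal (1 / (t * d)) * ∑ _i : Fin n,
        (ENNReal.ofReal (√((gaussKurt + 1) * d) / (t * n)) + ENNReal.ofReal (1 / (t * n))) := by
        gcongr with i
        exact lintegral_looQuad_sub_le ht hd hn i
    _ = ENNReal.ofReal (mpErr t d) := by
        simp only [Finset.sum_const, Finset.card_univ, Fintype.card_fin, nsmul_eq_mul]
        rw [← ENNReal.ofReal_add (by positivity) (by positivity), ← ENNReal.ofReal_natCast n,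
          ← ENNReal.ofReal_mul (by positivity), ← ENNReal.ofReal_mul (by positivity), mpErr]
        congr 1
        field_simp

/-- The rate of convergence of the normalized trace of the squared resolvent, for a finite
difference step `h`. -/
noncomputable def mpErr₂ (t g : ℝ) (d : ℕ) (h : ℝ) : ℝ :=
  h / t ^ 3 + 2 / h * mpErr t d + (h / t ^ 3 + g * h / t ^ 5)

/-- The squared resolvent is compared with a difference quotient of the resolvent in `t`. -/
theorem lintegral_tr_resolvent_sq_sub_le {n d : ℕ} {t h : ℝ} (ht : 0 < t) (hh : 0 < h)
    (hd : 0 < d) (hn : 0 < n) :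
    ∫⁻ X, ENNReal.ofReal |tr (resolvent t X * resolvent t X) / d - mpRoot₂ t (d / n)|
        ∂(featLaw n d) ≤ ENNReal.ofReal (mpErr₂ t (d / n) d h) := by
  have hd' : (0 : ℝ) < d := by exact_mod_cast hd
  have hn' : (0 : ℝ) < n := by exact_mod_cast hn
  have hth : 0 < t + h := by positivity
  set A : ℝ → (Fin n → E d) → ℝ := fun s X => |tr (resolvent s X) / d - mpRoot s (d / n)| with hA
  have hAm : ∀ s, 0 < s → Measurable (A s) := fun s hs =>
    (((measurable_tr_resolvent hs).div_const _).sub_const _).abs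
  have hpt : ∀ X : Fin n → E d,
      ENNReal.ofReal |tr (resolvent t X * resolvent t X) / d - mpRoot₂ t (d / n)|
      ≤ ENNReal.ofReal (1 / h) * (ENNReal.ofReal (A t X) + ENNReal.ofReal (A (t + h) X))
        + ENNReal.ofReal (h / t ^ 3 + (h / t ^ 3 + (d / n : ℝ) * h / t ^ 5)) := by
    intro X
    rw [← ENNReal.ofReal_add (abs_nonneg _) (abs_nonneg _), ← ENNReal.ofReal_mul (by positivity),
      ← ENNReal.ofReal_add (by positivity) (by positivity)]
    refine ENNReal.ofReal_le_ofReal ?_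
    set G := resolvent t X with hG
    set G' := resolvent (t + h) X with hG'
    have hGn : ‖G‖ ≤ 1 / t := norm_resolvent_le ht X
    have hGn' : ‖G'‖ ≤ 1 / t :=
      (norm_resolvent_le hth X).trans (one_div_le_one_div_of_le ht (by linarith))
    have e1 : G - G' = h • (G * G') := resolvent_sub_resolvent ht hh X
    have e2 : tr G - tr G' = h * tr (G * G') := by rw [← tr_sub, e1, tr_smul]
    have e3 : G * G - G * G' = h • (G * (G * G')) := by
      rw [← mul_sub, e1]
      ext1 u
      simp
    have e4 : |tr (G * G) - tr (G * G')| ≤ d * (h * (1 / t * (1 / t * (1 / t)))) := by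
      rw [← tr_sub, e3]
      refine (abs_tr_le _).trans (mul_le_mul_of_nonneg_left ?_ hd'.le)
      rw [norm_smul, Real.norm_of_nonneg hh.le]
      refine mul_le_mul_of_nonneg_left ?_ hh.le
      refine (norm_mul_le _ _).trans (mul_le_mul hGn ?_ (norm_nonneg _) (by positivity))
      exact (norm_mul_le _ _).trans (mul_le_mul hGn hGn' (norm_nonneg _) (by positivity))
    have e5 : tr (G * G) / d - mpRoot₂ t (d / n)
        = (tr (G * G) - tr (G * G')) / d
          + ((1 / h) * ((tr G / d - mpRoot t (d / n)) - (tr G' / d - mpRoot (t + h) (d / n)))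
          + ((mpRoot t (d / n) - mpRoot (t + h) (d / n)) / h - mpRoot₂ t (d / n))) := by
      have : tr (G * G') = (tr G - tr G') / h := by rw [e2]; field_simp
      rw [this]
      field_simp
      ring
    rw [e5]
    have b1 : |(tr (G * G) - tr (G * G')) / d| ≤ h / t ^ 3 := by
      rw [abs_div, abs_of_pos hd', div_le_iff₀ hd']
      refine e4.trans (le_of_eq ?_)
      field_simp
    have b2 := abs_slope_sub_mpRoot₂_le ht (by positivity : (0 : ℝ) < d / n) hh
    have b3 : |(1 / h) * ((tr G / d - mpRoot t (d / n)) - (tr G' / d - mpRoot (t + h) (d / n)))|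
        ≤ 1 / h * (A t X + A (t + h) X) := by
      rw [abs_mul, abs_of_pos (by positivity : 0 < 1 / h)]
      exact mul_le_mul_of_nonneg_left (abs_sub _ _) (by positivity)
    have b4 := abs_add_le ((tr (G * G) - tr (G * G')) / d)
      ((1 / h) * ((tr G / d - mpRoot t (d / n)) - (tr G' / d - mpRoot (t + h) (d / n)))
          + ((mpRoot t (d / n) - mpRoot (t + h) (d / n)) / h - mpRoot₂ t (d / n)))
    have b5 := abs_add_le
      ((1 / h) * ((tr G / d - mpRoot t (d / n)) - (tr G' / d - mpRoot (t + h) (d / n))))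
      ((mpRoot t (d / n) - mpRoot (t + h) (d / n)) / h - mpRoot₂ t (d / n))
    linarith
  have herr : mpErr (t + h) d ≤ mpErr t d := by
    unfold mpErr
    gcongr
    linarith
  calc _ ≤ ∫⁻ X, (ENNReal.ofReal (1 / h) * (ENNReal.ofReal (A t X) + ENNReal.ofReal (A (t + h) X))
        + ENNReal.ofReal (h / t ^ 3 + (h / t ^ 3 + (d / n : ℝ) * h / t ^ 5))) ∂(featLaw n d) :=
        lintegral_mono hpt
    _ = ENNReal.ofReal (1 / h) * (∫⁻ X, ENNReal.ofReal (A t X) ∂(featLaw n d)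
          + ∫⁻ X, ENNReal.ofReal (A (t + h) X) ∂(featLaw n d))
        + ENNReal.ofReal (h / t ^ 3 + (h / t ^ 3 + (d / n : ℝ) * h / t ^ 5)) := by
        have hm : Measurable fun X => ENNReal.ofReal (A t X) + ENNReal.ofReal (A (t + h) X) :=
          (hAm t ht).ennreal_ofReal.add (hAm _ hth).ennreal_ofReal
        rw [lintegral_add_right _ measurable_const, lintegral_const_mul _ hm,
          lintegral_add_left (hAm t ht).ennreal_ofReal]
        simp
    _ ≤ ENNReal.ofReal (1 / h) * (ENNReal.ofReal (mpErr t d) + ENNReal.ofReal (mpErr t d))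
        + ENNReal.ofReal (h / t ^ 3 + (h / t ^ 3 + (d / n : ℝ) * h / t ^ 5)) := by
        gcongr
        · exact lintegral_tr_resolvent_sub_mpRoot_le ht hd hn
        · exact (lintegral_tr_resolvent_sub_mpRoot_le hth hd hn).trans
            (ENNReal.ofReal_le_ofReal herr)
    _ = _ := by
        have := mpErr_nonneg t d
        rw [← ENNReal.ofReal_add (by positivity) (by positivity),
          ← ENNReal.ofReal_mul (by positivity), ← ENNReal.ofReal_add (by positivity) (by positivity),
          mpErr₂]
        congr 1
        ring

/-! ### Rotation invariance and quadratic forms of the resolvent -/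

lemma map_isometry_featLaw {n d : ℕ} (Q : E d ≃ₗᵢ[ℝ] E d) :
    (featLaw n d).map (fun X i => Q (X i)) = featLaw n d := by
  have h := Measure.pi_map_pi (μ := fun _ : Fin n => stdGaussian (E d)) (f := fun _ => Q)
    fun _ => Q.continuous.measurable.aemeasurable
  rw [featLaw, h]
  congr 1
  ext1 i
  exact stdGaussian_map Q

lemma sampleCov_isometry {n d : ℕ} (Q : E d ≃ₗᵢ[ℝ] E d) (X : Fin n → E d) (u : E d) :
    sampleCov (fun i => Q (X i)) (Q u) = Q (sampleCov X u) := by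
  simp [sampleCov_apply, map_sum]

lemma resolvent_isometry {n d : ℕ} {t : ℝ} (ht : 0 < t) (Q : E d ≃ₗᵢ[ℝ] E d)
    (X : Fin n → E d) (u : E d) :
    resolvent t (fun i => Q (X i)) (Q u) = Q (resolvent t X u) := by
  have h := resolvent_shift_apply ht (fun i => Q (X i)) (Q (resolvent t X u))
  rwa [sampleCov_isometry, ← map_smul, ← map_add, shift_resolvent_apply ht] at h

section Rotation

variable {n d : ℕ} {A : (Fin n → E d) → (E d →L[ℝ] E d)}

/-- The second moment of the quadratic form of a rotation-equivariant random operator depends on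
the vector through its norm only. -/
lemma norm_pow_mul_lintegral_quadForm (hA : Continuous A)
    (hrot : ∀ (Q : E d ≃ₗᵢ[ℝ] E d) X u, A (fun i => Q (X i)) (Q u) = Q (A X u)) (u v : E d) :
    ENNReal.ofReal (‖v‖ ^ 4) * ∫⁻ X, ENNReal.ofReal (inner ℝ u (A X u) ^ 2) ∂(featLaw n d)
      = ENNReal.ofReal (‖u‖ ^ 4) *
        ∫⁻ X, ENNReal.ofReal (inner ℝ v (A X v) ^ 2) ∂(featLaw n d) := by
  have hm : ∀ w : E d, Measurable fun X => ENNReal.ofReal (inner ℝ w (A X w) ^ 2) := fun w =>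
    ((continuous_const.inner (hA.clm_apply continuous_const)).pow 2).measurable.ennreal_ofReal
  have hsmul : ∀ (c : ℝ) (w : E d),
      ∫⁻ X, ENNReal.ofReal (inner ℝ (c • w) (A X (c • w)) ^ 2) ∂(featLaw n d)
        = ENNReal.ofReal (c ^ 4) *
          ∫⁻ X, ENNReal.ofReal (inner ℝ w (A X w) ^ 2) ∂(featLaw n d) := by
    intro c w
    rw [← lintegral_const_mul _ (hm w)]
    refine lintegral_congr fun X => ?_
    rw [← ENNReal.ofReal_mul (by positivity), map_smul, real_inner_smul_left,
      real_inner_smul_right]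
    congr 1
    ring
  have hnorm : ‖‖v‖ • u‖ = ‖‖u‖ • v‖ := by simp [norm_smul, mul_comm]
  rw [← hsmul, ← hsmul]
  -- a reflection carries one rescaled vector to the other
  set Q : E d ≃ₗᵢ[ℝ] E d := (ℝ ∙ (‖v‖ • u - ‖u‖ • v))ᗮ.reflection
  have hQ : Q (‖v‖ • u) = ‖u‖ • v := Submodule.reflection_sub hnorm
  have hQm : Measurable fun (X : Fin n → E d) i => Q (X i) := by fun_prop
  conv_rhs => rw [← map_isometry_featLaw Q, lintegral_map (hm _) hQm]
  refine lintegral_congr fun X => ?_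
  rw [← hQ, hrot, Q.inner_map_map]

/-- A rotation-equivariant symmetric random operator with small normalized trace has small
quadratic forms: by rotation invariance the fixed vector may be replaced by a Gaussian one. -/
lemma lintegral_quadForm_sq_le (hd : 0 < d) (hA : Continuous A)
    (hrot : ∀ (Q : E d ≃ₗᵢ[ℝ] E d) X u, A (fun i => Q (X i)) (Q u) = Q (A X u))
    (hsymm : ∀ X, (A X : E d →ₗ[ℝ] E d).IsSymmetric) {C e : ℝ} (hC : 0 ≤ C) (he : 0 ≤ e)
    (hAC : ∀ X, ‖A X‖ ≤ C)
    (htr : ∫⁻ X, ENNReal.ofReal |tr (A X) / d| ∂(featLaw n d) ≤ ENNReal.ofReal e) (u : E d) :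
    ∫⁻ X, ENNReal.ofReal (inner ℝ u (A X u) ^ 2) ∂(featLaw n d)
      ≤ ENNReal.ofReal (‖u‖ ^ 4 * (2 * C * e + 2 * gaussKurt * C ^ 2 / d)) := by
  have hd' : (0 : ℝ) < d := by exact_mod_cast hd
  have hK := gaussKurt_nonneg
  have hjc : Continuous fun p : E d × (Fin n → E d) => (inner ℝ p.1 (A p.2 p.1) : ℝ) :=
    continuous_fst.inner ((hA.comp continuous_snd).clm_apply continuous_fst)
  have hjm : Measurable (Function.uncurry fun (v : E d) (X : Fin n → E d) =>
      ENNReal.ofReal (inner ℝ v (A X v) ^ 2)) := (hjc.pow 2).measurable.ennreal_ofReal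
  have htrm : Measurable fun X => tr (A X) := (continuous_tr.comp hA).measurable
  have hX : ∀ X, ∫⁻ v, ENNReal.ofReal (inner ℝ v (A X v) ^ 2) ∂(stdGaussian (E d))
      ≤ ENNReal.ofReal (2 * C * d ^ 2) * ENNReal.ofReal |tr (A X) / d|
        + ENNReal.ofReal (2 * (gaussKurt * d * C ^ 2)) := by
    intro X
    have hm1 : Measurable fun y : E d => ENNReal.ofReal ((inner ℝ y (A X y) - tr (A X)) ^ 2) := by
      fun_prop
    calc _ ≤ ∫⁻ v, (ENNReal.ofReal 2 * ENNReal.ofReal ((inner ℝ v (A X v) - tr (A X)) ^ 2)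
          + ENNReal.ofReal (2 * tr (A X) ^ 2)) ∂(stdGaussian (E d)) := by
          refine lintegral_mono fun v => ?_
          rw [← ENNReal.ofReal_mul (by norm_num), ← ENNReal.ofReal_add (by positivity)
            (by positivity)]
          refine ENNReal.ofReal_le_ofReal ?_
          nlinarith [sq_nonneg (inner ℝ v (A X v) - 2 * tr (A X))]
      _ = ENNReal.ofReal 2 * ∫⁻ v, ENNReal.ofReal ((inner ℝ v (A X v) - tr (A X)) ^ 2)
            ∂(stdGaussian (E d)) + ENNReal.ofReal (2 * tr (A X) ^ 2) := by
          rw [lintegral_add_right _ measurable_const, lintegral_const_mul _ hm1]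
          simp
      _ ≤ ENNReal.ofReal 2 * ENNReal.ofReal (gaussKurt * d * C ^ 2)
            + ENNReal.ofReal (2 * C * d ^ 2 * |tr (A X) / d|) := by
          refine add_le_add (mul_le_mul_right ?_ _) (ENNReal.ofReal_le_ofReal ?_)
          · refine (lintegral_quadForm_sub_trace_sq_le (A X) (hsymm X)).trans ?_
            rw [finrank_euclideanSpace_fin]
            refine ENNReal.ofReal_le_ofReal ?_
            have := hAC X
            gcongr
          · have h1 : |tr (A X)| ≤ d * C :=
              (abs_tr_le _).trans (mul_le_mul_of_nonneg_left (hAC X) hd'.le)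
            have h2 : 2 * C * d ^ 2 * |tr (A X) / d| = 2 * (d * C) * |tr (A X)| := by
              rw [abs_div, abs_of_pos hd']; field_simp
            rw [h2, ← sq_abs]
            nlinarith [abs_nonneg (tr (A X))]
      _ = _ := by
          rw [← ENNReal.ofReal_mul (by positivity : 0 ≤ 2 * C * (d : ℝ) ^ 2),
            ← ENNReal.ofReal_mul (by norm_num), add_comm]
  -- average over a Gaussian `v`, then compare with `u`, using `d² ≤ 𝔼‖v‖⁴`
  have hint : ∫⁻ v, ∫⁻ X, ENNReal.ofReal (inner ℝ v (A X v) ^ 2) ∂(featLaw n d)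
        ∂(stdGaussian (E d)) ≤ ENNReal.ofReal (2 * C * d ^ 2 * e + 2 * (gaussKurt * d * C ^ 2)) := by
    rw [lintegral_lintegral_swap hjm.aemeasurable]
    calc _ ≤ ∫⁻ X, (ENNReal.ofReal (2 * C * d ^ 2) * ENNReal.ofReal |tr (A X) / d|
        + ENNReal.ofReal (2 * (gaussKurt * d * C ^ 2))) ∂(featLaw n d) := lintegral_mono hX
      _ = ENNReal.ofReal (2 * C * d ^ 2) * ∫⁻ X, ENNReal.ofReal |tr (A X) / d| ∂(featLaw n d)
        + ENNReal.ofReal (2 * (gaussKurt * d * C ^ 2)) := by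
          rw [lintegral_add_right _ measurable_const,
            lintegral_const_mul _ (htrm.div_const _).abs.ennreal_ofReal]
          simp
      _ ≤ ENNReal.ofReal (2 * C * d ^ 2) * ENNReal.ofReal e
        + ENNReal.ofReal (2 * (gaussKurt * d * C ^ 2)) := by gcongr
      _ = _ := by
          rw [← ENNReal.ofReal_mul (by positivity), ← ENNReal.ofReal_add (by positivity)
            (by positivity)]
  have hmain : ENNReal.ofReal ((d : ℝ) ^ 2) *
      ∫⁻ X, ENNReal.ofReal (inner ℝ u (A X u) ^ 2) ∂(featLaw n d)
      ≤ ENNReal.ofReal (‖u‖ ^ 4) *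
        ENNReal.ofReal (2 * C * d ^ 2 * e + 2 * (gaussKurt * d * C ^ 2)) := by
    have h4 := sq_finrank_le_lintegral_norm_pow_four (V := E d)
    rw [finrank_euclideanSpace_fin] at h4
    calc _ ≤ (∫⁻ v : E d, ENNReal.ofReal (‖v‖ ^ 4) ∂(stdGaussian (E d))) *
          ∫⁻ X, ENNReal.ofReal (inner ℝ u (A X u) ^ 2) ∂(featLaw n d) := by
          gcongr
          rwa [ENNReal.ofReal_pow hd'.le, ENNReal.ofReal_natCast]
      _ = ∫⁻ v : E d, ENNReal.ofReal (‖u‖ ^ 4) *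
          ∫⁻ X, ENNReal.ofReal (inner ℝ v (A X v) ^ 2) ∂(featLaw n d) ∂(stdGaussian (E d)) := by
          rw [← lintegral_mul_const _ (by fun_prop)]
          exact lintegral_congr fun v => norm_pow_mul_lintegral_quadForm hA hrot u v
      _ = ENNReal.ofReal (‖u‖ ^ 4) * ∫⁻ v : E d,
          ∫⁻ X, ENNReal.ofReal (inner ℝ v (A X v) ^ 2) ∂(featLaw n d) ∂(stdGaussian (E d)) :=
          lintegral_const_mul _ hjm.lintegral_prod_right
      _ ≤ _ := by gcongr
  have hd2 : ENNReal.ofReal ((d : ℝ) ^ 2) ≠ 0 := by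
    rw [Ne, ENNReal.ofReal_eq_zero, not_le]; positivity
  have heq : ENNReal.ofReal (‖u‖ ^ 4) *
        ENNReal.ofReal (2 * C * d ^ 2 * e + 2 * (gaussKurt * d * C ^ 2))
      = ENNReal.ofReal ((d : ℝ) ^ 2) *
        ENNReal.ofReal (‖u‖ ^ 4 * (2 * C * e + 2 * gaussKurt * C ^ 2 / d)) := by
    rw [← ENNReal.ofReal_mul (by positivity), ← ENNReal.ofReal_mul (by positivity)]
    congr 1
    field_simp
  rw [heq] at hmain
  exact (ENNReal.mul_le_mul_iff_right hd2 ENNReal.ofReal_ne_top).1 hmain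

end Rotation

section ResolventForms

variable {n d : ℕ} {t : ℝ}

lemma isSymmetric_sub_smul_one {A : E d →L[ℝ] E d} (hA : (A : E d →ₗ[ℝ] E d).IsSymmetric) (m : ℝ) :
    ((A - m • (1 : E d →L[ℝ] E d) : E d →L[ℝ] E d) : E d →ₗ[ℝ] E d).IsSymmetric := by
  intro u v
  have := hA u v
  simp only [ContinuousLinearMap.coe_coe] at this
  simp [inner_sub_left, inner_sub_right, real_inner_smul_left, real_inner_smul_right, this]

lemma tr_sub_smul_one_div (hd : 0 < d) (A : E d →L[ℝ] E d) (m : ℝ) :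
    tr (A - m • (1 : E d →L[ℝ] E d)) / d = tr A / d - m := by
  have hd' : (0 : ℝ) < d := by exact_mod_cast hd
  rw [tr_sub, tr_smul, tr_one]
  field_simp

lemma norm_sub_smul_one_le {A : E d →L[ℝ] E d} {m C : ℝ} (hA : ‖A‖ ≤ C) (hm0 : 0 ≤ m)
    (hm : m ≤ C) : ‖A - m • (1 : E d →L[ℝ] E d)‖ ≤ 2 * C := by
  have h1 : ‖m • (1 : E d →L[ℝ] E d)‖ ≤ C := by
    rw [norm_smul, Real.norm_of_nonneg hm0]
    calc m * ‖(1 : E d →L[ℝ] E d)‖ ≤ m * 1 := by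
          gcongr; exact ContinuousLinearMap.norm_id_le
      _ ≤ C := by linarith
  linarith [norm_sub_le A (m • (1 : E d →L[ℝ] E d))]

lemma lintegral_inner_resolvent_sub_le (ht : 0 < t) (hd : 0 < d) (hn : 0 < n) (u : E d) :
    ∫⁻ X, ENNReal.ofReal ((inner ℝ u (resolvent t X u) - mpRoot t (d / n) * ‖u‖ ^ 2) ^ 2)
        ∂(featLaw n d)
      ≤ ENNReal.ofReal (‖u‖ ^ 4 * (2 * (2 * (1 / t)) * mpErr t d
          + 2 * gaussKurt * (2 * (1 / t)) ^ 2 / d)) := by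
  have hd' : (0 : ℝ) < d := by exact_mod_cast hd
  have hn' : (0 : ℝ) < n := by exact_mod_cast hn
  have hg : (0 : ℝ) < d / n := by positivity
  refine le_trans (le_of_eq ?_) (lintegral_quadForm_sq_le
    (A := fun X : Fin n → E d => resolvent t X - mpRoot t (d / n) • (1 : E d →L[ℝ] E d)) hd
    ((continuous_resolvent ht).sub continuous_const) ?_
    (fun X => isSymmetric_sub_smul_one (isSymmetric_resolvent ht X) _) (by positivity)
    (mpErr_nonneg t d)
    (fun X => norm_sub_smul_one_le (norm_resolvent_le ht X) (mpRoot_pos ht hg).le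
      (mpRoot_le ht hg)) ?_ u)
  · refine lintegral_congr fun X => ?_
    simp [inner_sub_right, real_inner_smul_right]
  · intro Q X v
    simp [resolvent_isometry ht]
  · simp_rw [tr_sub_smul_one_div hd]
    exact lintegral_tr_resolvent_sub_mpRoot_le ht hd hn

lemma mpRoot₂_nonneg {g : ℝ} (ht : 0 < t) (hg : 0 < g) : 0 ≤ mpRoot₂ t g := by
  have := mpRoot_pos ht hg
  unfold mpRoot₂
  positivity

lemma mpRoot₂_le {g : ℝ} (ht : 0 < t) (hg : 0 < g) : mpRoot₂ t g ≤ 1 / t * (1 / t) := by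
  have h := mpRoot_pos ht hg
  have h1 : 0 < 1 / (1 + g * mpRoot t g) ^ 2 := by positivity
  calc mpRoot₂ t g ≤ mpRoot t g / t := by unfold mpRoot₂; gcongr; linarith
    _ ≤ (1 / t) / t := by gcongr; exact mpRoot_le ht hg
    _ = _ := by ring

lemma inner_resolvent_sq (ht : 0 < t) (X : Fin n → E d) (u : E d) :
    inner ℝ u (resolvent t X (resolvent t X u)) = ‖resolvent t X u‖ ^ 2 := by
  rw [inner_resolvent_comm ht, real_inner_self_eq_norm_sq]

lemma lintegral_norm_resolvent_sq_sub_le {h : ℝ} (ht : 0 < t) (hh : 0 < h) (hd : 0 < d)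
    (hn : 0 < n) (u : E d) :
    ∫⁻ X, ENNReal.ofReal ((‖resolvent t X u‖ ^ 2 - mpRoot₂ t (d / n) * ‖u‖ ^ 2) ^ 2)
        ∂(featLaw n d)
      ≤ ENNReal.ofReal (‖u‖ ^ 4 * (2 * (2 * (1 / t * (1 / t))) * mpErr₂ t (d / n) d h
          + 2 * gaussKurt * (2 * (1 / t * (1 / t))) ^ 2 / d)) := by
  have hd' : (0 : ℝ) < d := by exact_mod_cast hd
  have hn' : (0 : ℝ) < n := by exact_mod_cast hn
  have hg : (0 : ℝ) < d / n := by positivity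
  have herr : 0 ≤ mpErr₂ t (d / n) d h := by
    have := mpErr_nonneg t d
    unfold mpErr₂
    positivity
  have hsymm : ∀ X : Fin n → E d,
      ((resolvent t X * resolvent t X : E d →L[ℝ] E d) : E d →ₗ[ℝ] E d).IsSymmetric := by
    intro X v w
    simp [inner_resolvent_comm ht]
  refine le_trans (le_of_eq ?_) (lintegral_quadForm_sq_le
    (A := fun X : Fin n → E d => resolvent t X * resolvent t X - mpRoot₂ t (d / n) • (1 : E d →L[ℝ] E d)) hd
    (((continuous_resolvent ht).mul (continuous_resolvent ht)).sub continuous_const) ?_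
    (fun X => isSymmetric_sub_smul_one (hsymm X) _) (by positivity) herr
    (fun X => norm_sub_smul_one_le ((norm_mul_le _ _).trans (mul_le_mul (norm_resolvent_le ht X)
      (norm_resolvent_le ht X) (norm_nonneg _) (by positivity))) (mpRoot₂_nonneg ht hg)
      (mpRoot₂_le ht hg)) ?_ u)
  · refine lintegral_congr fun X => ?_
    simp [inner_sub_right, real_inner_smul_right, inner_resolvent_sq ht]
  · intro Q X v
    simp [resolvent_isometry ht]
  · simp_rw [tr_sub_smul_one_div hd]
    exact lintegral_tr_resolvent_sq_sub_le ht hh hd hn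

end ResolventForms

/-! ### The noise term -/

section Noise

open InnerProductSpace ContinuousLinearMap

variable {n d : ℕ} {t : ℝ}

/-- The operator `z ↦ (1/n) ∑ zᵢ xᵢ`. -/
noncomputable def noiseMap (X : Fin n → E d) : E n →L[ℝ] E d :=
  (1 / (n : ℝ)) • ∑ i, rankOne ℝ (X i) (EuclideanSpace.single i (1 : ℝ))

lemma noiseMap_apply (X : Fin n → E d) (z : E n) :
    noiseMap X z = (1 / (n : ℝ)) • ∑ i, z i • X i := by
  simp [noiseMap, EuclideanSpace.inner_single_left]

lemma continuous_noiseMap : Continuous (noiseMap : (Fin n → E d) → (E n →L[ℝ] E d)) := by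
  have h : ∀ i, Continuous fun X : Fin n → E d =>
      (rankOne ℝ (X i) (EuclideanSpace.single i (1 : ℝ) : E n) : E n →L[ℝ] E d) :=
    fun i => ((rankOne ℝ).continuous.comp (continuous_apply i)).clm_apply continuous_const
  exact (continuous_finsetSum Finset.univ fun i _ => h i).const_smul (1 / (n : ℝ))

lemma noiseMap_adjoint_apply (X : Fin n → E d) (u : E d) :
    adjoint (noiseMap X) u
      = (1 / (n : ℝ)) • ∑ i, (inner ℝ (X i) u : ℝ) • EuclideanSpace.single i (1 : ℝ) := by
  simp [noiseMap]

lemma noiseMap_comp_adjoint (X : Fin n → E d) (u : E d) :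
    noiseMap X (adjoint (noiseMap X) u) = (1 / (n : ℝ)) • sampleCov X u := by
  have h : ∀ i, noiseMap X (EuclideanSpace.single i (1 : ℝ)) = (1 / (n : ℝ)) • X i := by
    intro i
    simp [noiseMap_apply]
  rw [noiseMap_adjoint_apply, sampleCov_apply, map_smul, map_sum]
  simp_rw [map_smul, h, Finset.smul_sum]
  refine Finset.sum_congr rfl fun i _ => ?_
  module

/-- The linear map carrying the noise to its contribution to the ridge estimator. -/
noncomputable def ridgeNoise (t : ℝ) (X : Fin n → E d) : E n →L[ℝ] E d :=
  resolvent t X ∘L noiseMap X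

lemma norm_ridgeNoise_adjoint_sq (ht : 0 < t) (X : Fin n → E d) (u : E d) :
    ‖adjoint (ridgeNoise t X) u‖ ^ 2 ≤ ‖u‖ ^ 2 / (t * n) := by
  have h1 : ridgeNoise t X (adjoint (ridgeNoise t X) u)
      = (1 / (n : ℝ)) • resolvent t X (sampleCov X (resolvent t X u)) := by
    have hsa : adjoint (resolvent t X) = resolvent t X :=
      (isSelfAdjoint_iff_isSymmetric.2 (isSymmetric_resolvent ht X))
    rw [ridgeNoise, adjoint_comp, hsa]
    simp [noiseMap_comp_adjoint]
  rw [← real_inner_self_eq_norm_sq, adjoint_inner_left, h1, real_inner_smul_right,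
    inner_resolvent_comm ht]
  have h2 := inner_resolvent_sampleCov_le ht X u
  calc _ ≤ 1 / (n : ℝ) * (‖u‖ ^ 2 / t) := by gcongr
    _ = _ := by field_simp

lemma norm_ridgeNoise_sq_le (ht : 0 < t) (X : Fin n → E d) :
    ‖ridgeNoise t X‖ ^ 2 ≤ 1 / (t * n) := by
  have h : ‖adjoint (ridgeNoise t X)‖ ≤ √(1 / (t * n)) := by
    refine ContinuousLinearMap.opNorm_le_bound _ (Real.sqrt_nonneg _) fun u => ?_
    rw [← Real.sqrt_sq (norm_nonneg u), ← Real.sqrt_mul (by positivity)]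
    refine Real.le_sqrt_of_sq_le ((norm_ridgeNoise_adjoint_sq ht X u).trans (le_of_eq ?_))
    ring
  rw [LinearIsometryEquiv.norm_map] at h
  calc ‖ridgeNoise t X‖ ^ 2 ≤ √(1 / (t * n)) ^ 2 := pow_le_pow_left₀ (norm_nonneg _) h 2
    _ = _ := Real.sq_sqrt (by positivity)

lemma trace_ridgeNoise (ht : 0 < t) (X : Fin n → E d) :
    LinearMap.trace ℝ (E n) (adjoint (ridgeNoise t X) ∘L ridgeNoise t X)
      = (1 / (n : ℝ)) * (tr (resolvent t X) - t * tr (resolvent t X * resolvent t X)) := by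
  have hsa : adjoint (resolvent t X) = resolvent t X :=
    (isSelfAdjoint_iff_isSymmetric.2 (isSymmetric_resolvent ht X))
  have h : ridgeNoise t X ∘L adjoint (ridgeNoise t X)
      = (1 / (n : ℝ)) • (resolvent t X - t • (resolvent t X * resolvent t X)) := by
    ext1 u
    rw [ridgeNoise, adjoint_comp, hsa]
    simp [noiseMap_comp_adjoint, sampleCov_resolvent_apply ht]
  rw [toLinearMap_comp, LinearMap.trace_comp_comm', ← toLinearMap_comp, h]
  change tr _ = _
  rw [tr_smul, tr_sub, tr_smul]

/-- For fixed features, the squared norm of the noise contribution is a Gaussian quadratic form and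
concentrates around its trace. -/
lemma lintegral_norm_ridgeNoise_sub_sq_le (ht : 0 < t) (hn : 0 < n) (X : Fin n → E d) :
    ∫⁻ z, ENNReal.ofReal ((‖ridgeNoise t X z‖ ^ 2 - (1 / (n : ℝ)) *
        (tr (resolvent t X) - t * tr (resolvent t X * resolvent t X))) ^ 2) ∂(stdGaussian (E n))
      ≤ ENNReal.ofReal (gaussKurt / (t ^ 2 * n)) := by
  have hn' : (0 : ℝ) < n := by exact_mod_cast hn
  have hsymm : ((adjoint (ridgeNoise t X) ∘L ridgeNoise t X : E n →L[ℝ] E n) :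
      E n →ₗ[ℝ] E n).IsSymmetric := by
    intro u v
    simp [adjoint_inner_left, adjoint_inner_right]
  have h := lintegral_quadForm_sub_trace_sq_le _ hsymm
  rw [trace_ridgeNoise ht, finrank_euclideanSpace_fin] at h
  have hz : ∀ z, inner ℝ z ((adjoint (ridgeNoise t X) ∘L ridgeNoise t X) z)
      = ‖ridgeNoise t X z‖ ^ 2 := by
    intro z
    rw [comp_apply, adjoint_inner_right, real_inner_self_eq_norm_sq]
  simp_rw [hz] at h
  refine h.trans (ENNReal.ofReal_le_ofReal ?_)
  have hK := gaussKurt_nonneg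
  have hB : ‖adjoint (ridgeNoise t X) ∘L ridgeNoise t X‖ ≤ 1 / (t * n) := by
    refine (opNorm_comp_le _ _).trans ?_
    rw [LinearIsometryEquiv.norm_map, ← sq]
    exact norm_ridgeNoise_sq_le ht X
  calc gaussKurt * n * ‖adjoint (ridgeNoise t X) ∘L ridgeNoise t X‖ ^ 2
      ≤ gaussKurt * n * (1 / (t * n)) ^ 2 := by gcongr
    _ = _ := by field_simp

lemma lintegral_inner_ridgeNoise_sq_le (ht : 0 < t) (X : Fin n → E d) (v : E d) :
    ∫⁻ z, ENNReal.ofReal (inner ℝ v (ridgeNoise t X z) ^ 2) ∂(stdGaussian (E n))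
      ≤ ENNReal.ofReal (‖v‖ ^ 2 / (t * n)) := by
  have h := lintegral_inner_sq (adjoint (ridgeNoise t X) v)
  have hz : ∀ z, inner ℝ z (adjoint (ridgeNoise t X) v) = inner ℝ v (ridgeNoise t X z) := by
    intro z
    rw [adjoint_inner_right, real_inner_comm]
  simp_rw [hz] at h
  rw [h]
  exact ENNReal.ofReal_le_ofReal (norm_ridgeNoise_adjoint_sq ht X v)

end Noise

/-! ### Nets of the unit ball -/

/-- The unit ball has a `1/2`-net of at most `5 ^ d` points. -/
lemma exists_half_net (d : ℕ) : ∃ N : Finset (E d), N.card ≤ 5 ^ d ∧ (∀ v ∈ N, ‖v‖ ≤ 1) ∧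
    ∀ u : E d, ‖u‖ ≤ 1 → ∃ v ∈ N, ‖u - v‖ ≤ 1 / 2 := by
  classical
  -- a `1`-separated set of maximal cardinality in the ball of radius `2`, rescaled
  let P : Finset (E d) → Prop := fun s =>
    (∀ c ∈ s, ‖c‖ ≤ 2) ∧ ∀ c ∈ s, ∀ c' ∈ s, c ≠ c' → 1 ≤ ‖c - c'‖
  have hbound : ∀ s, P s → s.card ≤ 5 ^ d := fun s hs => by
    simpa using Besicovitch.card_le_of_separated s hs.1 hs.2
  have hex : ∃ k, ∃ s, P s ∧ s.card = k := ⟨0, ∅, by simp [P], rfl⟩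
  have hbdd : BddAbove {k | ∃ s, P s ∧ s.card = k} :=
    ⟨5 ^ d, by rintro _ ⟨s, hs, rfl⟩; exact hbound s hs⟩
  obtain ⟨s, hs, hcard⟩ := Nat.sSup_mem hex hbdd
  have hcover : ∀ u : E d, ‖u‖ ≤ 2 → ∃ v ∈ s, ‖u - v‖ ≤ 1 := by
    intro u hu
    by_contra! hcon
    have hus : u ∉ s := fun h => by simpa using (hcon u h).trans_le' zero_le_one
    have hins : P (insert u s) := by
      refine ⟨?_, ?_⟩
      · intro c hc
        rcases Finset.mem_insert.1 hc with rfl | hc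
        exacts [hu, hs.1 c hc]
      · intro c hc c' hc' hne
        rcases Finset.mem_insert.1 hc with h1 | h1 <;>
          rcases Finset.mem_insert.1 hc' with h2 | h2
        · exact absurd (h1.trans h2.symm) hne
        · rw [h1]; exact (hcon c' h2).le
        · rw [h2, norm_sub_rev]; exact (hcon c h1).le
        · exact hs.2 c h1 c' h2 hne
    have h : (insert u s).card ≤ s.card := (le_csSup hbdd ⟨_, hins, rfl⟩).trans hcard.ge
    rw [Finset.card_insert_of_notMem hus] at h
    omega
  refine ⟨s.image fun v => (1 / 2 : ℝ) • v, Finset.card_image_le.trans (hbound s hs), ?_, ?_⟩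
  · intro v hv
    obtain ⟨c, hc, rfl⟩ := Finset.mem_image.1 hv
    have := hs.1 c hc
    rw [norm_smul]
    norm_num
    linarith
  · intro u hu
    obtain ⟨v, hv, h⟩ := hcover ((2 : ℝ) • u) (by rw [norm_smul]; norm_num; linarith)
    refine ⟨_, Finset.mem_image_of_mem _ hv, ?_⟩
    have : u - (1 / 2 : ℝ) • v = (1 / 2 : ℝ) • ((2 : ℝ) • u - v) := by module
    rw [this, norm_smul]
    norm_num
    linarith

/-- Iterating the `1/2`-net gives a `2⁻ᵏ`-net of at most `5 ^ (d k)` points. -/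
lemma exists_fine_net (d k : ℕ) : ∃ N : Finset (E d), N.card ≤ 5 ^ (d * k) ∧
    ∀ u : E d, ‖u‖ ≤ 1 → ∃ v ∈ N, ‖u - v‖ ≤ (1 / 2) ^ k := by
  classical
  obtain ⟨N₁, hcard₁, -, hN₁⟩ := exists_half_net d
  induction k with
  | zero => exact ⟨{0}, by simp, fun u hu => ⟨0, by simp, by simpa using hu⟩⟩
  | succ k ih =>
    obtain ⟨N, hcard, hN⟩ := ih
    refine ⟨(N ×ˢ N₁).image fun p => p.1 + ((1 / 2 : ℝ) ^ k) • p.2, ?_, ?_⟩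
    · refine Finset.card_image_le.trans ?_
      rw [Finset.card_product, mul_add, pow_add, mul_one]
      exact Nat.mul_le_mul hcard hcard₁
    · intro u hu
      obtain ⟨v, hv, h1⟩ := hN u hu
      have h2 : ‖((2 : ℝ) ^ k) • (u - v)‖ ≤ 1 := by
        rw [norm_smul, Real.norm_of_nonneg (by positivity)]
        calc (2 : ℝ) ^ k * ‖u - v‖ ≤ 2 ^ k * (1 / 2) ^ k := by gcongr
          _ = 1 := by rw [← mul_pow]; norm_num
      obtain ⟨w, hw, h3⟩ := hN₁ _ h2
      refine ⟨_, Finset.mem_image_of_mem _ (Finset.mk_mem_product hv hw), ?_⟩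
      have h4 : u - (v + ((1 / 2 : ℝ) ^ k) • w)
          = ((1 / 2 : ℝ) ^ k) • (((2 : ℝ) ^ k) • (u - v) - w) := by
        have h5 : ((1 / 2 : ℝ) ^ k) * (2 : ℝ) ^ k = 1 := by rw [← mul_pow]; norm_num
        rw [smul_sub, smul_smul, h5]
        module
      simp only
      rw [h4, norm_smul, Real.norm_of_nonneg (by positivity), pow_succ]
      gcongr

/-! ### The smallest eigenvalue of the sample covariance -/

/-- The exponential Markov inequality for i.i.d. sums. -/
lemma measure_sum_ge_le {α : Type*} [MeasurableSpace α] (μ : Measure α) [IsProbabilityMeasure μ]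
    (n : ℕ) {φ : α → ℝ} (hφ : Integrable (fun x => Real.exp (φ x)) μ) {θ s : ℝ}
    (hθ : ∫ x, Real.exp (φ x) ∂μ ≤ θ) :
    (Measure.pi fun _ : Fin n => μ).real {X | n * s ≤ ∑ i, φ (X i)}
      ≤ (θ * Real.exp (-s)) ^ n := by
  have hint : Integrable (fun X : Fin n → α => ∏ i, Real.exp (φ (X i)))
      (Measure.pi fun _ => μ) := Integrable.fintype_prod fun _ => hφ
  have h := mul_meas_ge_le_integral_of_nonneg
    (ae_of_all _ fun X => Finset.prod_nonneg fun i _ => (Real.exp_pos _).le) hint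
    (Real.exp (n * s))
  rw [integral_fintype_prod_eq_pow (μ := μ) (f := fun x => Real.exp (φ x)), Fintype.card_fin] at h
  have hset : {X : Fin n → α | Real.exp (n * s) ≤ ∏ i, Real.exp (φ (X i))}
      = {X | n * s ≤ ∑ i, φ (X i)} := by
    ext X
    simp only [Set.mem_ofPred_eq, ← Real.exp_sum, Real.exp_le_exp]
  rw [hset] at h
  have h0 : 0 ≤ ∫ x, Real.exp (φ x) ∂μ := integral_nonneg fun _ => (Real.exp_pos _).le
  have h1 : (∫ x, Real.exp (φ x) ∂μ) ^ n ≤ θ ^ n := pow_le_pow_left₀ h0 hθ n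
  rw [mul_pow, ← Real.exp_nat_mul, mul_neg, Real.exp_neg, ← div_eq_mul_inv,
    le_div_iff₀ (Real.exp_pos _)]
  calc _ = _ := mul_comm _ _
    _ ≤ _ := h
    _ ≤ _ := h1

lemma integral_comp_inner_stdGaussian {d : ℕ} (v : E d) {f : ℝ → ℝ} (hf : Continuous f) :
    ∫ x, f (inner ℝ x v) ∂(stdGaussian (E d)) = ∫ g, f (‖v‖ * g) ∂(gaussianReal 0 1) := by
  have h1 := integral_map (μ := stdGaussian (E d)) (φ := fun x => inner ℝ x v) (f := f)
    (by fun_prop) hf.aestronglyMeasurable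
  have h2 := integral_map (μ := gaussianReal 0 1) (φ := fun g => ‖v‖ * g) (f := f)
    (by fun_prop) hf.aestronglyMeasurable
  rw [← h1, ← h2, map_inner_stdGaussian, gaussianReal_map_const_mul]
  congr 2
  · simp
  · ext; simp

/-- The two tail bounds for `∑ ⟪xᵢ, v⟫²`, with a common exponential rate. -/
lemma exists_tail_bounds : ∃ a b ρ : ℝ, 0 < a ∧ 0 < b ∧ 0 < ρ ∧ ρ < 1 ∧ ∀ (n d : ℕ) (v : E d),
    (1 / 2 ≤ ‖v‖ → (featLaw n d).real {X | ∑ i, inner ℝ (X i) v ^ 2 ≤ n * a} ≤ ρ ^ n) ∧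
    (‖v‖ ≤ 1 → (featLaw n d).real {X | n * b ≤ ∑ i, inner ℝ (X i) v ^ 2} ≤ ρ ^ n) := by
  obtain ⟨c, hc, hcint⟩ := IsGaussian.exists_integrable_exp_sq (gaussianReal 0 1)
  simp only [Real.norm_eq_abs, sq_abs] at hcint
  set ψ := ∫ g, Real.exp (c * g ^ 2) ∂(gaussianReal 0 1) with hψ
  have hψ1 : 1 ≤ ψ := by
    have : ∫ _g : ℝ, (1 : ℝ) ∂(gaussianReal 0 1) ≤ ψ :=
      integral_mono (integrable_const _) hcint fun g =>
        Real.one_le_exp (by positivity)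
    simpa using this
  have hbd : ∀ (l : ℝ), l ≤ 0 → ∀ μ : Measure ℝ, ∀ [IsProbabilityMeasure μ],
      Integrable (fun g : ℝ => Real.exp (l * g ^ 2)) μ := fun l hl μ _ =>
    Integrable.of_bound (C := 1) (by fun_prop) (ae_of_all _ fun g => by
      rw [Real.norm_of_nonneg (Real.exp_pos _).le]
      exact Real.exp_le_one_iff.2 (mul_nonpos_of_nonpos_of_nonneg hl (sq_nonneg g)))
  set θ := ∫ g, Real.exp (-1 * g ^ 2) ∂(gaussianReal 0 1) with hθ
  have hθ0 : 0 < θ := integral_exp_pos (hbd (-1) (by norm_num) _)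
  have hθ1 : θ < 1 := by
    have h1 : 0 < ∫ g, (1 - Real.exp (-1 * g ^ 2)) ∂(gaussianReal 0 1) := by
      rw [integral_pos_iff_support_of_nonneg]
      · have : Function.support (fun g : ℝ => 1 - Real.exp (-1 * g ^ 2)) = {0}ᶜ := by
          ext g
          simp only [Function.mem_support, Set.mem_compl_iff, Set.mem_singleton_iff, ne_eq,
            not_iff_not, sub_eq_zero, eq_comm (a := (1 : ℝ)), Real.exp_eq_one_iff]
          simp
        rw [this]
        have := nullSingletonClass_gaussianReal (μ := 0) (v := 1) one_ne_zero
        rw [prob_compl_eq_one_sub (measurableSet_singleton _), measure_singleton]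
        simp
      · intro g
        simp only [Pi.zero_apply, sub_nonneg]
        exact Real.exp_le_one_iff.2 (by nlinarith [sq_nonneg g])
      · exact (integrable_const _).sub (hbd (-1) (by norm_num) _)
    rw [integral_sub (integrable_const _) (hbd (-1) (by norm_num) _)] at h1
    simp only [integral_const, probReal_univ, smul_eq_mul, mul_one] at h1
    linarith
  have hlog : Real.log θ < 0 := Real.log_neg hθ0 hθ1
  have hlogψ : 0 ≤ Real.log ψ := Real.log_nonneg hψ1
  -- the thresholds leave a factor `√θ`, resp. `exp (-1)`, per sample in the Chernoff bounds
  -- with exponents `-4` and `c`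
  refine ⟨-Real.log θ / 8, (Real.log ψ + 1) / c, max (Real.exp (Real.log θ / 2)) (Real.exp (-1)),
    by linarith, by positivity, by positivity, ?_, ?_⟩
  · rw [← Real.exp_zero]
    exact max_lt (Real.exp_lt_exp.2 (by linarith)) (Real.exp_lt_exp.2 (by norm_num))
  intro n d v
  constructor
  · intro hv
    have hi : Integrable (fun x : E d => Real.exp (-4 * inner ℝ x v ^ 2)) (stdGaussian (E d)) :=
      Integrable.of_bound (C := 1) (by fun_prop) (ae_of_all _ fun x => by
        rw [Real.norm_of_nonneg (Real.exp_pos _).le]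
        exact Real.exp_le_one_iff.2 (by nlinarith [sq_nonneg (inner ℝ x v : ℝ)]))
    have hle : ∫ x, Real.exp (-4 * inner ℝ x v ^ 2) ∂(stdGaussian (E d)) ≤ θ := by
      rw [integral_comp_inner_stdGaussian v (f := fun y => Real.exp (-4 * y ^ 2)) (by fun_prop)]
      have : ∀ g : ℝ, -4 * (‖v‖ * g) ^ 2 = (-4 * ‖v‖ ^ 2) * g ^ 2 := fun g => by ring
      simp_rw [this]
      refine integral_mono (hbd _ (by nlinarith) _) (hbd (-1) (by norm_num) _) fun g => ?_
      refine Real.exp_le_exp.2 (mul_le_mul_of_nonneg_right ?_ (sq_nonneg g))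
      nlinarith
    have h := measure_sum_ge_le (stdGaussian (E d)) n hi (s := Real.log θ / 2) hle
    have hset : {X : Fin n → E d | ∑ i, inner ℝ (X i) v ^ 2 ≤ n * (-Real.log θ / 8)}
        = {X | n * (Real.log θ / 2) ≤ ∑ i, -4 * (inner ℝ (X i) v : ℝ) ^ 2} := by
      ext X
      simp only [Set.mem_ofPred_eq, ← Finset.mul_sum]
      constructor <;> intro h <;> linarith
    rw [hset]
    refine h.trans (pow_le_pow_left₀ (by positivity) (le_trans (le_of_eq ?_) (le_max_left _ _)) n)
    conv_lhs => rw [← Real.exp_log hθ0]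
    rw [← Real.exp_add, Real.log_exp]
    ring_nf
  · intro hv
    have hpt : ∀ g : ℝ, Real.exp (c * (‖v‖ * g) ^ 2) ≤ Real.exp (c * g ^ 2) := fun g => by
      refine Real.exp_le_exp.2 (mul_le_mul_of_nonneg_left ?_ hc.le)
      rw [mul_pow]
      exact mul_le_of_le_one_left (sq_nonneg g) (pow_le_one₀ (norm_nonneg _) hv)
    have hiv : Integrable (fun g : ℝ => Real.exp (c * (‖v‖ * g) ^ 2)) (gaussianReal 0 1) :=
      hcint.mono' (by fun_prop) (ae_of_all _ fun g => by
        rw [Real.norm_of_nonneg (Real.exp_pos _).le]; exact hpt g)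
    have hi : Integrable (fun x : E d => Real.exp (c * inner ℝ x v ^ 2)) (stdGaussian (E d)) := by
      have hm : (stdGaussian (E d)).map (fun x => inner ℝ x v)
          = (gaussianReal 0 1).map (fun g => ‖v‖ * g) := by
        rw [map_inner_stdGaussian, gaussianReal_map_const_mul]
        congr 1
        · simp
        · ext; simp
      have h1 : Integrable (fun y : ℝ => Real.exp (c * y ^ 2))
          ((stdGaussian (E d)).map (fun x => inner ℝ x v)) := by
        rw [hm, integrable_map_measure (by fun_prop) (by fun_prop)]
        exact hiv
      exact (integrable_map_measure (f := fun x : E d => (inner ℝ x v : ℝ))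
        (g := fun y : ℝ => Real.exp (c * y ^ 2)) (by fun_prop) (by fun_prop)).1 h1
    have hle : ∫ x, Real.exp (c * inner ℝ x v ^ 2) ∂(stdGaussian (E d)) ≤ ψ := by
      rw [integral_comp_inner_stdGaussian v (f := fun y => Real.exp (c * y ^ 2)) (by fun_prop)]
      exact integral_mono hiv hcint hpt
    have h := measure_sum_ge_le (stdGaussian (E d)) n hi (s := Real.log ψ + 1) hle
    have hset : {X : Fin n → E d | n * ((Real.log ψ + 1) / c) ≤ ∑ i, inner ℝ (X i) v ^ 2}
        = {X | n * (Real.log ψ + 1) ≤ ∑ i, c * (inner ℝ (X i) v : ℝ) ^ 2} := by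
      ext X
      simp only [Set.mem_ofPred_eq, ← Finset.mul_sum]
      rw [← mul_div_assoc, div_le_iff₀' hc]
    rw [hset]
    have hψ0 : 0 < ψ := by linarith
    refine h.trans (pow_le_pow_left₀ (by positivity) (le_trans (le_of_eq ?_) (le_max_right _ _)) n)
    conv_lhs => rw [← Real.exp_log hψ0]
    rw [← Real.exp_add, Real.log_exp]
    ring_nf

open ContinuousLinearMap in
/-- The event that the smallest eigenvalue of the sample covariance is below an absolute constant
is covered by finitely many tail events, one for each point of two nets. -/
lemma exists_smallest_eigenvalue_bound : ∃ c ρ : ℝ, ∃ k : ℕ, 0 < c ∧ 0 < ρ ∧ ρ < 1 ∧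
    ∀ n d : ℕ, 0 < n →
      (featLaw n d) {X | ¬ ∀ u : E d, c * ‖u‖ ^ 2 ≤ inner ℝ u (sampleCov X u)}
        ≤ ENNReal.ofReal (2 * ((5 ^ (d * k) : ℕ) * ρ ^ n)) := by
  obtain ⟨a, b, ρ, ha, hb, hρ0, hρ1, htail⟩ := exists_tail_bounds
  obtain ⟨k₀, hk₀⟩ := exists_pow_lt_of_lt_one
    (by positivity : 0 < √a / (4 * √b)) (by norm_num : (1 / 2 : ℝ) < 1)
  set k := k₀ + 1 with hk
  have hk1 : (1 / 2 : ℝ) ^ k ≤ 1 / 2 := by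
    rw [hk, pow_succ]
    exact mul_le_of_le_one_left (by norm_num) (pow_le_one₀ (by norm_num) (by norm_num))
  have hk2 : (1 / 2 : ℝ) ^ k * (4 * √b) ≤ √a := by
    rw [← le_div_iff₀ (by positivity)]
    refine le_trans ?_ hk₀.le
    exact pow_le_pow_of_le_one (by norm_num) (by norm_num) (by omega)
  refine ⟨a / 4, ρ, k, by positivity, hρ0, hρ1, fun n d hn => ?_⟩
  have hn' : (0 : ℝ) < n := by exact_mod_cast hn
  obtain ⟨N₁, hcard₁, hball₁, hN₁⟩ := exists_half_net d
  obtain ⟨N, hcard, hN⟩ := exists_fine_net d k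
  classical
  set N' := N.filter fun v => 1 / 2 ≤ ‖v‖
  set B₁ : E d → Set (Fin n → E d) := fun v => {X | n * b ≤ ∑ i, inner ℝ (X i) v ^ 2}
  set B₂ : E d → Set (Fin n → E d) := fun v => {X | ∑ i, inner ℝ (X i) v ^ 2 ≤ n * a}
  have hsub : {X : Fin n → E d | ¬ ∀ u : E d, a / 4 * ‖u‖ ^ 2 ≤ inner ℝ u (sampleCov X u)}
      ⊆ (⋃ v ∈ N₁, B₁ v) ∪ ⋃ v ∈ N', B₂ v := by
    intro X hX
    by_contra hcon
    simp only [Set.mem_union, Set.mem_iUnion, not_or, not_exists] at hcon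
    obtain ⟨hc1, hc2⟩ := hcon
    refine hX ?_
    -- `A` is a multiple of the design operator, normalized so that `n ‖A u‖² = ⟪u, S u⟫`
    set A := adjoint (noiseMap X) with hA
    have hAu : ∀ u, n * ‖A u‖ ^ 2 = inner ℝ u (sampleCov X u) := by
      intro u
      rw [← real_inner_self_eq_norm_sq, hA, adjoint_inner_left, noiseMap_comp_adjoint,
        real_inner_smul_right]
      field_simp
    have hAs : ∀ u, (n * ‖A u‖) ^ 2 = ∑ i, inner ℝ (X i) u ^ 2 := by
      intro u
      have h1 : (n * ‖A u‖) ^ 2 = n * (n * ‖A u‖ ^ 2) := by ring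
      rw [h1, hAu, inner_sampleCov]
      field_simp
    have hup : ∀ v ∈ N₁, n * ‖A v‖ ≤ √(n * b) := by
      intro v hv
      refine Real.le_sqrt_of_sq_le ?_
      rw [hAs]
      exact (not_le.1 (hc1 v hv)).le
    have hlow : ∀ v ∈ N', √(n * a) ≤ n * ‖A v‖ := by
      intro v hv
      refine Real.sqrt_le_iff.2 ⟨by positivity, ?_⟩
      rw [hAs]
      exact (not_le.1 (hc2 v hv)).le
    -- the coarse net bounds the norm of `A`, since an error of `‖A‖ / 2` can be absorbed
    have hAn : n * ‖A‖ ≤ 2 * √(n * b) := by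
      have h1 : ‖A‖ ≤ √(n * b) / n + ‖A‖ / 2 := by
        refine opNorm_le_of_unit_norm (𝕜 := ℝ) (by positivity) fun u hu => ?_
        obtain ⟨v, hv, hd⟩ := hN₁ u hu.le
        have h2 : A u = A v + A (u - v) := by rw [← map_add]; simp
        rw [h2]
        refine (norm_add_le _ _).trans (add_le_add ?_ ?_)
        · rw [le_div_iff₀ hn', mul_comm]
          exact hup v hv
        · calc ‖A (u - v)‖ ≤ ‖A‖ * ‖u - v‖ := A.le_opNorm _
            _ ≤ ‖A‖ * (1 / 2) := by gcongr
            _ = _ := by ring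
      have h3 : n * (‖A‖ / 2) ≤ √(n * b) := by
        rw [← le_div_iff₀' hn']
        linarith
      linarith
    -- on the fine net `A` is bounded below, and `k` is so large that the error costs only half
    have hunit : ∀ u : E d, ‖u‖ = 1 → a / 4 ≤ inner ℝ u (sampleCov X u) := by
      intro u hu
      obtain ⟨v, hv, hd⟩ := hN u hu.le
      have hv' : v ∈ N' := by
        refine Finset.mem_filter.2 ⟨hv, ?_⟩
        have := norm_sub_norm_le u v
        linarith
      have h1 : ‖A v‖ ≤ ‖A u‖ + ‖A‖ * (1 / 2) ^ k := by
        have h2 : A v = A u - A (u - v) := by rw [← map_sub]; simp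
        rw [h2]
        refine (norm_sub_le _ _).trans (add_le_add le_rfl ((A.le_opNorm _).trans ?_))
        gcongr
      have h4 : √(n * a) ≤ n * ‖A u‖ + (n * ‖A‖) * (1 / 2) ^ k :=
        (hlow v hv').trans ((mul_le_mul_of_nonneg_left h1 hn'.le).trans (le_of_eq (by ring)))
      have h5 : (n * ‖A‖) * (1 / 2) ^ k ≤ √(n * a) / 2 := by
        rw [Real.sqrt_mul hn'.le]
        rw [Real.sqrt_mul hn'.le] at hAn
        calc (n * ‖A‖) * (1 / 2) ^ k ≤ (2 * (√n * √b)) * (1 / 2) ^ k := by gcongr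
          _ = √n * ((1 / 2) ^ k * (4 * √b)) / 2 := by ring
          _ ≤ √n * √a / 2 := by gcongr
      have h6 : √(n * a) / 2 ≤ n * ‖A u‖ := by linarith
      have h7 : (√(n * a) / 2) ^ 2 ≤ (n * ‖A u‖) ^ 2 := pow_le_pow_left₀ (by positivity) h6 2
      rw [div_pow, Real.sq_sqrt (by positivity)] at h7
      rw [← hAu]
      refine le_of_mul_le_mul_left ?_ hn'
      nlinarith
    intro u
    rcases eq_or_ne u 0 with rfl | hu0
    · simp
    · have hu' : ‖u‖ ≠ 0 := norm_ne_zero_iff.2 hu0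
      have h := hunit (‖u‖⁻¹ • u) (by rw [norm_smul, norm_inv, norm_norm, inv_mul_cancel₀ hu'])
      rw [map_smul, real_inner_smul_left, real_inner_smul_right] at h
      have h8 : inner ℝ u (sampleCov X u)
          = ‖u‖ ^ 2 * (‖u‖⁻¹ * (‖u‖⁻¹ * inner ℝ u (sampleCov X u))) := by field_simp
      rw [h8, mul_comm]
      gcongr
  have hcard' : (N'.card : ℝ) ≤ (5 ^ (d * k) : ℕ) := by
    exact_mod_cast (Finset.card_filter_le _ _).trans hcard
  have hcard₁' : (N₁.card : ℝ) ≤ (5 ^ (d * k) : ℕ) := by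
    have : 5 ^ d ≤ 5 ^ (d * k) := Nat.pow_le_pow_right (by norm_num) (by rw [hk]; nlinarith)
    exact_mod_cast hcard₁.trans this
  have hreal : (featLaw n d).real ((⋃ v ∈ N₁, B₁ v) ∪ ⋃ v ∈ N', B₂ v)
      ≤ 2 * ((5 ^ (d * k) : ℕ) * ρ ^ n) := by
    calc _ ≤ (featLaw n d).real (⋃ v ∈ N₁, B₁ v) + (featLaw n d).real (⋃ v ∈ N', B₂ v) :=
          measureReal_union_le _ _
      _ ≤ ∑ v ∈ N₁, (featLaw n d).real (B₁ v) + ∑ v ∈ N', (featLaw n d).real (B₂ v) :=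
          add_le_add (measureReal_biUnion_finset_le _ _) (measureReal_biUnion_finset_le _ _)
      _ ≤ ∑ _v ∈ N₁, ρ ^ n + ∑ _v ∈ N', ρ ^ n :=
          add_le_add (Finset.sum_le_sum fun v hv => (htail n d v).2 (hball₁ v hv))
            (Finset.sum_le_sum fun v hv => (htail n d v).1 (Finset.mem_filter.1 hv).2)
      _ = N₁.card * ρ ^ n + N'.card * ρ ^ n := by simp
      _ ≤ (5 ^ (d * k) : ℕ) * ρ ^ n + (5 ^ (d * k) : ℕ) * ρ ^ n := by gcongr
      _ = _ := by ring
  calc _ ≤ (featLaw n d) ((⋃ v ∈ N₁, B₁ v) ∪ ⋃ v ∈ N', B₂ v) := measure_mono hsub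
    _ = ENNReal.ofReal ((featLaw n d).real ((⋃ v ∈ N₁, B₁ v) ∪ ⋃ v ∈ N', B₂ v)) :=
        (ofReal_measureReal (measure_ne_top _ _)).symm
    _ ≤ _ := ENNReal.ofReal_le_ofReal hreal

/-- For a small aspect ratio the sample covariance is bounded below with high probability. -/
theorem exists_tendsto_smallest_eigenvalue : ∃ c γ₀ : ℝ, 0 < c ∧ 0 < γ₀ ∧
    ∀ (γ : ℝ) (n d : ℕ → ℕ), γ < γ₀ → Tendsto n atTop atTop →
      Tendsto (fun k => (d k : ℝ) / n k) atTop (𝓝 γ) →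
      Tendsto (fun k => (featLaw (n k) (d k))
        {X | ¬ ∀ u : E (d k), c * ‖u‖ ^ 2 ≤ inner ℝ u (sampleCov X u)}) atTop (𝓝 0) := by
  obtain ⟨c, ρ, K, hc, hρ0, hρ1, hbound⟩ := exists_smallest_eigenvalue_bound
  have hlogρ : Real.log ρ < 0 := Real.log_neg hρ0 hρ1
  have hlog5 : 0 < Real.log 5 := Real.log_pos (by norm_num)
  refine ⟨c, -Real.log ρ / ((K + 1) * Real.log 5), hc, div_pos (by linarith) (by positivity), ?_⟩
  intro γ n d hγ hn hdn
  rw [lt_div_iff₀ (by positivity)] at hγ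
  have hnR : Tendsto (fun k => (n k : ℝ)) atTop atTop := tendsto_natCast_atTop_atTop.comp hn
  have hexp : Tendsto (fun k => (d k : ℝ) / n k * ((K + 1) * Real.log 5) + Real.log ρ) atTop
      (𝓝 (γ * ((K + 1) * Real.log 5) + Real.log ρ)) := (hdn.mul_const _).add_const _
  have hbot : Tendsto (fun k => (n k : ℝ) *
      ((d k : ℝ) / n k * ((K + 1) * Real.log 5) + Real.log ρ)) atTop atBot :=
    hnR.atTop_mul_neg (by linarith) hexp
  have h0 := ((Real.tendsto_exp_atBot.comp hbot).const_mul 2)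
  rw [mul_zero] at h0
  have h1 := ENNReal.tendsto_ofReal h0
  rw [ENNReal.ofReal_zero] at h1
  refine tendsto_of_tendsto_of_tendsto_of_le_of_le' tendsto_const_nhds h1
    (Eventually.of_forall fun _ => zero_le) ?_
  filter_upwards [hn.eventually_gt_atTop 0] with k hk
  have hk' : (0 : ℝ) < n k := by exact_mod_cast hk
  refine (hbound (n k) (d k) hk).trans (ENNReal.ofReal_le_ofReal ?_)
  refine mul_le_mul_of_nonneg_left ?_ (by norm_num)
  have h5 : ((5 ^ (d k * K) : ℕ) : ℝ) = Real.exp (d k * K * Real.log 5) := by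
    have := Real.exp_nat_mul (Real.log 5) (d k * K)
    rw [Real.exp_log (by norm_num)] at this
    push_cast at this ⊢
    exact this.symm
  have hρ : ρ ^ n k = Real.exp (n k * Real.log ρ) := by
    rw [Real.exp_nat_mul, Real.exp_log hρ0]
  rw [h5, hρ, ← Real.exp_add, Function.comp_apply]
  refine Real.exp_le_exp.2 ?_
  have h6 : (n k : ℝ) * ((d k : ℝ) / n k * ((K + 1) * Real.log 5) + Real.log ρ)
      = d k * ((K + 1) * Real.log 5) + n k * Real.log ρ := by field_simp
  rw [h6]
  have : 0 ≤ (d k : ℝ) * Real.log 5 := by positivity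
  nlinarith

/-! ### The ridge objective -/

section Ridge

open ContinuousLinearMap

variable {n d : ℕ}

lemma ridgeObj_le_empAdvRisk (hn : 0 < n) (D : Data n d) {s : ℝ} (hs : 0 ≤ s) (w : E d) :
    ridgeObj D s w ≤ empAdvRisk D s w ∧ empAdvRisk D s w ≤ 2 * ridgeObj D s w := by
  have hn' : (0 : ℝ) < n := by exact_mod_cast hn
  have hobj : ridgeObj D s w
      = (1 / (n : ℝ)) * ∑ i, ((inner ℝ (D i).1 w - (D i).2) ^ 2 + s ^ 2 * ‖w‖ ^ 2) := by
    rw [ridgeObj, Finset.sum_add_distrib, mul_add]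
    simp only [Finset.sum_const, Finset.card_univ, Fintype.card_fin, nsmul_eq_mul]
    field_simp
  rw [hobj, empAdvRisk]
  simp only [advLoss_eq hs]
  have hsw : 0 ≤ s * ‖w‖ := by positivity
  constructor
  · refine mul_le_mul_of_nonneg_left (Finset.sum_le_sum fun i _ => ?_) (by positivity)
    rw [← sq_abs (inner ℝ (D i).1 w - (D i).2)]
    nlinarith [mul_nonneg (abs_nonneg ((inner ℝ (D i).1 w : ℝ) - (D i).2)) hsw]
  · rw [mul_left_comm, Finset.mul_sum _ _ (2 : ℝ)]
    refine mul_le_mul_of_nonneg_left (Finset.sum_le_sum fun i _ => ?_) (by positivity)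
    rw [← sq_abs (inner ℝ (D i).1 w - (D i).2)]
    nlinarith [sq_nonneg (|(inner ℝ (D i).1 w : ℝ) - (D i).2| - s * ‖w‖)]

/-- The feature vectors of a dataset. -/
def feats (D : Data n d) : Fin n → E d := fun i => (D i).1

/-- The empirical cross moment `(1/n) ∑ yᵢ xᵢ`. -/
noncomputable def crossMoment (D : Data n d) : E d := (1 / (n : ℝ)) • ∑ i, (D i).2 • (D i).1

lemma ridgeObj_add (D : Data n d) (s : ℝ) (w v : E d) :
    ridgeObj D s (w + v) = ridgeObj D s w
      + 2 * inner ℝ (sampleCov (feats D) w + s ^ 2 • w - crossMoment D) v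
      + (inner ℝ v (sampleCov (feats D) v) + s ^ 2 * ‖v‖ ^ 2) := by
  have h1 : inner ℝ (sampleCov (feats D) w) v
      = (1 / (n : ℝ)) * ∑ i, inner ℝ (D i).1 w * inner ℝ (D i).1 v := by
    rw [← inner_sampleCov_comm, inner_sampleCov]
    rfl
  have h2 : inner ℝ (crossMoment D) v = (1 / (n : ℝ)) * ∑ i, (D i).2 * inner ℝ (D i).1 v := by
    rw [crossMoment, real_inner_smul_left, sum_inner]
    simp [real_inner_smul_left]
  have h3 : inner ℝ v (sampleCov (feats D) v)
      = (1 / (n : ℝ)) * ∑ i, inner ℝ (D i).1 v * inner ℝ (D i).1 v := inner_sampleCov _ _ _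
  rw [inner_sub_left, inner_add_left, real_inner_smul_left, h1, h2, h3, ridgeObj, ridgeObj,
    norm_add_sq_real]
  have h4 : ∀ i, (inner ℝ (D i).1 (w + v) - (D i).2) ^ 2
      = (inner ℝ (D i).1 w - (D i).2) ^ 2 + (2 * (inner ℝ (D i).1 w * inner ℝ (D i).1 v)
        - 2 * ((D i).2 * inner ℝ (D i).1 v) + inner ℝ (D i).1 v * inner ℝ (D i).1 v) := by
    intro i
    rw [inner_add_right]
    ring
  simp_rw [h4, Finset.sum_add_distrib, Finset.sum_sub_distrib, ← Finset.mul_sum]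
  ring

/-- The minimizers of the ridge objective are the solutions of the normal equation. -/
lemma isTrained_iff (D : Data n d) (s : ℝ) (w : E d) :
    IsTrained D s w ↔ sampleCov (feats D) w + s ^ 2 • w = crossMoment D := by
  constructor
  · intro h
    set g := sampleCov (feats D) w + s ^ 2 • w - crossMoment D with hg
    set q := inner ℝ g (sampleCov (feats D) g) + s ^ 2 * ‖g‖ ^ 2 with hq
    have hq0 : 0 ≤ q := add_nonneg (inner_sampleCov_self_nonneg _ _) (by positivity)
    -- a short step against the gradient would decrease the objective
    set e := ‖g‖ ^ 2 / (q + 1)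
    have h1 := h (w + (-e) • g)
    rw [ridgeObj_add, ← hg, real_inner_smul_right, real_inner_self_eq_norm_sq, map_smul,
      real_inner_smul_left, real_inner_smul_right, norm_smul, mul_pow] at h1
    have h2 : 0 ≤ 2 * (-e * ‖g‖ ^ 2) + e ^ 2 * q := by
      rw [hq]
      simp only [norm_neg, Real.norm_eq_abs, sq_abs] at h1
      nlinarith
    have h3 : e * (q + 1) = ‖g‖ ^ 2 := div_mul_cancel₀ _ (by positivity)
    have he0 : 0 ≤ e := by positivity
    have h4 : ‖g‖ ^ 2 = 0 := by
      by_contra hne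
      have hgpos : 0 < ‖g‖ ^ 2 := lt_of_le_of_ne (sq_nonneg _) (Ne.symm hne)
      have hepos : 0 < e := by positivity
      rw [← h3] at h2
      nlinarith [mul_pos hepos hepos, mul_nonneg (mul_pos hepos hepos).le hq0]
    have h5 : g = 0 := by simpa using h4
    exact sub_eq_zero.1 h5
  · intro h w'
    have h1 := ridgeObj_add D s w (w' - w)
    rw [h, sub_self, inner_zero_left, mul_zero, add_zero, add_sub_cancel] at h1
    rw [h1]
    have := inner_sampleCov_self_nonneg (feats D) (w' - w)
    have : 0 ≤ s ^ 2 * ‖w' - w‖ ^ 2 := by positivity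
    linarith

lemma crossMoment_eq (D : Data n d) :
    crossMoment D = noiseMap (feats D) (WithLp.toLp 2 (responses D)) := by
  rw [crossMoment, noiseMap_apply]
  rfl

lemma exists_isTrained (D : Data n d) {s : ℝ} (hs : 0 ≤ s) : ∃ w, IsTrained D s w := by
  simp only [isTrained_iff]
  rcases hs.eq_or_lt with rfl | hs
  · -- project the responses on the range of the design
    set T := noiseMap (feats D)
    set y : E n := WithLp.toLp 2 (responses D)
    obtain ⟨k, hk, k', hk', hy⟩ :=
      (LinearMap.range (adjoint T : E d →ₗ[ℝ] E n)).exists_add_mem_mem_orthogonal y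
    obtain ⟨u, rfl⟩ := hk
    have hTk' : T k' = 0 := by
      rw [← inner_self_eq_zero (𝕜 := ℝ), ← adjoint_inner_right, real_inner_comm]
      exact hk' _ ⟨_, rfl⟩
    refine ⟨(1 / (n : ℝ)) • u, ?_⟩
    rw [crossMoment_eq]
    change _ = T y
    rw [hy, map_add, hTk']
    simp [T, noiseMap_comp_adjoint]
  · exact ⟨resolvent (s ^ 2) (feats D) (crossMoment D), shift_resolvent_apply (by positivity) _ _⟩

lemma sampleCov_eq_mulVec (D : Data n d) (u : E d) :
    (sampleCov (feats D) u).ofLp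
      = ((1 / (n : ℝ)) • ((design D).transpose * design D)).mulVec u.ofLp := by
  have h : ∀ i, (inner ℝ (feats D i) u : ℝ) = (design D).mulVec u.ofLp i := by
    intro i
    simp [design, feats, Matrix.mulVec, dotProduct, PiLp.inner_apply, mul_comm]
  rw [Matrix.smul_mulVec, ← Matrix.mulVec_mulVec, sampleCov_apply]
  simp_rw [h]
  generalize (design D).mulVec u.ofLp = v
  ext j
  simp [Matrix.mulVec, dotProduct, feats, design, Finset.sum_apply, mul_comm]

lemma crossMoment_eq_mulVec (D : Data n d) :
    (crossMoment D).ofLp = (1 / (n : ℝ)) • (design D).transpose.mulVec (responses D) := by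
  ext j
  simp [crossMoment, Matrix.mulVec, dotProduct, design, responses, Finset.sum_apply, mul_comm]

/-- The explicit ridge estimator solves the normal equation. -/
lemma sampleCov_ridge_add (D : Data n d) {t : ℝ} (ht : 0 < t) :
    sampleCov (feats D) (ridge D t) + t • ridge D t = crossMoment D := by
  set M := (1 / (n : ℝ)) • ((design D).transpose * design D) + t • (1 : Matrix (Fin d) (Fin d) ℝ)
    with hM
  have hMu : ∀ u : E d, M.mulVec u.ofLp = (sampleCov (feats D) u + t • u).ofLp := by
    intro u
    rw [hM, Matrix.add_mulVec, ← sampleCov_eq_mulVec, Matrix.smul_mulVec, Matrix.one_mulVec]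
    rfl
  have hinj : Function.Injective M.mulVec := by
    intro a b hab
    have h1 := hMu (WithLp.toLp 2 a)
    have h2 := hMu (WithLp.toLp 2 b)
    have h3 : sampleCov (feats D) (WithLp.toLp 2 a) + t • WithLp.toLp 2 a
        = sampleCov (feats D) (WithLp.toLp 2 b) + t • (WithLp.toLp 2 b : E d) :=
      WithLp.ofLp_injective 2 (by rw [← h1, ← h2]; exact hab)
    have h4 := congrArg (resolvent t (feats D)) h3
    rw [resolvent_shift_apply ht, resolvent_shift_apply ht] at h4
    exact congrArg WithLp.ofLp h4
  have hunit : IsUnit M := Matrix.mulVec_injective_iff_isUnit.1 hinj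
  refine WithLp.ofLp_injective 2 ?_
  rw [← hMu, ridge, ← hM, crossMoment_eq_mulVec, Matrix.mulVec_mulVec,
    Matrix.mul_nonsing_inv _ ((Matrix.isUnit_iff_isUnit_det M).1 hunit), Matrix.one_mulVec]

lemma isTrained_iff_eq_ridge (D : Data n d) {s : ℝ} (hs : 0 < s) (w : E d) :
    IsTrained D s w ↔ w = ridge D (s ^ 2) := by
  rw [isTrained_iff, ← sampleCov_ridge_add D (by positivity : 0 < s ^ 2)]
  constructor
  · intro h
    have h1 := congrArg (resolvent (s ^ 2) (feats D)) h
    rwa [resolvent_shift_apply (by positivity), resolvent_shift_apply (by positivity)] at h1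
  · rintro rfl
    rfl

end Ridge

/-! ### Convergence in probability on varying spaces -/

namespace TendstoInProb

variable {Ω : ℕ → Type} [∀ k, MeasurableSpace (Ω k)] {P : ∀ k, Measure (Ω k)}
  {f g : ∀ k, Ω k → ℝ} {a b l : ℝ}

lemma of_tendsto {u : ℕ → ℝ} (hu : Tendsto u atTop (𝓝 a)) : TendstoInProb P (fun k _ => u k) a := by
  intro η hη
  refine tendsto_const_nhds.congr' ?_
  filter_upwards [Metric.tendsto_nhds.1 hu η hη] with k hk
  rw [Real.dist_eq] at hk
  have : {_ω : Ω k | η ≤ |u k - a|} = ∅ := by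
    ext ω
    simp [hk]
  rw [this, measure_empty]

/-- The continuous mapping theorem, for a function of two variables. -/
lemma map₂ (hf : TendstoInProb P f a) (hg : TendstoInProb P g b) {φ : ℝ × ℝ → ℝ}
    (hφ : ContinuousAt φ (a, b)) : TendstoInProb P (fun k ω => φ (f k ω, g k ω)) (φ (a, b)) := by
  intro η hη
  obtain ⟨δ, hδ, h⟩ := Metric.continuousAt_iff.1 hφ η hη
  refine tendsto_of_tendsto_of_tendsto_of_le_of_le tendsto_const_nhds
    (by simpa using (hf δ hδ).add (hg δ hδ)) (fun _ => zero_le) fun k => ?_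
  refine (measure_mono ?_).trans (measure_union_le _ _)
  intro ω hω
  by_contra hcon
  simp only [Set.mem_union, Set.mem_ofPred_eq, not_or, not_le] at hcon hω
  have h1 := h (x := (f k ω, g k ω)) (by
    rw [Prod.dist_eq, Real.dist_eq, Real.dist_eq]
    exact max_lt hcon.1 hcon.2)
  rw [Real.dist_eq] at h1
  exact absurd hω (not_le.2 h1)

lemma map (hf : TendstoInProb P f a) {φ : ℝ → ℝ} (hφ : ContinuousAt φ a) :
    TendstoInProb P (fun k ω => φ (f k ω)) (φ a) :=
  hf.map₂ hf (φ := fun p => φ p.1) (ContinuousAt.comp (g := φ) (f := Prod.fst) hφ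
    continuous_fst.continuousAt)

lemma add (hf : TendstoInProb P f a) (hg : TendstoInProb P g b) :
    TendstoInProb P (fun k ω => f k ω + g k ω) (a + b) :=
  hf.map₂ hg (φ := fun p => p.1 + p.2) (by fun_prop)

lemma sub (hf : TendstoInProb P f a) (hg : TendstoInProb P g b) :
    TendstoInProb P (fun k ω => f k ω - g k ω) (a - b) :=
  hf.map₂ hg (φ := fun p => p.1 - p.2) (by fun_prop)

lemma mul (hf : TendstoInProb P f a) (hg : TendstoInProb P g b) :
    TendstoInProb P (fun k ω => f k ω * g k ω) (a * b) :=
  hf.map₂ hg (φ := fun p => p.1 * p.2) (by fun_prop)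

lemma congr' (hf : TendstoInProb P f a) (h : ∀ᶠ k in atTop, ∀ ω, f k ω = g k ω) :
    TendstoInProb P g a := by
  intro η hη
  refine (hf η hη).congr' ?_
  filter_upwards [h] with k hk
  simp_rw [hk]

lemma of_lintegral_abs_le (hf : ∀ k, Measurable (f k)) {e : ℕ → ℝ} (he : Tendsto e atTop (𝓝 0))
    (h : ∀ᶠ k in atTop, ∫⁻ ω, ENNReal.ofReal |f k ω| ∂(P k) ≤ ENNReal.ofReal (e k)) :
    TendstoInProb P f 0 := by
  intro η hη
  have hη2 : ENNReal.ofReal η ≠ 0 := by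
    rw [Ne, ENNReal.ofReal_eq_zero, not_le]; positivity
  have h1 := ENNReal.Tendsto.div_const (ENNReal.tendsto_ofReal he) (Or.inr hη2)
  rw [ENNReal.ofReal_zero, ENNReal.zero_div] at h1
  refine tendsto_of_tendsto_of_tendsto_of_le_of_le' tendsto_const_nhds h1
    (Eventually.of_forall fun _ => zero_le) ?_
  filter_upwards [h] with k hk
  have h2 := meas_ge_le_lintegral_div (μ := P k) (hf k).abs.ennreal_ofReal.aemeasurable
    hη2 ENNReal.ofReal_ne_top
  refine (measure_mono fun ω hω => ?_).trans (h2.trans (ENNReal.div_le_div_right hk _))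
  simp only [Set.mem_ofPred_eq, sub_zero] at hω ⊢
  exact ENNReal.ofReal_le_ofReal hω

lemma of_lintegral_sq_le (hf : ∀ k, Measurable (f k)) {e : ℕ → ℝ} (he : Tendsto e atTop (𝓝 0))
    (h : ∀ᶠ k in atTop, ∫⁻ ω, ENNReal.ofReal (f k ω ^ 2) ∂(P k) ≤ ENNReal.ofReal (e k)) :
    TendstoInProb P f 0 := by
  have h1 : TendstoInProb P (fun k ω => f k ω ^ 2) 0 :=
    of_lintegral_abs_le (fun k => (hf k).pow_const 2) he (by simpa only [abs_sq] using h)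
  intro η hη
  refine tendsto_of_tendsto_of_tendsto_of_le_of_le tendsto_const_nhds (h1 (η ^ 2) (by positivity))
    (fun _ => zero_le) fun k => measure_mono fun ω hω => ?_
  simp only [Set.mem_ofPred_eq, sub_zero] at hω ⊢
  rw [abs_sq, ← sq_abs (f k ω)]
  exact pow_le_pow_left₀ hη.le hω 2

/-- A sequence that is approximated in probability by convergent sequences converges. -/
lemma of_approx (h : ∀ δ : ℝ, 0 < δ → ∃ (f' : ∀ k, Ω k → ℝ) (l' : ℝ), TendstoInProb P f' l' ∧
      |l' - l| < δ ∧ Tendsto (fun k => P k {ω | δ ≤ |f k ω - f' k ω|}) atTop (𝓝 0)) :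
    TendstoInProb P f l := by
  intro η hη
  obtain ⟨f', l', h1, h2, h3⟩ := h (η / 3) (by positivity)
  refine tendsto_of_tendsto_of_tendsto_of_le_of_le tendsto_const_nhds
    (by simpa using h3.add (h1 (η / 3) (by positivity))) (fun _ => zero_le) fun k => ?_
  refine (measure_mono ?_).trans (measure_union_le _ _)
  intro ω hω
  by_contra hcon
  simp only [Set.mem_union, Set.mem_ofPred_eq, not_or, not_le] at hcon hω
  have e : f k ω - l = (f k ω - f' k ω) + ((f' k ω - l') + (l' - l)) := by ring
  have e1 := abs_add_le (f k ω - f' k ω) ((f' k ω - l') + (l' - l))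
  have e2 := abs_add_le (f' k ω - l') (l' - l)
  rw [← e] at e1
  linarith [hcon.1, hcon.2]

lemma of_le {B : ℝ} (hf : TendstoInProb P f a) (hB : a < B) :
    Tendsto (fun k => P k {ω | B ≤ f k ω}) atTop (𝓝 0) := by
  refine tendsto_of_tendsto_of_tendsto_of_le_of_le tendsto_const_nhds
    (hf (B - a) (sub_pos.2 hB)) (fun _ => zero_le) fun k => measure_mono fun ω hω => ?_
  simp only [Set.mem_ofPred_eq] at hω ⊢
  exact le_trans (by linarith) (le_abs_self _)

end TendstoInProb

lemma TendstoInProb.fst {Ω Ω' : ℕ → Type} [∀ k, MeasurableSpace (Ω k)]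
    [∀ k, MeasurableSpace (Ω' k)] {P : ∀ k, Measure (Ω k)} {P' : ∀ k, Measure (Ω' k)}
    [∀ k, IsProbabilityMeasure (P' k)] [∀ k, SFinite (P k)]
    {f : ∀ k, Ω k → ℝ} {a : ℝ} (hf : TendstoInProb P f a) :
    TendstoInProb (fun k => (P k).prod (P' k)) (fun k p => f k p.1) a := by
  intro η hη
  refine (hf η hη).congr fun k => ?_
  have : {p : Ω k × Ω' k | η ≤ |f k p.1 - a|} = {ω | η ≤ |f k ω - a|} ×ˢ Set.univ := by
    ext p
    simp
  rw [this, Measure.prod_prod, measure_univ, mul_one]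

/-! ### Continuity of the limiting quantities -/

lemma continuousAt_mpRoot {t g : ℝ} (hD : 0 < (t + 1 - g) + √((t + 1 - g) ^ 2 + 4 * g * t)) :
    ContinuousAt (fun p : ℝ × ℝ => mpRoot p.1 p.2) (t, g) := by
  unfold mpRoot
  exact ContinuousAt.div continuousAt_const (by fun_prop) hD.ne'

lemma continuousAt_mpRoot₂ {t g : ℝ} (ht : 0 ≤ t) (hg : 0 ≤ g)
    (hD : 0 < (t + 1 - g) + √((t + 1 - g) ^ 2 + 4 * g * t)) :
    ContinuousAt (fun p : ℝ × ℝ => mpRoot₂ p.1 p.2) (t, g) := by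
  have hm : 0 < mpRoot t g := div_pos two_pos hD
  have hc := continuousAt_mpRoot hD
  unfold mpRoot₂
  have h1 : ContinuousAt (fun p : ℝ × ℝ => (1 + p.2 * mpRoot p.1 p.2) ^ 2) (t, g) :=
    (continuousAt_const.add (continuousAt_snd.mul hc)).pow 2
  have h2 : (1 + g * mpRoot t g) ^ 2 ≠ 0 := by positivity
  refine hc.div (continuousAt_fst.add (continuousAt_const.div h1 h2)) ?_
  simp only
  positivity

/-- The limit of `‖ŵ - w₀‖² / d`: a squared bias plus a variance term. -/
noncomputable def limErr (R σ t g : ℝ) : ℝ :=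
  t ^ 2 * R ^ 2 * mpRoot₂ t g + σ ^ 2 * g * (mpRoot t g - t * mpRoot₂ t g)

/-- The limit of `‖ŵ‖² / d`. -/
noncomputable def limNorm (R σ t g : ℝ) : ℝ := R ^ 2 * (1 - 2 * t * mpRoot t g) + limErr R σ t g

lemma continuousAt_limErr (R σ : ℝ) {t g : ℝ} (ht : 0 ≤ t) (hg : 0 ≤ g)
    (hD : 0 < (t + 1 - g) + √((t + 1 - g) ^ 2 + 4 * g * t)) :
    ContinuousAt (fun p : ℝ × ℝ => limErr R σ p.1 p.2) (t, g) := by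
  have h1 := continuousAt_mpRoot hD
  have h2 := continuousAt_mpRoot₂ ht hg hD
  unfold limErr
  exact (((continuousAt_fst.pow 2).mul continuousAt_const).mul h2).add
    ((continuousAt_const.mul continuousAt_snd).mul (h1.sub (continuousAt_fst.mul h2)))

lemma continuousAt_limNorm (R σ : ℝ) {t g : ℝ} (ht : 0 ≤ t) (hg : 0 ≤ g)
    (hD : 0 < (t + 1 - g) + √((t + 1 - g) ^ 2 + 4 * g * t)) :
    ContinuousAt (fun p : ℝ × ℝ => limNorm R σ p.1 p.2) (t, g) := by
  have h1 := continuousAt_mpRoot hD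
  unfold limNorm
  exact (continuousAt_const.mul (continuousAt_const.sub
    ((continuousAt_const.mul continuousAt_fst).mul h1))).add (continuousAt_limErr R σ ht hg hD)

lemma mpRoot_zero_right {t : ℝ} (ht : 0 ≤ t) : mpRoot t 0 = 1 / (1 + t) := by
  have h : √((t + 1 - 0) ^ 2 + 4 * 0 * t) = t + 1 := by
    rw [show (t + 1 - 0) ^ 2 + 4 * 0 * t = (t + 1) ^ 2 by ring, Real.sqrt_sq (by positivity)]
  rw [mpRoot, h, sub_zero, div_eq_div_iff (by positivity) (by positivity)]
  ring

lemma limErr_zero_right (R σ : ℝ) {t : ℝ} (ht : 0 ≤ t) :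
    limErr R σ t 0 = (t / (1 + t)) ^ 2 * R ^ 2 := by
  rw [limErr, mpRoot₂, mpRoot_zero_right ht]
  field_simp
  ring

lemma limNorm_zero_right (R σ : ℝ) {t : ℝ} (ht : 0 ≤ t) :
    limNorm R σ t 0 = (1 - t / (1 + t)) ^ 2 * R ^ 2 := by
  rw [limNorm, limErr_zero_right R σ ht, mpRoot_zero_right ht]
  field_simp
  ring

/-- The rate `mpErr` in powers of `d ^ (-1/4)`, which is the finite difference step for which
`mpErr₂` tends to zero. -/
lemma mpErr_eq {t : ℝ} (ht : 0 < t) {d : ℕ} (hd : 0 < d) :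
    mpErr t d = (√(gaussKurt + 1) * (1 / √√d) ^ 2 + (1 / √√d) ^ 4) / t ^ 2 := by
  have hd' : (0 : ℝ) < d := by exact_mod_cast hd
  have hK := gaussKurt_nonneg
  have h2 : (√√(d : ℝ)) ^ 2 = √d := Real.sq_sqrt (Real.sqrt_nonneg _)
  have h4 : (√√(d : ℝ)) ^ 4 = d := by
    rw [show (4 : ℕ) = 2 * 2 by norm_num, pow_mul, h2, Real.sq_sqrt hd'.le]
  rw [mpErr, Real.sqrt_mul (by positivity)]
  rw [div_pow, div_pow, h2, h4]
  have h5 : √(d : ℝ) * √d = d := Real.mul_self_sqrt hd'.le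
  have h6 : 0 < √(d : ℝ) := Real.sqrt_pos.2 hd'
  field_simp
  linear_combination (√(gaussKurt + 1)) * h5

lemma tendsto_inv_sqrt_sqrt {d : ℕ → ℕ} (hd : Tendsto d atTop atTop) :
    Tendsto (fun k => 1 / √√(d k : ℝ)) atTop (𝓝 0) := by
  have h : Tendsto (fun k => √√(d k : ℝ)) atTop atTop :=
    Real.tendsto_sqrt_atTop.comp (Real.tendsto_sqrt_atTop.comp
      (tendsto_natCast_atTop_atTop.comp hd))
  simp only [one_div]
  exact h.inv_tendsto_atTop

lemma tendsto_mpErr {t : ℝ} (ht : 0 < t) {d : ℕ → ℕ} (hd : Tendsto d atTop atTop) :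
    Tendsto (fun k => mpErr t (d k)) atTop (𝓝 0) := by
  have hx := tendsto_inv_sqrt_sqrt hd
  have h : Tendsto (fun k => (√(gaussKurt + 1) * (1 / √√(d k : ℝ)) ^ 2
      + (1 / √√(d k : ℝ)) ^ 4) / t ^ 2) atTop (𝓝 ((√(gaussKurt + 1) * 0 ^ 2 + 0 ^ 4) / t ^ 2)) :=
    (((hx.pow 2).const_mul _).add (hx.pow 4)).div_const _
  simp only [ne_eq, OfNat.ofNat_ne_zero, not_false_eq_true, zero_pow, mul_zero, add_zero,
    zero_div] at h
  refine h.congr' ?_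
  filter_upwards [hd.eventually_gt_atTop 0] with k hk
  rw [mpErr_eq ht hk]

lemma tendsto_mpErr₂ {t γ : ℝ} (ht : 0 < t) {g : ℕ → ℝ} {d : ℕ → ℕ}
    (hd : Tendsto d atTop atTop) (hg : Tendsto g atTop (𝓝 γ)) :
    Tendsto (fun k => mpErr₂ t (g k) (d k) (1 / √√(d k : ℝ))) atTop (𝓝 0) := by
  have hx := tendsto_inv_sqrt_sqrt hd
  have h : Tendsto (fun k => 1 / √√(d k : ℝ) / t ^ 3
      + 2 * ((√(gaussKurt + 1) * (1 / √√(d k : ℝ)) + (1 / √√(d k : ℝ)) ^ 3) / t ^ 2)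
      + (1 / √√(d k : ℝ) / t ^ 3 + g k * (1 / √√(d k : ℝ)) / t ^ 5)) atTop
      (𝓝 (0 / t ^ 3 + 2 * ((√(gaussKurt + 1) * 0 + 0 ^ 3) / t ^ 2) + (0 / t ^ 3
        + γ * 0 / t ^ 5))) :=
    ((hx.div_const _).add ((((hx.const_mul _).add (hx.pow 3)).div_const _).const_mul 2)).add
      ((hx.div_const _).add ((hg.mul hx).div_const _))
  simp only [ne_eq, OfNat.ofNat_ne_zero, not_false_eq_true, zero_pow, mul_zero, add_zero,
    zero_div] at h
  refine h.congr' ?_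
  filter_upwards [hd.eventually_gt_atTop 0] with k hk
  have hk' : (0 : ℝ) < d k := by exact_mod_cast hk
  have hs : 0 < √√(d k : ℝ) := Real.sqrt_pos.2 (Real.sqrt_pos.2 hk')
  rw [mpErr₂, mpErr_eq ht hk]
  field_simp

/-! ### The ridge estimator at positive regularization -/

lemma lintegral_ofReal_mul_sq_le {α : Type*} [MeasurableSpace α] {μ : Measure α} {F : α → ℝ}
    {B : ℝ} (a : ℝ) (h : ∫⁻ x, ENNReal.ofReal (F x ^ 2) ∂μ ≤ ENNReal.ofReal B) :
    ∫⁻ x, ENNReal.ofReal ((a * F x) ^ 2) ∂μ ≤ ENNReal.ofReal (a ^ 2 * B) := by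
  simp_rw [mul_pow, ENNReal.ofReal_mul (sq_nonneg a)]
  rw [lintegral_const_mul' _ _ ENNReal.ofReal_ne_top]
  gcongr

lemma lintegral_prod_le_of_forall {α β : Type*} [MeasurableSpace α] [MeasurableSpace β]
    {μ : Measure α} {ν : Measure β} [IsProbabilityMeasure μ] [SFinite ν] {F : α × β → ℝ≥0∞}
    (hF : Measurable F) {B : ℝ≥0∞} (h : ∀ x, ∫⁻ y, F (x, y) ∂ν ≤ B) :
    ∫⁻ p, F p ∂(μ.prod ν) ≤ B := by
  rw [lintegral_prod _ hF.aemeasurable]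
  calc ∫⁻ x, ∫⁻ y, F (x, y) ∂ν ∂μ ≤ ∫⁻ _x, B ∂μ := lintegral_mono h
    _ = B := by simp

/-- The joint law of Gaussian features and standardized Gaussian noise. -/
noncomputable abbrev featNoiseLaw (n d : ℕ) : Measure ((Fin n → E d) × E n) :=
  (featLaw n d).prod (stdGaussian (E n))

section PositiveRegularization

variable {t γ : ℝ} {n d : ℕ → ℕ}

lemma tendstoInProb_tr_resolvent (ht : 0 < t) (hγ : 0 < γ) (hn : Tendsto n atTop atTop)
    (hd : Tendsto d atTop atTop) (hr : Tendsto (fun k => (d k : ℝ) / n k) atTop (𝓝 γ)) :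
    TendstoInProb (fun k => featLaw (n k) (d k)) (fun k X => tr (resolvent t X) / d k)
      (mpRoot t γ) := by
  have hc : ContinuousAt (fun g => mpRoot t g) γ :=
    ContinuousAt.comp (f := fun g => (t, g)) (continuousAt_mpRoot (mpRoot_denom_pos ht hγ))
      (by fun_prop)
  have h1 : TendstoInProb (fun k => featLaw (n k) (d k))
      (fun k X => tr (resolvent t X) / d k - mpRoot t (d k / n k)) 0 := by
    refine .of_lintegral_abs_le (fun k => ((measurable_tr_resolvent ht).div_const _).sub_const _)
      (tendsto_mpErr ht hd) ?_
    filter_upwards [hn.eventually_gt_atTop 0, hd.eventually_gt_atTop 0] with k hnk hdk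
    exact lintegral_tr_resolvent_sub_mpRoot_le ht hdk hnk
  have h2 := h1.add (.of_tendsto (hc.tendsto.comp hr))
  rw [zero_add] at h2
  exact h2.congr' (.of_forall fun k X => by simp)

lemma tendsto_mpRoot₂_ratio (ht : 0 < t) (hγ : 0 < γ)
    (hr : Tendsto (fun k => (d k : ℝ) / n k) atTop (𝓝 γ)) :
    Tendsto (fun k => mpRoot₂ t (d k / n k)) atTop (𝓝 (mpRoot₂ t γ)) := by
  have hc : ContinuousAt (fun g => mpRoot₂ t g) γ :=
    ContinuousAt.comp (f := fun g => (t, g))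
      (continuousAt_mpRoot₂ ht.le hγ.le (mpRoot_denom_pos ht hγ)) (by fun_prop)
  exact hc.tendsto.comp hr

lemma tendstoInProb_tr_resolvent_sq (ht : 0 < t) (hγ : 0 < γ) (hn : Tendsto n atTop atTop)
    (hd : Tendsto d atTop atTop) (hr : Tendsto (fun k => (d k : ℝ) / n k) atTop (𝓝 γ)) :
    TendstoInProb (fun k => featLaw (n k) (d k))
      (fun k X => tr (resolvent t X * resolvent t X) / d k) (mpRoot₂ t γ) := by
  have h1 : TendstoInProb (fun k => featLaw (n k) (d k))
      (fun k X => tr (resolvent t X * resolvent t X) / d k - mpRoot₂ t (d k / n k)) 0 := by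
    refine .of_lintegral_abs_le (fun k => ?_) (tendsto_mpErr₂ ht hd hr) ?_
    · have hc := continuous_resolvent (n := n k) (d := d k) ht
      exact (((continuous_tr.comp (hc.mul hc)).measurable).div_const _).sub_const _
    filter_upwards [hn.eventually_gt_atTop 0, hd.eventually_gt_atTop 0] with k hnk hdk
    have hdk' : (0 : ℝ) < d k := by exact_mod_cast hdk
    exact lintegral_tr_resolvent_sq_sub_le ht
      (one_div_pos.2 (Real.sqrt_pos.2 (Real.sqrt_pos.2 hdk'))) hdk hnk
  have h2 := h1.add (.of_tendsto (tendsto_mpRoot₂_ratio ht hγ hr))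
  rw [zero_add] at h2
  exact h2.congr' (.of_forall fun k X => by simp)

variable {R σ : ℝ} {w₀ : ∀ k, E (d k)} {σ₀ : ℕ → ℝ≥0}

lemma tendstoInProb_inner_resolvent (H : Regime R σ γ n d w₀ σ₀) (ht : 0 < t) (hγ : 0 < γ) :
    TendstoInProb (fun k => featLaw (n k) (d k))
      (fun k X => inner ℝ (w₀ k) (resolvent t X (w₀ k)) / d k) (R ^ 2 * mpRoot t γ) := by
  have hc : ContinuousAt (fun g => mpRoot t g) γ :=
    ContinuousAt.comp (f := fun g => (t, g)) (continuousAt_mpRoot (mpRoot_denom_pos ht hγ))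
      (by fun_prop)
  have h1 : TendstoInProb (fun k => featLaw (n k) (d k))
      (fun k X => 1 / (d k : ℝ) * (inner ℝ (w₀ k) (resolvent t X (w₀ k))
        - mpRoot t (d k / n k) * ‖w₀ k‖ ^ 2)) 0 := by
    have he : Tendsto (fun k => (‖w₀ k‖ ^ 2 / d k) ^ 2 * (2 * (2 * (1 / t)) * mpErr t (d k)
          + 2 * gaussKurt * (2 * (1 / t)) ^ 2 * (1 / (d k : ℝ)))) atTop
        (𝓝 ((R ^ 2) ^ 2 * (2 * (2 * (1 / t)) * 0 + 2 * gaussKurt * (2 * (1 / t)) ^ 2 * 0))) :=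
      (H.signal.pow 2).mul (((tendsto_mpErr ht H.d_top).const_mul _).add
        ((tendsto_one_div_atTop_nhds_zero_nat.comp H.d_top).const_mul _))
    rw [mul_zero, mul_zero, add_zero, mul_zero] at he
    refine .of_lintegral_sq_le (fun k => ?_) he ?_
    · have hc := continuous_resolvent (n := n k) (d := d k) ht
      exact Continuous.measurable (by fun_prop)
    filter_upwards [H.n_top.eventually_gt_atTop 0, H.d_top.eventually_gt_atTop 0] with k hnk hdk
    refine (lintegral_ofReal_mul_sq_le _
      (lintegral_inner_resolvent_sub_le ht hdk hnk (w₀ k))).trans (le_of_eq ?_)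
    congr 1
    ring
  have h2 := h1.add (.of_tendsto (H.signal.mul (hc.tendsto.comp H.ratio)))
  rw [zero_add] at h2
  refine h2.congr' (.of_forall fun k X => ?_)
  simp only [Function.comp_apply]
  ring

lemma tendstoInProb_norm_resolvent_sq (H : Regime R σ γ n d w₀ σ₀) (ht : 0 < t) (hγ : 0 < γ) :
    TendstoInProb (fun k => featLaw (n k) (d k))
      (fun k X => ‖resolvent t X (w₀ k)‖ ^ 2 / d k) (R ^ 2 * mpRoot₂ t γ) := by
  have h1 : TendstoInProb (fun k => featLaw (n k) (d k))
      (fun k X => 1 / (d k : ℝ) * (‖resolvent t X (w₀ k)‖ ^ 2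
        - mpRoot₂ t (d k / n k) * ‖w₀ k‖ ^ 2)) 0 := by
    have he : Tendsto (fun k => (‖w₀ k‖ ^ 2 / d k) ^ 2 * (2 * (2 * (1 / t * (1 / t)))
          * mpErr₂ t (d k / n k) (d k) (1 / √√(d k : ℝ))
          + 2 * gaussKurt * (2 * (1 / t * (1 / t))) ^ 2 * (1 / (d k : ℝ)))) atTop
        (𝓝 ((R ^ 2) ^ 2 * (2 * (2 * (1 / t * (1 / t))) * 0
          + 2 * gaussKurt * (2 * (1 / t * (1 / t))) ^ 2 * 0))) :=
      (H.signal.pow 2).mul (((tendsto_mpErr₂ ht H.d_top H.ratio).const_mul _).add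
        ((tendsto_one_div_atTop_nhds_zero_nat.comp H.d_top).const_mul _))
    rw [mul_zero, mul_zero, add_zero, mul_zero] at he
    refine .of_lintegral_sq_le (fun k => ?_) he ?_
    · have hc := continuous_resolvent (n := n k) (d := d k) ht
      exact Continuous.measurable (by fun_prop)
    filter_upwards [H.n_top.eventually_gt_atTop 0, H.d_top.eventually_gt_atTop 0] with k hnk hdk
    have hdk' : (0 : ℝ) < d k := by exact_mod_cast hdk
    refine (lintegral_ofReal_mul_sq_le _ (lintegral_norm_resolvent_sq_sub_le ht
      (one_div_pos.2 (Real.sqrt_pos.2 (Real.sqrt_pos.2 hdk'))) hdk hnk (w₀ k))).trans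
      (le_of_eq ?_)
    congr 1
    ring
  have h2 := h1.add (.of_tendsto (H.signal.mul (tendsto_mpRoot₂_ratio ht hγ H.ratio)))
  rw [zero_add] at h2
  refine h2.congr' (.of_forall fun k X => ?_)
  ring

lemma continuous_ridgeNoise_apply {n d : ℕ} (ht : 0 < t) :
    Continuous fun p : (Fin n → E d) × E n => ridgeNoise t p.1 p.2 := by
  have h1 : Continuous fun p : (Fin n → E d) × E n => resolvent t p.1 :=
    (continuous_resolvent ht).comp continuous_fst
  have h2 : Continuous fun p : (Fin n → E d) × E n => noiseMap p.1 :=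
    continuous_noiseMap.comp continuous_fst
  exact h1.clm_apply (h2.clm_apply continuous_snd)

/-- The noise part of the ridge estimator is asymptotically orthogonal to any vector that is a
bounded function of the features. -/
lemma tendstoInProb_inner_ridgeNoise (H : Regime R σ γ n d w₀ σ₀) (ht : 0 < t)
    {v : ∀ k, (Fin (n k) → E (d k)) → E (d k)} (hv : ∀ k, Continuous (v k)) {C : ℝ}
    (hvC : ∀ k X, ‖v k X‖ ≤ C * ‖w₀ k‖) :
    TendstoInProb (fun k => featNoiseLaw (n k) (d k))
      (fun k p => (σ₀ k / d k : ℝ) * inner ℝ (v k p.1) (ridgeNoise t p.1 p.2)) 0 := by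
  have he : Tendsto (fun k => (σ₀ k : ℝ) ^ 2 / d k * (‖w₀ k‖ ^ 2 / d k)
      * (C ^ 2 / t * (1 / (n k : ℝ)))) atTop (𝓝 (σ ^ 2 * R ^ 2 * (C ^ 2 / t * 0))) :=
    (H.noise.mul H.signal).mul ((tendsto_one_div_atTop_nhds_zero_nat.comp H.n_top).const_mul _)
  rw [mul_zero, mul_zero] at he
  have hm : ∀ k, Measurable fun p : (Fin (n k) → E (d k)) × E (n k) =>
      inner ℝ (v k p.1) (ridgeNoise t p.1 p.2) := fun k =>
    ((hv k).comp continuous_fst |>.inner (continuous_ridgeNoise_apply ht)).measurable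
  refine .of_lintegral_sq_le (fun k => (hm k).const_mul _) he (.of_forall fun k => ?_)
  have hb : ∀ X, ∫⁻ z, ENNReal.ofReal (inner ℝ (v k X) (ridgeNoise t X z) ^ 2)
      ∂(stdGaussian (E (n k))) ≤ ENNReal.ofReal (C ^ 2 * ‖w₀ k‖ ^ 2 / (t * n k)) := fun X => by
    refine (lintegral_inner_ridgeNoise_sq_le ht X _).trans (ENNReal.ofReal_le_ofReal ?_)
    rw [← mul_pow]
    gcongr
    exact hvC k X
  refine (lintegral_ofReal_mul_sq_le _ (lintegral_prod_le_of_forall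
    ((hm k).pow_const 2).ennreal_ofReal hb)).trans (le_of_eq ?_)
  congr 1
  field_simp

lemma tendstoInProb_norm_ridgeNoise_sq (H : Regime R σ γ n d w₀ σ₀) (ht : 0 < t) (hγ : 0 < γ) :
    TendstoInProb (fun k => featNoiseLaw (n k) (d k))
      (fun k p => (σ₀ k : ℝ) ^ 2 / d k * ‖ridgeNoise t p.1 p.2‖ ^ 2)
      (σ ^ 2 * γ * (mpRoot t γ - t * mpRoot₂ t γ)) := by
  have he : Tendsto (fun k => ((σ₀ k : ℝ) ^ 2 / d k) ^ 2 * (gaussKurt / t ^ 2 * (1 / (n k : ℝ))))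
      atTop (𝓝 ((σ ^ 2) ^ 2 * (gaussKurt / t ^ 2 * 0))) :=
    (H.noise.pow 2).mul ((tendsto_one_div_atTop_nhds_zero_nat.comp H.n_top).const_mul _)
  rw [mul_zero, mul_zero] at he
  have hm : ∀ k, Measurable fun p : (Fin (n k) → E (d k)) × E (n k) =>
      ‖ridgeNoise t p.1 p.2‖ ^ 2 - (1 / (n k : ℝ)) * (tr (resolvent t p.1)
        - t * tr (resolvent t p.1 * resolvent t p.1)) := fun k => by
    have hc : Continuous fun p : (Fin (n k) → E (d k)) × E (n k) => resolvent t p.1 :=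
      (continuous_resolvent ht).comp continuous_fst
    exact (((continuous_ridgeNoise_apply ht).norm.pow 2).sub (continuous_const.mul
      ((continuous_tr.comp hc).sub (continuous_const.mul
        (continuous_tr.comp (hc.mul hc)))))).measurable
  have h1 : TendstoInProb (fun k => featNoiseLaw (n k) (d k))
      (fun k p => (σ₀ k : ℝ) ^ 2 / d k * (‖ridgeNoise t p.1 p.2‖ ^ 2 - (1 / (n k : ℝ)) *
        (tr (resolvent t p.1) - t * tr (resolvent t p.1 * resolvent t p.1)))) 0 := by
    refine .of_lintegral_sq_le (fun k => (hm k).const_mul _) he ?_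
    filter_upwards [H.n_top.eventually_gt_atTop 0] with k hnk
    refine (lintegral_ofReal_mul_sq_le _ (lintegral_prod_le_of_forall
      ((hm k).pow_const 2).ennreal_ofReal
      (lintegral_norm_ridgeNoise_sub_sq_le ht hnk))).trans (le_of_eq ?_)
    congr 1
    field_simp
  have h2 := ((tendstoInProb_tr_resolvent ht hγ H.n_top H.d_top H.ratio).sub
    ((TendstoInProb.of_tendsto (tendsto_const_nhds (x := t))).mul
      (tendstoInProb_tr_resolvent_sq ht hγ H.n_top H.d_top H.ratio))).fst
    (P' := fun k => stdGaussian (E (n k)))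
  have h3 := h1.add ((TendstoInProb.of_tendsto (H.noise.mul H.ratio)).mul h2)
  rw [zero_add] at h3
  refine h3.congr' ?_
  filter_upwards [H.n_top.eventually_gt_atTop 0, H.d_top.eventually_gt_atTop 0] with k hnk hdk p
  have hdk' : (0 : ℝ) < d k := by exact_mod_cast hdk
  have hnk' : (0 : ℝ) < n k := by exact_mod_cast hnk
  field_simp
  ring

/-- The error `ŵ - w₀` of the ridge estimator: noise minus bias. -/
noncomputable def ridgeErr {n d : ℕ} (t : ℝ) (w₀ : E d) (σ₀ : ℝ) (p : (Fin n → E d) × E n) : E d :=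
  σ₀ • ridgeNoise t p.1 p.2 - t • resolvent t p.1 w₀

lemma add_ridgeErr {n d : ℕ} (ht : 0 < t) (w₀ : E d) (σ₀ : ℝ) (p : (Fin n → E d) × E n) :
    w₀ + ridgeErr t w₀ σ₀ p = resolvent t p.1 (sampleCov p.1 w₀ + σ₀ • noiseMap p.1 p.2) := by
  rw [ridgeErr, map_add, map_smul, resolvent_sampleCov_apply ht, ridgeNoise,
    ContinuousLinearMap.comp_apply]
  abel

lemma tendstoInProb_norm_ridgeErr_sq (H : Regime R σ γ n d w₀ σ₀) (ht : 0 < t) (hγ : 0 < γ) :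
    TendstoInProb (fun k => featNoiseLaw (n k) (d k))
      (fun k p => ‖ridgeErr t (w₀ k) (σ₀ k) p‖ ^ 2 / d k) (limErr R σ t γ) := by
  have hc : ∀ k, Continuous fun X : Fin (n k) → E (d k) => resolvent t X (w₀ k) := fun k =>
    (continuous_resolvent ht).clm_apply continuous_const
  have h1 := tendstoInProb_norm_ridgeNoise_sq H ht hγ
  have h2 := tendstoInProb_inner_ridgeNoise H ht hc (fun k X => norm_resolvent_apply_le ht X (w₀ k))
  have h3 := (tendstoInProb_norm_resolvent_sq H ht hγ).fst (P' := fun k => stdGaussian (E (n k)))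
  have h4 := (h1.sub (h2.mul (.of_tendsto (tendsto_const_nhds (x := 2 * t))))).add
    (h3.mul (.of_tendsto (tendsto_const_nhds (x := t ^ 2))))
  have hl : limErr R σ t γ = σ ^ 2 * γ * (mpRoot t γ - t * mpRoot₂ t γ) - 0 * (2 * t)
      + R ^ 2 * mpRoot₂ t γ * t ^ 2 := by
    rw [limErr]; ring
  rw [hl]
  refine h4.congr' (.of_forall fun k p => ?_)
  rw [ridgeErr, norm_sub_sq_real, norm_smul, norm_smul, real_inner_smul_left,
    real_inner_smul_right, mul_pow, mul_pow, Real.norm_eq_abs, Real.norm_eq_abs, sq_abs, sq_abs,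
    real_inner_comm]
  ring

lemma tendstoInProb_norm_add_ridgeErr_sq (H : Regime R σ γ n d w₀ σ₀) (ht : 0 < t) (hγ : 0 < γ) :
    TendstoInProb (fun k => featNoiseLaw (n k) (d k))
      (fun k p => ‖w₀ k + ridgeErr t (w₀ k) (σ₀ k) p‖ ^ 2 / d k) (limNorm R σ t γ) := by
  have h1 := tendstoInProb_inner_ridgeNoise H ht (v := fun k _ => w₀ k)
    (fun k => continuous_const) (C := 1) (fun k X => by simp)
  have h2 := (tendstoInProb_inner_resolvent H ht hγ).fst (P' := fun k => stdGaussian (E (n k)))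
  have h3 := (TendstoInProb.of_tendsto H.signal).add
    (((h1.mul (.of_tendsto (tendsto_const_nhds (x := (2 : ℝ))))).sub
      (h2.mul (.of_tendsto (tendsto_const_nhds (x := 2 * t))))).add
        (tendstoInProb_norm_ridgeErr_sq H ht hγ))
  have hl : limNorm R σ t γ = R ^ 2 + (0 * 2 - R ^ 2 * mpRoot t γ * (2 * t) + limErr R σ t γ) := by
    rw [limNorm]; ring
  rw [hl]
  refine h3.congr' (.of_forall fun k p => ?_)
  rw [norm_add_sq_real]
  have h5 : inner ℝ (w₀ k) (ridgeErr t (w₀ k) (σ₀ k) p)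
      = σ₀ k * inner ℝ (w₀ k) (ridgeNoise t p.1 p.2)
        - t * inner ℝ (w₀ k) (resolvent t p.1 (w₀ k)) := by
    rw [ridgeErr, inner_sub_right, real_inner_smul_right, real_inner_smul_right]
  rw [h5]
  ring

lemma tendstoInProb_norm_ridgeErr (H : Regime R σ γ n d w₀ σ₀) (ht : 0 < t) (hγ : 0 < γ) :
    TendstoInProb (fun k => featNoiseLaw (n k) (d k))
      (fun k p => ‖ridgeErr t (w₀ k) (σ₀ k) p‖ / √(d k)) √(limErr R σ t γ) := by
  refine ((tendstoInProb_norm_ridgeErr_sq H ht hγ).map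
    Real.continuous_sqrt.continuousAt).congr' (.of_forall fun k p => ?_)
  rw [Real.sqrt_div (sq_nonneg _), Real.sqrt_sq (norm_nonneg _)]

lemma tendstoInProb_norm_add_ridgeErr (H : Regime R σ γ n d w₀ σ₀) (ht : 0 < t) (hγ : 0 < γ) :
    TendstoInProb (fun k => featNoiseLaw (n k) (d k))
      (fun k p => ‖w₀ k + ridgeErr t (w₀ k) (σ₀ k) p‖ / √(d k)) √(limNorm R σ t γ) := by
  refine ((tendstoInProb_norm_add_ridgeErr_sq H ht hγ).map
    Real.continuous_sqrt.continuousAt).congr' (.of_forall fun k p => ?_)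
  rw [Real.sqrt_div (sq_nonneg _), Real.sqrt_sq (norm_nonneg _)]

end PositiveRegularization

/-! ### Solutions of the normal equations -/

/-- If `S ≥ c` then shifting `S` by `τ` perturbs the solution of a linear system little. -/
lemma norm_sub_le_of_le_sampleCov {n d : ℕ} {c τ : ℝ} (hc : 0 < c) (hτ : 0 < τ)
    {X : Fin n → E d} (hX : ∀ u : E d, c * ‖u‖ ^ 2 ≤ inner ℝ u (sampleCov X u)) {v v' : E d}
    (h : sampleCov X v = sampleCov X v' + τ • v') : ‖v - v'‖ ≤ τ / c * ‖v'‖ := by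
  have h1 := hX (v - v')
  rw [map_sub, h, add_sub_cancel_left, real_inner_smul_right] at h1
  have h2 : c * ‖v - v'‖ ^ 2 ≤ τ * (‖v - v'‖ * ‖v'‖) :=
    h1.trans (mul_le_mul_of_nonneg_left (real_inner_le_norm _ _) hτ.le)
  rcases (norm_nonneg (v - v')).eq_or_lt with h0 | h0
  · rw [← h0]; positivity
  · rw [div_mul_eq_mul_div, le_div_iff₀ hc]
    nlinarith

section NormalEquations

variable {γ R σ : ℝ} {n d : ℕ → ℕ} {w₀ : ∀ k, E (d k)} {σ₀ : ℕ → ℝ≥0}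
  {v : ∀ k, (Fin (n k) → E (d k)) × E (n k) → E (d k)}

lemma eq_add_ridgeErr {t : ℝ} (ht : 0 < t) (hv : ∀ k p, sampleCov p.1 (v k p) + t • v k p
      = sampleCov p.1 (w₀ k) + (σ₀ k : ℝ) • noiseMap p.1 p.2)
    (k : ℕ) (p : (Fin (n k) → E (d k)) × E (n k)) :
    v k p = w₀ k + ridgeErr t (w₀ k) (σ₀ k) p := by
  rw [add_ridgeErr ht, ← hv, resolvent_shift_apply ht]

/-- Limits for ridgeless solutions follow from limits for ridge solutions, when the sample
covariance is bounded below with high probability. -/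
lemma tendstoInProb_norm_sub_of_ridge (H : Regime R σ γ n d w₀ σ₀) (hγ0 : 0 < γ) (hγ1 : γ < 1)
    {c : ℝ} (hc : 0 < c) (hS : Tendsto (fun k => (featLaw (n k) (d k))
      {X | ¬ ∀ u : E (d k), c * ‖u‖ ^ 2 ≤ inner ℝ u (sampleCov X u)}) atTop (𝓝 0))
    (hv : ∀ k p, sampleCov p.1 (v k p)
      = sampleCov p.1 (w₀ k) + (σ₀ k : ℝ) • noiseMap p.1 p.2)
    {a : ∀ k, E (d k)} {l : ℝ → ℝ} (hl : Tendsto l (𝓝[>] 0) (𝓝 (l 0)))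
    (ha : ∀ τ, 0 < τ → TendstoInProb (fun k => featNoiseLaw (n k) (d k))
      (fun k p => ‖w₀ k + ridgeErr τ (w₀ k) (σ₀ k) p - a k‖ / √(d k)) (l τ)) :
    TendstoInProb (fun k => featNoiseLaw (n k) (d k))
      (fun k p => ‖v k p - a k‖ / √(d k)) (l 0) := by
  refine .of_approx fun δ hδ => ?_
  have hD : 0 < ((0 : ℝ) + 1 - γ) + √(((0 : ℝ) + 1 - γ) ^ 2 + 4 * γ * 0) :=
    add_pos_of_pos_of_nonneg (by linarith) (Real.sqrt_nonneg _)
  -- for small `τ`, ridge solutions differ from ridgeless ones by less than `δ`, up to scaling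
  have h1 : Tendsto (fun τ => τ * √(limNorm R σ τ γ)) (𝓝[>] 0) (𝓝 0) := by
    have h : ContinuousAt (fun τ => τ * √(limNorm R σ τ γ)) 0 :=
      continuousAt_id.mul (ContinuousAt.sqrt (ContinuousAt.comp (f := fun τ : ℝ => (τ, γ))
        (continuousAt_limNorm R σ le_rfl hγ0.le hD) (by fun_prop)))
    simpa using h.tendsto.mono_left nhdsWithin_le_nhds
  obtain ⟨τ, ⟨hτl, hτ1⟩, hτ⟩ := (((Metric.tendsto_nhds.1 hl δ hδ).and
    (h1.eventually_lt_const (mul_pos hδ hc))).and self_mem_nhdsWithin).exists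
  have hτ0 : 0 < τ := hτ
  refine ⟨_, l τ, ha τ hτ0, hτl, ?_⟩
  have h2 := (tendstoInProb_norm_add_ridgeErr H hτ0 hγ0).of_le (B := δ * c / τ)
    (by rw [lt_div_iff₀ hτ0]; linarith)
  have h3 : Tendsto (fun k => (featNoiseLaw (n k) (d k))
      ({X | ¬ ∀ u : E (d k), c * ‖u‖ ^ 2 ≤ inner ℝ u (sampleCov X u)} ×ˢ Set.univ))
      atTop (𝓝 0) := by
    refine hS.congr fun k => ?_
    rw [Measure.prod_prod, measure_univ, mul_one]
  have h23 := h3.add h2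
  rw [add_zero] at h23
  refine tendsto_of_tendsto_of_tendsto_of_le_of_le tendsto_const_nhds h23 (fun _ => zero_le) fun k =>
      (measure_mono fun p hp => ?_).trans (measure_union_le _ _)
  by_contra hcon
  simp only [Set.mem_union, Set.mem_prod, Set.mem_univ, and_true, Set.mem_ofPred_eq, not_or,
    not_not, not_le] at hcon hp
  obtain ⟨hX, hB⟩ := hcon
  set v' := w₀ k + ridgeErr τ (w₀ k) (σ₀ k) p with hv'
  have h4 : sampleCov p.1 (v k p) = sampleCov p.1 v' + τ • v' := by
    rw [hv, hv', add_ridgeErr hτ0, shift_resolvent_apply hτ0]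
  have h5 := norm_sub_le_of_le_sampleCov hc hτ0 hX h4
  have h6 : |‖v k p - a k‖ - ‖v' - a k‖| ≤ ‖v k p - v'‖ := by
    simpa using abs_norm_sub_norm_le (v k p - a k) (v' - a k)
  rw [← sub_div, abs_div, abs_of_nonneg (Real.sqrt_nonneg _)] at hp
  have h7 : |‖v k p - a k‖ - ‖v' - a k‖| / √(d k) ≤ τ / c * (‖v'‖ / √(d k)) := by
    rw [← mul_div_assoc]
    exact div_le_div_of_nonneg_right (h6.trans h5) (Real.sqrt_nonneg _)
  have h8 : τ / c * (‖v'‖ / √(d k)) < τ / c * (δ * c / τ) := by gcongr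
  have h9 : τ / c * (δ * c / τ) = δ := by field_simp
  linarith

end NormalEquations

/-- The norms of the estimation error and of the estimator converge, for any solution of the normal
equation. At `t = 0` this needs a small aspect ratio, so that the sample covariance is bounded
below with high probability. -/
theorem exists_tendstoInProb_norm : ∃ γ₁ : ℝ, 0 < γ₁ ∧ ∀ (R σ γ t : ℝ) (n d : ℕ → ℕ)
    (w₀ : ∀ k, E (d k)) (σ₀ : ℕ → ℝ≥0) (v : ∀ k, (Fin (n k) → E (d k)) × E (n k) → E (d k)),
    0 < γ → γ < γ₁ → 0 ≤ t → Regime R σ γ n d w₀ σ₀ →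
    (∀ k p, sampleCov p.1 (v k p) + t • v k p
      = sampleCov p.1 (w₀ k) + (σ₀ k : ℝ) • noiseMap p.1 p.2) →
    TendstoInProb (fun k => featNoiseLaw (n k) (d k))
      (fun k p => ‖v k p - w₀ k‖ / √(d k)) √(limErr R σ t γ) ∧
    TendstoInProb (fun k => featNoiseLaw (n k) (d k))
      (fun k p => ‖v k p‖ / √(d k)) √(limNorm R σ t γ) := by
  obtain ⟨c, γ₀, hc, hγ₀, hS⟩ := exists_tendsto_smallest_eigenvalue
  refine ⟨min γ₀ 1, lt_min hγ₀ one_pos, fun R σ γ t n d w₀ σ₀ v hγ hγ1 ht H hv => ?_⟩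
  rcases ht.eq_or_lt with rfl | ht
  · have hγ2 : γ < 1 := hγ1.trans_le (min_le_right _ _)
    have hD : 0 < ((0 : ℝ) + 1 - γ) + √(((0 : ℝ) + 1 - γ) ^ 2 + 4 * γ * 0) :=
      add_pos_of_pos_of_nonneg (by linarith) (Real.sqrt_nonneg _)
    have hS' := hS γ n d (hγ1.trans_le (min_le_left _ _)) H.n_top H.ratio
    have hv' : ∀ k p, sampleCov p.1 (v k p)
        = sampleCov p.1 (w₀ k) + (σ₀ k : ℝ) • noiseMap p.1 p.2 := fun k p => by
      simpa using hv k p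
    have hp : ContinuousAt (fun τ : ℝ => (τ, γ)) 0 := by fun_prop
    constructor
    · refine tendstoInProb_norm_sub_of_ridge (l := fun τ => √(limErr R σ τ γ)) H hγ hγ2 hc hS' hv'
        ?_ fun τ hτ => ?_
      · exact (ContinuousAt.sqrt (ContinuousAt.comp (f := fun τ : ℝ => (τ, γ))
          (continuousAt_limErr R σ le_rfl hγ.le hD) hp)).tendsto.mono_left nhdsWithin_le_nhds
      · simpa only [add_sub_cancel_left] using tendstoInProb_norm_ridgeErr H hτ hγ
    · have h := tendstoInProb_norm_sub_of_ridge (a := fun _ => 0)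
        (l := fun τ => √(limNorm R σ τ γ)) H hγ hγ2 hc hS' hv' ?_ fun τ hτ => ?_
      · simpa only [sub_zero] using h
      · exact (ContinuousAt.sqrt (ContinuousAt.comp (f := fun τ : ℝ => (τ, γ))
          (continuousAt_limNorm R σ le_rfl hγ.le hD) hp)).tendsto.mono_left nhdsWithin_le_nhds
      · simpa only [sub_zero] using tendstoInProb_norm_add_ridgeErr H hτ hγ
  · have hv' := eq_add_ridgeErr ht hv
    constructor
    · refine (tendstoInProb_norm_ridgeErr H ht hγ).congr' (.of_forall fun k p => ?_)
      rw [hv', add_sub_cancel_left]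
    · refine (tendstoInProb_norm_add_ridgeErr H ht hγ).congr' (.of_forall fun k p => ?_)
      rw [hv']

/-! ### Datasets as images of Gaussian features and standardized noise -/

section Datasets

variable {n d : ℕ}

/-- The affine change of variables `(x, z) ↦ (x, ⟪x, w₀⟫ + σ₀ z)`. -/
noncomputable def sampleEquiv (w₀ : E d) {σ₀ : ℝ} (hσ : σ₀ ≠ 0) : E d × ℝ ≃ᵐ E d × ℝ where
  toFun p := (p.1, inner ℝ p.1 w₀ + σ₀ * p.2)
  invFun p := (p.1, σ₀⁻¹ * (p.2 - inner ℝ p.1 w₀))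
  left_inv p := by simp [hσ]
  right_inv p := by simp [hσ]
  measurable_toFun := by
    simp only [Equiv.coe_fn_mk]
    fun_prop
  measurable_invFun := by
    simp only [Equiv.coe_fn_symm_mk]
    fun_prop

lemma measurePreserving_sampleEquiv (w₀ : E d) {σ₀ : ℝ≥0} (hσ : (σ₀ : ℝ) ≠ 0) :
    MeasurePreserving (sampleEquiv w₀ hσ) ((stdGaussian (E d)).prod (gaussianReal 0 1))
      (sampleLaw w₀ σ₀) := by
  refine ⟨(sampleEquiv w₀ hσ).measurable, ?_⟩
  have h1 : (gaussianReal 0 1).map (fun z => (σ₀ : ℝ) * z) = gaussianReal 0 (σ₀ ^ 2) := by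
    rw [gaussianReal_map_const_mul, mul_zero, mul_one]
    rfl
  have h2 : Measurable fun p : E d × ℝ => (p.1, inner ℝ p.1 w₀ + p.2) := by fun_prop
  have h3 := Measure.map_prod_map (f := fun x : E d => x) (g := fun z => (σ₀ : ℝ) * z)
    (stdGaussian (E d)) (gaussianReal 0 1) measurable_id (by fun_prop)
  rw [Measure.map_id', h1] at h3
  rw [sampleLaw, h3, Measure.map_map h2 (by fun_prop)]
  rfl

instance (w₀ : E d) (σ₀ : ℝ≥0) : IsProbabilityMeasure (sampleLaw w₀ σ₀) :=
  Measure.isProbabilityMeasure_map (by fun_prop)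

/-- A dataset, as a function of its features and its standardized noise. -/
noncomputable def dataMap (w₀ : E d) (σ₀ : ℝ) (p : (Fin n → E d) × E n) : Data n d :=
  fun i => (p.1 i, inner ℝ (p.1 i) w₀ + σ₀ * p.2 i)

/-- The map `dataMap` is bimeasurable unless the noise vanishes, so that laws are transported even
on sets that are not measurable. -/
noncomputable def dataEquiv (n : ℕ) (w₀ : E d) {σ₀ : ℝ} (hσ : σ₀ ≠ 0) :
    (Fin n → E d) × E n ≃ᵐ Data n d :=
  ((MeasurableEquiv.prodCongr (.refl _) (MeasurableEquiv.toLp 2 (Fin n → ℝ)).symm).trans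
    (MeasurableEquiv.arrowProdEquivProdArrow (E d) ℝ (Fin n)).symm).trans
    (.piCongrRight fun _ => sampleEquiv w₀ hσ)

lemma coe_dataEquiv (w₀ : E d) {σ₀ : ℝ} (hσ : σ₀ ≠ 0) :
    ⇑(dataEquiv n w₀ hσ) = dataMap w₀ σ₀ := rfl

lemma measurePreserving_dataEquiv (w₀ : E d) {σ₀ : ℝ≥0} (hσ : (σ₀ : ℝ) ≠ 0) :
    MeasurePreserving (dataEquiv n w₀ hσ) (featNoiseLaw n d) (dataLaw n w₀ σ₀) := by
  have h1 : MeasurePreserving (MeasurableEquiv.toLp 2 (Fin n → ℝ))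
      (Measure.pi fun _ => gaussianReal 0 1) (stdGaussian (E n)) :=
    ⟨MeasurableEquiv.measurable _, map_pi_eq_stdGaussian⟩
  have h2 := (MeasurePreserving.id (featLaw n d)).prod (h1.symm _)
  have h3 := (measurePreserving_arrowProdEquivProdArrow (E d) ℝ (Fin n)
    (fun _ => stdGaussian (E d)) (fun _ => gaussianReal 0 1)).symm
  have h4 := measurePreserving_pi (fun _ : Fin n => (stdGaussian (E d)).prod (gaussianReal 0 1))
    (fun _ => sampleLaw w₀ σ₀) (f := fun _ => sampleEquiv w₀ hσ)
    (fun _ => measurePreserving_sampleEquiv w₀ hσ)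
  exact h4.comp (h3.comp h2)

lemma dataLaw_apply (w₀ : E d) {σ₀ : ℝ≥0} (hσ : (σ₀ : ℝ) ≠ 0) (s : Set (Data n d)) :
    dataLaw n w₀ σ₀ s = featNoiseLaw n d (dataMap w₀ σ₀ ⁻¹' s) := by
  rw [← (measurePreserving_dataEquiv w₀ hσ).map_eq, MeasurableEquiv.map_apply, coe_dataEquiv]

lemma feats_dataMap (w₀ : E d) (σ₀ : ℝ) (p : (Fin n → E d) × E n) :
    feats (dataMap w₀ σ₀ p) = p.1 := rfl

lemma crossMoment_dataMap (w₀ : E d) (σ₀ : ℝ) (p : (Fin n → E d) × E n) :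
    crossMoment (dataMap w₀ σ₀ p) = sampleCov p.1 w₀ + σ₀ • noiseMap p.1 p.2 := by
  simp_rw [crossMoment, dataMap, add_smul, Finset.sum_add_distrib, smul_add,
    sampleCov_apply, noiseMap_apply, mul_smul, ← Finset.smul_sum]
  rw [smul_comm σ₀]

end Datasets

/-! ### Limits of the risks -/

section Limits

variable {R σ γ : ℝ} {n d : ℕ → ℕ} {w₀ : ∀ k, E (d k)} {σ₀ : ℕ → ℝ≥0}

lemma Regime.eventually_noise_pos (H : Regime R σ γ n d w₀ σ₀) (hσ : 0 < σ) :
    ∀ᶠ k in atTop, (σ₀ k : ℝ) ≠ 0 := by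
  filter_upwards [H.noise.eventually_const_lt (by positivity : 0 < σ ^ 2)] with k hk h
  rw [h] at hk
  simp at hk

lemma Regime.eventually_signal_ne_zero (H : Regime R σ γ n d w₀ σ₀) (hR : 0 < R) :
    ∀ᶠ k in atTop, w₀ k ≠ 0 := by
  filter_upwards [H.signal.eventually_const_lt (by positivity : 0 < R ^ 2)] with k hk h
  rw [h] at hk
  simp at hk

lemma Regime.tendsto_optRisk (H : Regime R σ γ n d w₀ σ₀) (hR : 0 < R) {r ε : ℝ} (hr : 0 ≤ r)
    (hε0 : 0 ≤ ε) (hε1 : ε ≤ 1) :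
    Tendsto (fun k => optRisk (w₀ k) (σ₀ k) r ε / (d k : ℝ)) atTop
      (𝓝 (segRisk r (R ^ 2) (σ ^ 2) ε)) := by
  have h := ((continuous_segRisk r).tendsto ((R ^ 2, σ ^ 2), ε)).comp
    ((H.signal.prodMk_nhds H.noise).prodMk_nhds (tendsto_const_nhds (x := ε)))
  refine h.congr' ?_
  filter_upwards [H.eventually_signal_ne_zero hR] with k hk
  simp only [Function.comp_apply]
  rw [optRisk_eq hk _ hr hε0 hε1, div_eq_inv_mul, div_eq_inv_mul, div_eq_inv_mul,
    segRisk_smul r ε (by positivity)]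

lemma Regime.tendsto_optRiskLe (H : Regime R σ γ n d w₀ σ₀) (hR : 0 < R) {r ε : ℝ} (hr : 0 ≤ r)
    (hε0 : 0 ≤ ε) (hε1 : ε ≤ 1) :
    Tendsto (fun k => optRiskLe (w₀ k) (σ₀ k) r ε / (d k : ℝ)) atTop
      (𝓝 (sInf (segRisk r (R ^ 2) (σ ^ 2) '' Set.Icc 0 ε))) := by
  have h := ((continuous_sInf_segRisk r ε).tendsto (R ^ 2, σ ^ 2)).comp
    (H.signal.prodMk_nhds H.noise)
  refine h.congr' ?_
  filter_upwards [H.eventually_signal_ne_zero hR] with k hk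
  simp only [Function.comp_apply]
  rw [optRiskLe_eq hk _ hr hε0 hε1, div_eq_inv_mul, div_eq_inv_mul, div_eq_inv_mul,
    sInf_segRisk_smul r ε (by positivity)]

/-- The limiting risk per dimension of the ridge estimator, before the limit `γ → 0`. The norms
converge to `√limErr` and `√limNorm`; keeping the squared root avoids the nonnegativity of
`limErr`. -/
noncomputable def limRisk (r R σ t g : ℝ) : ℝ :=
  riskOf r √(√(limErr R σ t g) ^ 2 + σ ^ 2) √(limNorm R σ t g)

/-- Convergence in probability may be checked on features and standardized noise. Nothing is assumed
on the measurability of `f`. -/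
lemma Regime.tendstoInProb_of_dataMap (H : Regime R σ γ n d w₀ σ₀) (hσ : 0 < σ)
    {f : ∀ k, Data (n k) (d k) → ℝ} {f' : ∀ k, (Fin (n k) → E (d k)) × E (n k) → ℝ} {l : ℝ}
    (hf' : TendstoInProb (fun k => featNoiseLaw (n k) (d k)) f' l)
    (h : ∀ᶠ k in atTop, ∀ p, f k (dataMap (w₀ k) (σ₀ k) p) = f' k p) :
    TendstoInProb (fun k => dataLaw (n k) (w₀ k) (σ₀ k)) f l := by
  intro η hη
  refine (hf' η hη).congr' ?_
  filter_upwards [h, H.eventually_noise_pos hσ] with k hk hσk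
  rw [dataLaw_apply (w₀ k) hσk]
  simp only [Set.preimage_ofPred_eq, hk]

/-- The asymptotics of adversarial training: the excess risk and the adversarial risk converge in
probability. -/
theorem exists_tendstoInProb_risk : ∃ γ₁ : ℝ, 0 < γ₁ ∧ ∀ (R σ γ s r : ℝ) (n d : ℕ → ℕ)
    (w₀ : ∀ k, E (d k)) (σ₀ : ℕ → ℝ≥0) (what : ∀ k, Data (n k) (d k) → E (d k)),
    0 < R → 0 < σ → 0 < γ → γ < γ₁ → 0 ≤ r → Regime R σ γ n d w₀ σ₀ →
    (∀ k D, IsTrained D s (what k D)) →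
    TendstoInProb (fun k => dataLaw (n k) (w₀ k) (σ₀ k))
      (fun k D => excessRisk (w₀ k) (σ₀ k) (what k D)) (√(limErr R σ (s ^ 2) γ) ^ 2 / R ^ 2) ∧
    TendstoInProb (fun k => dataLaw (n k) (w₀ k) (σ₀ k))
      (fun k D => advRisk (w₀ k) (σ₀ k) (what k D) r / (d k : ℝ)) (limRisk r R σ (s ^ 2) γ) := by
  obtain ⟨γ₁, hγ₁, hmain⟩ := exists_tendstoInProb_norm
  refine ⟨γ₁, hγ₁, fun R σ γ s r n d w₀ σ₀ what hR hσ hγ hγ1 hr H hw => ?_⟩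
  set v : ∀ k, (Fin (n k) → E (d k)) × E (n k) → E (d k) :=
    fun k p => what k (dataMap (w₀ k) (σ₀ k) p) with hvdef
  have hv : ∀ k p, sampleCov p.1 (v k p) + s ^ 2 • v k p
      = sampleCov p.1 (w₀ k) + (σ₀ k : ℝ) • noiseMap p.1 p.2 := fun k p => by
    have h := (isTrained_iff _ s _).1 (hw k (dataMap (w₀ k) (σ₀ k) p))
    rwa [feats_dataMap, crossMoment_dataMap] at h
  obtain ⟨h1, h2⟩ := hmain R σ γ (s ^ 2) n d w₀ σ₀ v hγ hγ1 (sq_nonneg s) H hv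
  constructor
  · have h3 := (h1.mul h1).mul (.of_tendsto (H.signal.inv₀ (by positivity)))
    have hl : √(limErr R σ (s ^ 2) γ) ^ 2 / R ^ 2
        = √(limErr R σ (s ^ 2) γ) * √(limErr R σ (s ^ 2) γ) * (R ^ 2)⁻¹ := by ring
    rw [hl]
    refine H.tendstoInProb_of_dataMap hσ h3 ?_
    filter_upwards [H.d_top.eventually_gt_atTop 0] with k hdk p
    have hdk' : (0 : ℝ) < d k := by exact_mod_cast hdk
    rw [excessRisk_eq, inv_div, div_mul_div_comm, Real.mul_self_sqrt hdk'.le,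
      div_mul_div_cancel₀ hdk'.ne', ← sq]
  · have h3 := ((h1.mul h1).add (.of_tendsto H.noise)).map₂ h2
      (φ := fun q : ℝ × ℝ => riskOf r √q.1 q.2) (by
        have := continuous_riskOf r
        exact (this.comp (by fun_prop : Continuous fun q : ℝ × ℝ => (√q.1, q.2))).continuousAt)
    have hl : limRisk r R σ (s ^ 2) γ = riskOf r √(√(limErr R σ (s ^ 2) γ)
        * √(limErr R σ (s ^ 2) γ) + σ ^ 2) √(limNorm R σ (s ^ 2) γ) := by
      rw [limRisk, ← sq]
    rw [hl]
    refine H.tendstoInProb_of_dataMap hσ h3 ?_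
    filter_upwards [H.d_top.eventually_gt_atTop 0] with k hdk p
    have hdk' : (0 : ℝ) < d k := by exact_mod_cast hdk
    have h4 : √(‖v k p - w₀ k‖ / √(d k) * (‖v k p - w₀ k‖ / √(d k)) + (σ₀ k : ℝ) ^ 2 / d k)
        = 1 / √(d k) * √(‖v k p - w₀ k‖ ^ 2 + (σ₀ k : ℝ) ^ 2) := by
      rw [div_mul_div_comm, Real.mul_self_sqrt hdk'.le, ← add_div, ← sq,
        Real.sqrt_div (by positivity)]
      ring
    have h5 : (1 / √(d k : ℝ)) ^ 2 = 1 / d k := by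
      rw [div_pow, one_pow, Real.sq_sqrt hdk'.le]
    rw [advRisk_eq _ _ _ hr, h4, div_eq_mul_one_div ‖v k p‖, mul_comm ‖v k p‖, riskOf_smul, h5]
    ring

end Limits

lemma tendsto_limErr_div {R σ t ε : ℝ} (hR : 0 < R) (ht : 0 ≤ t) (hε : t / (1 + t) = ε) :
    Tendsto (fun γ => √(limErr R σ t γ) ^ 2 / R ^ 2) (𝓝[>] 0) (𝓝 (ε ^ 2)) := by
  have hD : 0 < (t + 1 - 0) + √((t + 1 - 0) ^ 2 + 4 * 0 * t) :=
    add_pos_of_pos_of_nonneg (by linarith) (Real.sqrt_nonneg _)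
  have h : ContinuousAt (fun γ => √(limErr R σ t γ) ^ 2 / R ^ 2) 0 :=
    ((ContinuousAt.sqrt (ContinuousAt.comp (f := fun γ : ℝ => (t, γ))
      (continuousAt_limErr R σ ht le_rfl hD) (by fun_prop))).pow 2).div_const _
  have hl : √(limErr R σ t 0) ^ 2 / R ^ 2 = ε ^ 2 := by
    rw [limErr_zero_right R σ ht, Real.sq_sqrt (by positivity), hε]
    field_simp
  rw [← hl]
  exact h.tendsto.mono_left nhdsWithin_le_nhds

lemma tendsto_limRisk {r R σ t ε : ℝ} (hR : 0 < R) (ht : 0 ≤ t) (hε : t / (1 + t) = ε)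
    (hε1 : ε ≤ 1) :
    Tendsto (fun γ => limRisk r R σ t γ) (𝓝[>] 0) (𝓝 (segRisk r (R ^ 2) (σ ^ 2) ε)) := by
  have hD : 0 < (t + 1 - 0) + √((t + 1 - 0) ^ 2 + 4 * 0 * t) :=
    add_pos_of_pos_of_nonneg (by linarith) (Real.sqrt_nonneg _)
  have hp : ContinuousAt (fun γ : ℝ => (t, γ)) 0 := by fun_prop
  have h1 : ContinuousAt (fun γ => √(limErr R σ t γ)) 0 :=
    ContinuousAt.sqrt (ContinuousAt.comp (f := fun γ : ℝ => (t, γ))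
      (continuousAt_limErr R σ ht le_rfl hD) hp)
  have h2 : ContinuousAt (fun γ => √(limNorm R σ t γ)) 0 :=
    ContinuousAt.sqrt (ContinuousAt.comp (f := fun γ : ℝ => (t, γ))
      (continuousAt_limNorm R σ ht le_rfl hD) hp)
  have h : ContinuousAt (fun γ => limRisk r R σ t γ) 0 :=
    ContinuousAt.comp (g := fun p : ℝ × ℝ => riskOf r p.1 p.2)
      (f := fun γ => (√(√(limErr R σ t γ) ^ 2 + σ ^ 2), √(limNorm R σ t γ)))
      (continuous_riskOf r).continuousAt
      ((ContinuousAt.sqrt ((h1.pow 2).add continuousAt_const)).prodMk h2)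
  have hl : limRisk r R σ t 0 = segRisk r (R ^ 2) (σ ^ 2) ε := by
    have h3 : √((1 - ε) ^ 2 * R ^ 2) = (1 - ε) * √(R ^ 2) := by
      rw [Real.sqrt_mul (sq_nonneg _), Real.sqrt_sq (by linarith)]
    rw [limRisk, limErr_zero_right R σ ht, limNorm_zero_right R σ ht,
      Real.sq_sqrt (by positivity), hε, h3, segRisk]
  rw [← hl]
  exact h.tendsto.mono_left nhdsWithin_le_nhds

end AdvReg

open AdvReg in
theorem mainTheorem3 :
    -- reduction of adversarial training to ridge regression, up to absolute constants
    (∀ (n d : ℕ) (D : Data n d) (s : ℝ), 0 < n → 0 ≤ s →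
      (∀ w : E d, ridgeObj D s w ≤ empAdvRisk D s w ∧ empAdvRisk D s w ≤ 2 * ridgeObj D s w) ∧
      (∃ w : E d, IsTrained D s w) ∧
      (0 < s → ∀ w : E d, IsTrained D s w ↔ w = ridge D (s ^ 2))) ∧
    -- the iterated limits, with absolute constants `c`, `C`
    ∃ c C : ℝ, 0 < c ∧ 0 < C ∧
      ∀ R σ r ε : ℝ, 0 < R → 0 < σ → 0 ≤ r → 0 ≤ ε → ε < 1 →
        ∃ (excessLim riskLim : ℝ → ℝ) (L M M' : ℝ),
          (∀ᶠ γ in 𝓝[>] (0 : ℝ),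
            ∀ (n d : ℕ → ℕ) (w₀ : ∀ k, E (d k)) (σ₀ : ℕ → ℝ≥0)
              (what : ∀ k, Data (n k) (d k) → E (d k)),
              Regime R σ γ n d w₀ σ₀ →
              (∀ k D, IsTrained D (Real.sqrt (ε / (1 - ε))) (what k D)) →
              TendstoInProb (fun k => dataLaw (n k) (w₀ k) (σ₀ k))
                (fun k D => excessRisk (w₀ k) (σ₀ k) (what k D)) (excessLim γ) ∧
              TendstoInProb (fun k => dataLaw (n k) (w₀ k) (σ₀ k))
                (fun k D => advRisk (w₀ k) (σ₀ k) (what k D) r / (d k : ℝ)) (riskLim γ) ∧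
              Tendsto (fun k => optRisk (w₀ k) (σ₀ k) r ε / (d k : ℝ)) atTop (𝓝 M) ∧
              Tendsto (fun k => optRiskLe (w₀ k) (σ₀ k) r ε / (d k : ℝ)) atTop (𝓝 M')) ∧
          Tendsto excessLim (𝓝[>] 0) (𝓝 (ε ^ 2)) ∧
          Tendsto riskLim (𝓝[>] 0) (𝓝 L) ∧
          c * M ≤ L ∧ L ≤ C * M ∧
          c * M' ≤ L ∧ L ≤ C * (1 + R ^ 2 / σ ^ 2) * M' ∧
          (ε ≤ r ^ 2 / (1 + r ^ 2) → L ≤ C * M') := by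
  refine ⟨fun n d D s hn hs => ⟨ridgeObj_le_empAdvRisk hn D hs, exists_isTrained D hs,
    fun hs' => isTrained_iff_eq_ridge D hs'⟩, 1, 2, one_pos, two_pos,
    fun R σ r ε hR hσ hr hε0 hε1 => ?_⟩
  obtain ⟨γ₁, hγ₁, hmain⟩ := exists_tendstoInProb_risk
  set t := ε / (1 - ε) with ht_def
  have h1ε : 0 < 1 - ε := by linarith
  have ht : 0 ≤ t := div_nonneg hε0 h1ε.le
  have hst : √t ^ 2 = t := Real.sq_sqrt ht
  -- for `γ → 0` ridge regression shrinks `w₀` by the factor `1 / (1 + t) = 1 - ε`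
  have htε : t / (1 + t) = ε := by
    rw [ht_def]
    field_simp
    ring
  set M := segRisk r (R ^ 2) (σ ^ 2) ε with hM_def
  have hM : 0 ≤ M := segRisk_nonneg hr hε1.le
  have hR2 : (0 : ℝ) < R ^ 2 := by positivity
  have hσ2 : (0 : ℝ) < σ ^ 2 := by positivity
  obtain ⟨e, he, hmin⟩ := exists_isLeast_segRisk r (R ^ 2) (σ ^ 2) hε0
  have hM' : sInf (segRisk r (R ^ 2) (σ ^ 2) '' Set.Icc 0 ε) = segRisk r (R ^ 2) (σ ^ 2) e :=
    hmin.csInf_eq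
  -- the limiting estimator is `(1 - ε) w₀`, which is optimal: the limits `L` and `M` coincide
  refine ⟨fun γ => √(limErr R σ t γ) ^ 2 / R ^ 2, limRisk r R σ t, M, M,
    segRisk r (R ^ 2) (σ ^ 2) e, ?_, tendsto_limErr_div hR ht htε,
    tendsto_limRisk hR ht htε hε1.le, by linarith, by linarith, ?_,
    segRisk_le_ratio_mul hr hR2.le hσ2 he.1 he.2 hε1.le,
    fun hεr => segRisk_le_of_le_ratio hr hR2.le hσ2.le he.2 hε1.le hεr⟩
  · filter_upwards [Ioo_mem_nhdsGT hγ₁] with γ hγ n d w₀ σ₀ what H hw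
    have h := hmain R σ γ √t r n d w₀ σ₀ what hR hσ hγ.1 hγ.2 hr H hw
    rw [hst] at h
    refine ⟨h.1, h.2, H.tendsto_optRisk hR hr hε0 hε1.le, ?_⟩
    rw [← hM']
    exact H.tendsto_optRiskLe hR hr hε0 hε1.le
  · rw [one_mul]
    exact hmin.2 ⟨ε, ⟨hε0, le_rfl⟩, rfl⟩
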